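/- Let $G=\mathrm{SU}(2)$ or $G=\mathrm{SO}(3)$, and let $X_1,X_2,X_3$ be an orthonormal basis of the Lie algebra of $G$ with respect to the invariant inner product $\langle X,Y\rangle=-\tfrac12\operatorname{tr}(XY)$. For an irreducible continuous unitary representation $\pi$ of $G$ let $K_\pi=\sum_i d\pi(X_i)^2=-\kappa_\pi I_\pi$ be its Casimir operator (so that $\kappa$ takes the values $n(n+2)$ on $\mathrm{SU}(2)$ and $n(n+1)$ on $\mathrm{SO}(3)$, $n=0,1,2,\dots$). For $\eta:\mathbb R\to\mathbb R$, the convolution semigroup induced by $\eta$ is a vaguely continuous convolution semigroup $(\mu_t)_{t\ge0}$ of Borel probability measures on $G$ with $\mu_0=\delta_e$ and $$\int_G\pi(g)\,\mu_t(dg)=e^{-t\eta(\kappa_\pi^{1/2})}I_\pi\qquad\text{for all irreducible } \pi \text{ and all } t\ge 0 .$$ For each of the exponents $\eta$ and groups listed below such a semigroup exists, and for every $t>0$ the measure $\mu_t$ has a continuous density $k_t\ge0$ with respect to normalized Haar measure. Moreover, as $t\to0^+$: 1. (Cauchy semigroup) if $\eta(u)=\sigma|u|$ with $\sigma>0$,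 then $k_t(e)\sim\dfrac{2}{\sigma^3t^3}$ on $\mathrm{SU}(2)$ and $k_t(e)\sim\dfrac{8}{\sigma^3t^3}$ on $\mathrm{SO}(3)$. 2. (Heat semigroup) if $\eta(u)=\tfrac12\sigma^2u^2$ with $\sigma>0$, then $k_t(e)\sim\dfrac{\sqrt{\pi/2}}{\sigma^3}\,t^{-3/2}$ on $\mathrm{SU}(2)$ and $k_t(e)\sim\dfrac{2\sqrt{2\pi}}{\sigma^3}\,t^{-3/2}$ on $\mathrm{SO}(3)$. In particular, on each of the two groups, the density at $e$ of any Cauchy semigroup blows up much faster than that of any heat semigroup: the heat density $h_t(e)$ and the Cauchy density $k_t(e)$ satisfy $h_t(e)=o(k_t(e))$. 3. (Relativistic Schrödinger semigroup) if $\eta(u)=\sqrt{m^2+u^2}-m$ with $m>0$, then on $\mathrm{SU}(2)$ one has $k_t(e)\sim\dfrac{2}{t^3}$, the same asymptotics as for the Cauchy semigroup with $\sigma=1$. -/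

import Mathlib

open MeasureTheory Filter Topology Asymptotics

namespace CompactLie

/-! ### The groups `SU(2)` and `SO(3)` as compact topological groups with Borel σ-algebra -/

section Groups

variable {n : ℕ} {𝕜 : Type} [RCLike 𝕜]

theorem continuous_star_specialUnitary :
    Continuous (fun A : Matrix.specialUnitaryGroup (Fin n) 𝕜 => star A) :=
  Continuous.subtype_mk (continuous_subtype_val.matrix_conjTranspose) _

instance instTopGroup : IsTopologicalGroup (Matrix.specialUnitaryGroup (Fin n) 𝕜) where
  continuous_inv := continuous_star_specialUnitary

instance instCompact : CompactSpace (Matrix.specialUnitaryGroup (Fin n) 𝕜) := by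
  have hcl : IsClosed
      ((Matrix.specialUnitaryGroup (Fin n) 𝕜 : Submonoid _) : Set (Matrix (Fin n) (Fin n) 𝕜)) := by
    have : ((Matrix.specialUnitaryGroup (Fin n) 𝕜 : Submonoid _) :
        Set (Matrix (Fin n) (Fin n) 𝕜)) = {A | A * star A = 1} ∩ {A | A.det = 1} := by
      ext A
      simp [Matrix.mem_specialUnitaryGroup_iff, Matrix.mem_unitaryGroup_iff]
    rw [this]
    refine IsClosed.inter (isClosed_eq ?_ continuous_const) (isClosed_eq ?_ continuous_const)
    · exact continuous_id.mul continuous_id.matrix_conjTranspose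
    · exact continuous_id.matrix_det
  have hK : IsCompact (Set.univ.pi fun _ : Fin n => Set.univ.pi fun _ : Fin n =>
      Metric.closedBall (0 : 𝕜) 1) :=
    isCompact_univ_pi fun _ => isCompact_univ_pi fun _ => isCompact_closedBall _ _
  refine isCompact_iff_compactSpace.mp ?_
  refine hK.of_isClosed_subset hcl ?_
  intro A hA i _ j _
  simpa using entry_norm_bound_of_unitary (Matrix.specialUnitaryGroup_le_unitaryGroup hA) i j

instance instMeas : MeasurableSpace (Matrix.specialUnitaryGroup (Fin n) 𝕜) := borel _

instance instBorel : BorelSpace (Matrix.specialUnitaryGroup (Fin n) 𝕜) := ⟨rfl⟩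

end Groups

/-- `SU(2)`. -/
abbrev SU2 : Type := Matrix.specialUnitaryGroup (Fin 2) ℂ

/-- `SO(3)`: real `3 × 3` matrices with `A * Aᵀ = 1` and determinant one (the star operation of a
real matrix is the transpose). -/
abbrev SO3 : Type := Matrix.specialUnitaryGroup (Fin 3) ℝ

/-- The one-parameter subgroups `s ↦ exp (s X)` of `SU(2)` for `X = i σ_x, i σ_y, i σ_z` (Pauli
matrices). These three `X` form an orthonormal basis of the Lie algebra `su(2)` with respect to
the invariant inner product `⟨X, Y⟩ = - tr (X Y) / 2`. -/
noncomputable def frameSU2 (i : Fin 3) (s : ℝ) : SU2 :=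
  ⟨![!![(Real.cos s : ℂ), Complex.I * Real.sin s; Complex.I * Real.sin s, Real.cos s],
     !![(Real.cos s : ℂ), Real.sin s; -Real.sin s, Real.cos s],
     !![Complex.exp (Complex.I * s), 0; 0, Complex.exp (-(Complex.I * s))]] i, by
    have h : (Complex.cos s) ^ 2 = 1 - (Complex.sin s) ^ 2 :=
      eq_sub_of_add_eq' (Complex.sin_sq_add_cos_sq s)
    have e : Complex.exp (Complex.I * s) * Complex.exp (-(Complex.I * s)) = 1 := by
      rw [← Complex.exp_add]; simp
    have e' : Complex.exp (-(Complex.I * s)) * Complex.exp (Complex.I * s) = 1 := by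
      rw [← Complex.exp_add]; simp
    rw [Matrix.mem_specialUnitaryGroup_iff, Matrix.mem_unitaryGroup_iff]
    fin_cases i
    · refine ⟨?_, ?_⟩
      · ext a b
        fin_cases a <;> fin_cases b <;>
          simp [Matrix.mul_apply, Matrix.star_apply, Fin.sum_univ_two, ← Complex.ofReal_cos,
            ← Complex.ofReal_sin, -Complex.ofReal_cos, -Complex.ofReal_sin] <;>
          (try simp only [Complex.ofReal_cos, Complex.ofReal_sin]) <;>
          ring_nf <;> (try simp [Complex.I_sq, h])
      · simp [Matrix.det_fin_two]
        ring_nf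
        simp [Complex.I_sq, h]
    · refine ⟨?_, ?_⟩
      · ext a b
        fin_cases a <;> fin_cases b <;>
          simp [Matrix.mul_apply, Matrix.star_apply, Fin.sum_univ_two, ← Complex.ofReal_cos,
            ← Complex.ofReal_sin, -Complex.ofReal_cos, -Complex.ofReal_sin] <;>
          (try simp only [Complex.ofReal_cos, Complex.ofReal_sin]) <;>
          ring_nf <;> (try simp [h])
      · simp [Matrix.det_fin_two]
        ring_nf
        simp [h]
    · refine ⟨?_, ?_⟩
      · ext a b
        fin_cases a <;> fin_cases b <;>
          simp [Matrix.mul_apply, Matrix.star_apply, Fin.sum_univ_two, ← Complex.exp_conj, e, e']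
      · simp [Matrix.det_fin_two, e]⟩

/-- The rotations of `ℝ³` by the angle `s` about the three coordinate axes, i.e. the one-parameter
subgroups `s ↦ exp (s X)` of `SO(3)` for the standard generators `X = L_x, L_y, L_z`. These three
`X` form an orthonormal basis of the Lie algebra `so(3)` with respect to the invariant inner
product `⟨X, Y⟩ = - tr (X Y) / 2`. -/
noncomputable def frameSO3 (i : Fin 3) (s : ℝ) : SO3 :=
  ⟨![!![1, 0, 0; 0, Real.cos s, -Real.sin s; 0, Real.sin s, Real.cos s],
     !![Real.cos s, 0, Real.sin s; 0, 1, 0; -Real.sin s, 0, Real.cos s],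
     !![Real.cos s, -Real.sin s, 0; Real.sin s, Real.cos s, 0; 0, 0, 1]] i, by
    have h : (Real.cos s) ^ 2 = 1 - (Real.sin s) ^ 2 := Real.cos_sq' s
    rw [Matrix.mem_specialUnitaryGroup_iff, Matrix.mem_unitaryGroup_iff]
    fin_cases i <;> refine ⟨?_, ?_⟩
    all_goals first
      | (ext a b
         fin_cases a <;> fin_cases b <;>
           simp [Matrix.mul_apply, Matrix.star_apply, Fin.sum_univ_three] <;>
           ring_nf <;> (try simp [h]))
      | (simp [Matrix.det_fin_three]
         ring_nf
         simp [h])⟩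

/-! ### Irreducible unitary representations, Casimir operator, Fourier transform -/

section General

variable {G : Type} [Group G] [TopologicalSpace G]

/-- A continuous irreducible unitary representation of `G` of dimension `d`, in matrix form. -/
structure UnitaryIrrep (G : Type) [Group G] [TopologicalSpace G] (d : ℕ) where
  toHom : G →* Matrix.unitaryGroup (Fin d) ℂ
  continuous_toHom : Continuous toHom
  dim_pos : 0 < d
  irreducible : ∀ W : Submodule ℂ (Fin d → ℂ),
    (∀ g : G, ∀ v ∈ W, Matrix.mulVec (toHom g : Matrix (Fin d) (Fin d) ℂ) v ∈ W) →
      W = ⊥ ∨ W = ⊤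

/-- The derived representation on the generator of the one-parameter subgroup `x`: the matrix
`d/ds π(x(s))` at `s = 0`, computed entrywise. -/
noncomputable def UnitaryIrrep.derived {d : ℕ} (π : UnitaryIrrep G d) (x : ℝ → G) :
    Matrix (Fin d) (Fin d) ℂ :=
  Matrix.of fun i j => deriv (fun s : ℝ => (π.toHom (x s) : Matrix (Fin d) (Fin d) ℂ) i j) 0

/-- The Casimir operator `K_π = ∑ i, dπ(X i)²`, where `x i` is the one-parameter subgroup generated
by the `i`-th vector `X i` of an orthonormal basis of the Lie algebra. -/
noncomputable def UnitaryIrrep.casimir {d : ℕ} (π : UnitaryIrrep G d) (x : Fin 3 → ℝ → G) :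
    Matrix (Fin d) (Fin d) ℂ :=
  ∑ i, π.derived (x i) * π.derived (x i)

variable [MeasurableSpace G]

/-- The Fourier transform `∫ π(g) μ(dg)` of a measure, computed entrywise. -/
noncomputable def UnitaryIrrep.fourier {d : ℕ} (π : UnitaryIrrep G d) (μ : Measure G) :
    Matrix (Fin d) (Fin d) ℂ :=
  Matrix.of fun i j => ∫ g, (π.toHom g : Matrix (Fin d) (Fin d) ℂ) i j ∂μ

/-- `(μ t)`, `t ≥ 0`, is a (vaguely) continuous convolution semigroup of probability measures on
the compact group `G` starting at `δ_e`, and it is induced by the characteristic exponent `η` on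
the real line: if the Casimir operator in `π` is `-κ I`, then the Fourier transform of `μ t` at `π`
is `exp (-t η(√κ)) I`. -/
structure IsInducedSemigroup (x : Fin 3 → ℝ → G) (η : ℝ → ℝ) (μ : ℝ → Measure G) : Prop where
  prob : ∀ t, 0 ≤ t → IsProbabilityMeasure (μ t)
  zero : μ 0 = Measure.dirac 1
  conv : ∀ s t, 0 ≤ s → 0 ≤ t → μ (s + t) = (μ s).mconv (μ t)
  cont : ∀ f : C(G, ℝ), ContinuousOn (fun t => ∫ g, f g ∂(μ t)) (Set.Ici 0)
  fourier : ∀ t, 0 ≤ t → ∀ (d : ℕ) (π : UnitaryIrrep G d) (κ : ℝ),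
    π.casimir x = (-κ : ℂ) • (1 : Matrix (Fin d) (Fin d) ℂ) →
      π.fourier (μ t) = (Real.exp (-t * η (√κ)) : ℂ) • (1 : Matrix (Fin d) (Fin d) ℂ)

variable [IsTopologicalGroup G] [CompactSpace G] [BorelSpace G]

/-- For every `t > 0`, `k t` is a continuous density of `μ t` with respect to normalized Haar
measure. -/
def IsContinuousDensity (μ : ℝ → Measure G) (k : ℝ → G → ℝ) : Prop :=
  ∀ t, 0 < t → Continuous (k t) ∧ (∀ g, 0 ≤ k t g) ∧
    μ t = (Measure.haarMeasure (⊤ : TopologicalSpace.PositiveCompacts G)).withDensity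
      (fun g => ENNReal.ofReal (k t g))

/-- The semigroup induced by `η` exists, it has a continuous density `k t` for every `t > 0`, and
`k t (e) ~ a t` as `t → 0+`. -/
def HasDensityAsymptotics (x : Fin 3 → ℝ → G) (η : ℝ → ℝ) (a : ℝ → ℝ) : Prop :=
  (∃ μ, IsInducedSemigroup x η μ) ∧
    ∀ μ, IsInducedSemigroup x η μ →
      (∃ k, IsContinuousDensity μ k) ∧
        ∀ k, IsContinuousDensity μ k → (fun t => k t 1) ~[𝓝[>] 0] a

end General

/-- Characteristic exponent of the symmetric Cauchy law with scale `σ`. -/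
noncomputable def cauchyExponent (σ : ℝ) (u : ℝ) : ℝ := σ * |u|

/-- Characteristic exponent of the centred Gaussian law with variance `σ²`. -/
noncomputable def gaussExponent (σ : ℝ) (u : ℝ) : ℝ := σ ^ 2 * u ^ 2 / 2

/-- Characteristic exponent of the relativistic Schrödinger law with mass `m`. -/
noncomputable def relativisticExponent (m : ℝ) (u : ℝ) : ℝ := √(m ^ 2 + u ^ 2) - m

end CompactLie

open CompactLie

/-! On `SU(2)` the irreducible characters are the Chebyshev polynomials U_n evaluated at half the
trace, with dimension n + 1 and Casimir value n(n + 2). The density must therefore be the central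
function k_t(g) = ∑ (n + 1) exp(-t η(√(n(n+2)))) U_n(tr g / 2), and k_t(e) = ∑ (n + 1)² exp(-t
η(√(n(n+2)))). Since √(n(n+2)) lies between n and n + 1, the coefficients agree with exp(-(hN)^p), N
= n + 1, up to a factor tending to 1, where p = 1 (Cauchy, relativistic) or p = 2 (heat) and h =
h(t) → 0. Then h³ ∑ N² exp(-(hN)^p) is a Riemann sum of ∫ x² exp(-x^p) dx = Γ(3/p)/p
(`tendsto_expPowSum`), which gives all the constants.

Existence needs k_t ≥ 0. This is proved without a Lévy–Khintchine or subordination theorem, through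
sequences that multiply character coefficients and preserve nonnegativity (`PosMultiplier`).
Averages over conjugacy classes are of this kind (`PosMultiplier.chebU_div`); powers of averages
over shrinking classes converge to the heat multipliers; and since 1 - √(1 - x) is a limit of
polynomials with nonnegative coefficients, the multipliers exp(-t(√(m² + κ) - m)) follow, with m = 0
the Cauchy case. Applying a multiplier to Poisson kernels gives positivity of its own series.

The Fourier transform of a central density is scalar by Schur's lemma, and its trace is found from
the characters (`UnitaryIrrep.exists_character`) and their orthogonality. The characters come from
the radial Casimir equation on the torus, where y = sin θ · χ satisfies y'' = -(κ + 1) y and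
vanishes at 0 and π. Orthogonality comes from the moments of the trace, computed by differentiating
the invariance of Haar measure.

Uniqueness rests on `FaithfulFrame.eq_top`: products of entries of the defining representation are
coefficients of its tensor powers, these split into irreducibles on which the Casimir is a real
scalar, and Stone–Weierstrass applies. The same density argument yields the convolution and
continuity properties from the Fourier transform alone.

`SO(3)` is reached through the double cover: only even n survive, which halves the Riemann-sum
limit, and the Casimir is multiplied by 4 on lifting, so η(u) on `SO(3)` corresponds to η(u/2) on
`SU(2)`. -/

namespace CompactLie

/-! ### Positivity of character series -/

section Positivity

/-- The value at `x = tr g / 2` of the character of the `(n + 1)`-dimensional irreducible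
representation of `SU(2)`. -/
noncomputable def chebU (n : ℕ) (x : ℝ) : ℝ := (Polynomial.Chebyshev.U ℝ n).eval x

theorem chebU_zero (x : ℝ) : chebU 0 x = 1 := by simp [chebU]

theorem chebU_one (x : ℝ) : chebU 1 x = 2 * x := by simp [chebU]

theorem chebU_add_two (n : ℕ) (x : ℝ) : chebU (n + 2) x = 2 * x * chebU (n + 1) x - chebU n x := by
  have := Polynomial.Chebyshev.U_add_two ℝ n
  simp only [chebU]
  push_cast
  rw [this]
  simp

theorem chebU_at_one (n : ℕ) : chebU n 1 = n + 1 := by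
  simp [chebU, Polynomial.Chebyshev.U_eval_one]

theorem chebU_neg (n : ℕ) (x : ℝ) : chebU n (-x) = (-1) ^ n * chebU n x := by
  simp only [chebU, Polynomial.Chebyshev.U_eval_neg]
  simp [Int.negOnePow]

theorem chebU_cos_mul_sin (n : ℕ) (θ : ℝ) :
    chebU n (Real.cos θ) * Real.sin θ = Real.sin ((n + 1) * θ) := by
  simp [chebU]

theorem continuous_chebU (n : ℕ) : Continuous (chebU n) := Polynomial.continuous _

/-- U_{n+1} = x U_n + T_{n+1} with |x|, |T_{n+1}| ≤ 1, so each step adds at most 1. -/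
theorem abs_chebU_le (n : ℕ) {x : ℝ} (hx : x ∈ Set.Icc (-1 : ℝ) 1) : |chebU n x| ≤ n + 1 := by
  obtain ⟨θ, rfl⟩ : ∃ θ, Real.cos θ = x := ⟨_, Real.cos_arccos hx.1 hx.2⟩
  induction n with
  | zero => simp [chebU_zero]
  | succ n ih =>
    have h : chebU (n + 1) (Real.cos θ)
        = Real.cos θ * chebU n (Real.cos θ) + Real.cos ((n + 1) * θ) := by
      have := congrArg (Polynomial.eval (Real.cos θ))
        (Polynomial.Chebyshev.U_eq_X_mul_U_add_T ℝ n)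
      simpa [chebU] using this
    rw [h]
    calc _ ≤ |Real.cos θ * chebU n (Real.cos θ)| + |Real.cos ((n + 1) * θ)| := abs_add_le _ _
      _ ≤ 1 * (n + 1) + 1 := by
        rw [abs_mul]
        gcongr
        · exact Real.abs_cos_le_one _
        · exact Real.abs_cos_le_one _
      _ = _ := by push_cast; ring

/-- The class function `∑ (n + 1) bₙ χₙ` on `SU(2)`, as a function of `x = tr g / 2`. -/
noncomputable def charSeries (b : ℕ → ℝ) (x : ℝ) : ℝ := ∑' n : ℕ, (n + 1) * b n * chebU n x

/-- Coefficient sequences for which the character series converges absolutely and uniformly. -/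
def RapidDecay (b : ℕ → ℝ) : Prop := Summable fun n : ℕ => ((n : ℝ) + 1) ^ 2 * |b n|

theorem abs_charTerm_le (b : ℕ → ℝ) (n : ℕ) {x : ℝ} (hx : x ∈ Set.Icc (-1 : ℝ) 1) :
    |(n + 1) * b n * chebU n x| ≤ ((n : ℝ) + 1) ^ 2 * |b n| := by
  have hn : |(n : ℝ) + 1| = n + 1 := abs_of_pos (by positivity)
  rw [abs_mul, abs_mul, hn]
  calc _ ≤ ((n : ℝ) + 1) * |b n| * (n + 1) := by gcongr; exact abs_chebU_le n hx
    _ = _ := by ring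

theorem RapidDecay.summable {b : ℕ → ℝ} (hb : RapidDecay b) {x : ℝ}
    (hx : x ∈ Set.Icc (-1 : ℝ) 1) : Summable fun n : ℕ => (n + 1) * b n * chebU n x :=
  Summable.of_norm_bounded hb fun n => abs_charTerm_le b n hx

theorem RapidDecay.mul_bounded {a b : ℕ → ℝ} (hb : RapidDecay b) {C : ℝ} (ha : ∀ n, |a n| ≤ C) :
    RapidDecay fun n => a n * b n := by
  refine Summable.of_nonneg_of_le (fun n => by positivity) (fun n => ?_) (hb.mul_left C)
  rw [abs_mul]
  calc _ = |a n| * (((n : ℝ) + 1) ^ 2 * |b n|) := by ring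
    _ ≤ _ := by gcongr; exact ha n

theorem RapidDecay.continuousOn_charSeries {b : ℕ → ℝ} (hb : RapidDecay b) :
    ContinuousOn (charSeries b) (Set.Icc (-1) 1) :=
  continuousOn_tsum (fun n => (continuous_const.mul (continuous_chebU n)).continuousOn) hb
    fun n _ hx => abs_charTerm_le b n hx

/-- The character series is nonnegative on the group. -/
def CharNonneg (b : ℕ → ℝ) : Prop := ∀ x ∈ Set.Icc (-1 : ℝ) 1, 0 ≤ charSeries b x

/-- Pointwise limits of dominated coefficient sequences preserve nonnegativity. -/
theorem CharNonneg.of_tendsto {b : ℕ → ℝ} (hb : RapidDecay b) {c : ℕ → ℕ → ℝ} {d : ℕ → ℝ}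
    (hc : ∀ k n, |c k n| ≤ |b n|) (hlim : ∀ n, Tendsto (fun k => c k n) atTop (𝓝 (d n)))
    (h : ∀ᶠ k in atTop, CharNonneg (c k)) : CharNonneg d := by
  intro x hx
  have : Tendsto (fun k => charSeries (c k) x) atTop (𝓝 (charSeries d x)) := by
    refine tendsto_tsum_of_dominated_convergence hb
      (fun n => ((hlim n).const_mul _).mul_const _) (Eventually.of_forall fun k n => ?_)
    refine (abs_charTerm_le _ n hx).trans ?_
    exact mul_le_mul_of_nonneg_left (hc k n) (by positivity)
  exact ge_of_tendsto this (h.mono fun k hk => hk x hx)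

/-- Bounded sequences which act on coefficient sequences preserving nonnegativity. -/
structure PosMultiplier (a : ℕ → ℝ) : Prop where
  bounded : ∃ C, ∀ n, |a n| ≤ C
  nonneg : ∀ b, RapidDecay b → CharNonneg b → CharNonneg fun n => a n * b n

theorem PosMultiplier.const {c : ℝ} (hc : 0 ≤ c) : PosMultiplier fun _ => c where
  bounded := ⟨|c|, fun _ => le_rfl⟩
  nonneg b _ h x hx := by
    have : charSeries (fun n => c * b n) x = c * charSeries b x := by
      simp only [charSeries, ← tsum_mul_left]
      exact tsum_congr fun n => by ring
    rw [this]
    exact mul_nonneg hc (h x hx)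

theorem PosMultiplier.add {a a' : ℕ → ℝ} (h : PosMultiplier a) (h' : PosMultiplier a') :
    PosMultiplier fun n => a n + a' n where
  bounded := by
    obtain ⟨C, hC⟩ := h.bounded
    obtain ⟨C', hC'⟩ := h'.bounded
    exact ⟨C + C', fun n => (abs_add_le _ _).trans (add_le_add (hC n) (hC' n))⟩
  nonneg b hb hbn x hx := by
    obtain ⟨C, hC⟩ := h.bounded
    obtain ⟨C', hC'⟩ := h'.bounded
    have : charSeries (fun n => (a n + a' n) * b n) x
        = charSeries (fun n => a n * b n) x + charSeries (fun n => a' n * b n) x := by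
      simp only [charSeries]
      rw [← ((hb.mul_bounded hC).summable hx).tsum_add ((hb.mul_bounded hC').summable hx)]
      exact tsum_congr fun n => by ring
    rw [this]
    exact add_nonneg (h.nonneg b hb hbn x hx) (h'.nonneg b hb hbn x hx)

theorem PosMultiplier.mul {a a' : ℕ → ℝ} (h : PosMultiplier a) (h' : PosMultiplier a') :
    PosMultiplier fun n => a n * a' n where
  bounded := by
    obtain ⟨C, hC⟩ := h.bounded
    obtain ⟨C', hC'⟩ := h'.bounded
    refine ⟨C * C', fun n => ?_⟩
    rw [abs_mul]
    exact mul_le_mul (hC n) (hC' n) (abs_nonneg _) ((abs_nonneg _).trans (hC n))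
  nonneg b hb hbn := by
    obtain ⟨C', hC'⟩ := h'.bounded
    simpa only [mul_assoc] using h.nonneg _ (hb.mul_bounded hC') (h'.nonneg b hb hbn)

theorem PosMultiplier.pow {a : ℕ → ℝ} (h : PosMultiplier a) (k : ℕ) :
    PosMultiplier fun n => a n ^ k := by
  induction k with
  | zero => simpa using PosMultiplier.const zero_le_one
  | succ k ih => simpa only [pow_succ] using ih.mul h

theorem PosMultiplier.of_tendsto {a : ℕ → ℕ → ℝ} {d : ℕ → ℝ} (C : ℝ)
    (hC : ∀ k n, |a k n| ≤ C) (hlim : ∀ n, Tendsto (fun k => a k n) atTop (𝓝 (d n)))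
    (h : ∀ᶠ k in atTop, PosMultiplier (a k)) : PosMultiplier d where
  bounded := ⟨C, fun n => le_of_tendsto (hlim n).abs (Eventually.of_forall fun k => hC k n)⟩
  nonneg b hb hbn := by
    refine CharNonneg.of_tendsto (b := fun n => C * b n) ?_ (c := fun k n => a k n * b n) ?_
      (fun n => (hlim n).mul_const _) (h.mono fun k hk => hk.nonneg b hb hbn)
    · exact hb.mul_bounded (C := |C|) fun _ => le_rfl
    · intro k n
      rw [abs_mul, abs_mul]
      exact mul_le_mul_of_nonneg_right ((hC k n).trans (le_abs_self _)) (abs_nonneg _)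

/-- The exponential is the limit of (1 + t a / k)^k, built from nonnegative constants, sums and
products of positive multipliers, with the common bound exp(tC). -/
theorem PosMultiplier.exp {a : ℕ → ℝ} (h : PosMultiplier a) {t : ℝ} (ht : 0 ≤ t) :
    PosMultiplier fun n => Real.exp (t * a n) := by
  obtain ⟨C, hC⟩ := h.bounded
  refine PosMultiplier.of_tendsto (a := fun k n => (1 + t * a n / k) ^ k) (Real.exp (t * C))
    (fun k n => ?_) (fun n => Real.tendsto_one_add_div_pow_exp _)
    (Eventually.of_forall fun k => PosMultiplier.pow ?_ k)
  · rw [abs_pow]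
    have h1 : |1 + t * a n / k| ≤ Real.exp (t * C / k) := by
      calc _ ≤ 1 + t * |a n| / k := by
            refine (abs_add_le _ _).trans ?_
            rw [abs_div, abs_mul, abs_of_nonneg ht, abs_one, Nat.abs_cast]
        _ ≤ 1 + t * C / k := by gcongr; exact hC n
        _ ≤ _ := by rw [add_comm]; exact Real.add_one_le_exp _
    have hCn : 0 ≤ C := (abs_nonneg _).trans (hC 0)
    calc _ ≤ Real.exp (t * C / k) ^ k := by gcongr
      _ = Real.exp (k * (t * C / k)) := by rw [← Real.exp_nat_mul]
      _ ≤ _ := by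
        rcases eq_or_ne k 0 with rfl | hk
        · simp only [Nat.cast_zero, zero_mul, Real.exp_zero]
          exact Real.one_le_exp (by positivity)
        · rw [mul_div_cancel₀]
          exact_mod_cast hk
  · have := (PosMultiplier.const zero_le_one).add
      ((PosMultiplier.const (show (0 : ℝ) ≤ t / k by positivity)).mul h)
    convert this using 3
    ring

/-! ### Averages over conjugacy classes and the heat multipliers -/

/-- The cosine series whose derivative is `- sin φ` times the character series. -/
noncomputable def cosSeries (b : ℕ → ℝ) (φ : ℝ) : ℝ := ∑' n : ℕ, b n * Real.cos ((n + 1) * φ)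

theorem RapidDecay.summable_linear {b : ℕ → ℝ} (hb : RapidDecay b) :
    Summable fun n : ℕ => ((n : ℝ) + 1) * |b n| := by
  refine Summable.of_nonneg_of_le (fun n => by positivity) (fun n => ?_) hb
  have : (0 : ℝ) ≤ n := by positivity
  gcongr
  nlinarith

theorem RapidDecay.summable_abs {b : ℕ → ℝ} (hb : RapidDecay b) :
    Summable fun n : ℕ => |b n| := by
  refine Summable.of_nonneg_of_le (fun n => by positivity) (fun n => ?_) hb.summable_linear
  have : (0 : ℝ) ≤ n := by positivity
  nlinarith [abs_nonneg (b n), mul_nonneg this (abs_nonneg (b n))]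

theorem RapidDecay.summable_cos {b : ℕ → ℝ} (hb : RapidDecay b) (φ : ℝ) :
    Summable fun n : ℕ => b n * Real.cos ((n + 1) * φ) := by
  refine Summable.of_norm_bounded hb.summable_abs fun n => ?_
  rw [norm_mul]
  exact mul_le_of_le_one_right (norm_nonneg _) (Real.abs_cos_le_one _)

theorem RapidDecay.hasDerivAt_cosSeries {b : ℕ → ℝ} (hb : RapidDecay b) (φ : ℝ) :
    HasDerivAt (cosSeries b) (-(Real.sin φ * charSeries b (Real.cos φ))) φ := by
  have h : HasDerivAt (cosSeries b)
      (∑' n : ℕ, b n * (-Real.sin ((n + 1) * φ) * ((n : ℝ) + 1))) φ := by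
    refine hasDerivAt_tsum (g := fun (n : ℕ) (y : ℝ) => b n * Real.cos ((n + 1) * y))
      (g' := fun (n : ℕ) (y : ℝ) => b n * (-Real.sin ((n + 1) * y) * ((n : ℝ) + 1)))
      hb.summable_linear (fun n y => ?_) (fun n y => ?_) (y₀ := 0) (hb.summable_cos 0) φ
    · have h1 : HasDerivAt (fun y : ℝ => ((n : ℝ) + 1) * y) ((n : ℝ) + 1) y := by
        simpa using (hasDerivAt_id y).const_mul ((n : ℝ) + 1)
      exact h1.cos.const_mul (b n)
    · have hn : |(n : ℝ) + 1| = n + 1 := abs_of_pos (by positivity)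
      rw [Real.norm_eq_abs, abs_mul, abs_mul, abs_neg, hn]
      calc _ ≤ |b n| * (1 * ((n : ℝ) + 1)) := by gcongr; exact Real.abs_sin_le_one _
        _ = _ := by ring
  convert h using 1
  rw [charSeries, ← tsum_mul_left, ← tsum_neg]
  refine tsum_congr fun n => ?_
  rw [← chebU_cos_mul_sin]
  ring

/-- Positivity of the character series becomes monotonicity of `cosSeries`. In this form it can be
tested by comparing two points, which is what averaging over a class produces. -/
theorem cosSeries_antitoneOn {b : ℕ → ℝ} (hb : RapidDecay b) (h : CharNonneg b) :
    AntitoneOn (cosSeries b) (Set.Icc 0 Real.pi) := by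
  refine antitoneOn_of_hasDerivWithinAt_nonpos (convex_Icc _ _)
    (fun x _ => (hb.hasDerivAt_cosSeries x).continuousAt.continuousWithinAt)
    (fun x _ => (hb.hasDerivAt_cosSeries x).hasDerivWithinAt) fun x hx => ?_
  rw [interior_Icc] at hx
  have := mul_nonneg (Real.sin_pos_of_pos_of_lt_pi hx.1 hx.2).le
    (h _ ⟨Real.neg_one_le_cos x, Real.cos_le_one x⟩)
  linarith

theorem cosSeries_abs (b : ℕ → ℝ) (φ : ℝ) : cosSeries b |φ| = cosSeries b φ := by
  rcases abs_choice φ with h | h <;> rw [h]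
  simp [cosSeries]

theorem cosSeries_two_pi_sub (b : ℕ → ℝ) (φ : ℝ) :
    cosSeries b (2 * Real.pi - φ) = cosSeries b φ := by
  refine tsum_congr fun n => ?_
  congr 1
  rw [← Real.cos_nat_mul_two_pi_sub _ (n + 1)]
  congr 1
  push_cast
  ring

/-- The class-average formula is divided by sin θ, so x = ±1 has to be recovered by continuity. -/
theorem charNonneg_of_interior {b : ℕ → ℝ} (hb : RapidDecay b)
    (h : ∀ θ ∈ Set.Ioo 0 Real.pi, 0 ≤ charSeries b (Real.cos θ)) : CharNonneg b := by
  intro x hx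
  have hcont : ContinuousOn (fun θ => charSeries b (Real.cos θ)) (Set.Icc 0 Real.pi) :=
    hb.continuousOn_charSeries.comp Real.continuous_cos.continuousOn
      fun θ _ => ⟨Real.neg_one_le_cos θ, Real.cos_le_one θ⟩
  have hcl : closure (Set.Ioo 0 Real.pi) = Set.Icc 0 Real.pi := closure_Ioo Real.pi_pos.ne
  have := le_on_closure (f := fun _ => (0 : ℝ)) h continuousOn_const (by rwa [hcl])
    (x := Real.arccos x) (by rw [hcl]; exact ⟨Real.arccos_nonneg x, Real.arccos_le_pi x⟩)
  rwa [Real.cos_arccos hx.1 hx.2] at this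

/-- Averaging over a conjugacy class is a positive operation. -/
theorem PosMultiplier.chebU_div {s : ℝ} (hs : s ∈ Set.Ioo 0 Real.pi) :
    PosMultiplier fun n => chebU n (Real.cos s) / (n + 1) := by
  have hbd : ∀ n : ℕ, |chebU n (Real.cos s) / (n + 1)| ≤ 1 := fun n => by
    rw [abs_div, abs_of_pos (show (0 : ℝ) < n + 1 by positivity), div_le_one (by positivity)]
    exact abs_chebU_le n ⟨Real.neg_one_le_cos s, Real.cos_le_one s⟩
  refine ⟨⟨1, hbd⟩, fun b hb hbn => charNonneg_of_interior (hb.mul_bounded hbd) fun θ hθ => ?_⟩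
  have hsin : 0 < Real.sin s := Real.sin_pos_of_pos_of_lt_pi hs.1 hs.2
  have hsinθ : 0 < Real.sin θ := Real.sin_pos_of_pos_of_lt_pi hθ.1 hθ.2
  -- Termwise this is 2 sin((n+1)s) sin((n+1)θ) = cos((n+1)(θ-s)) - cos((n+1)(θ+s)); the divisor n +
  -- 1 of the multiplier cancels the weight n + 1 of the series.
  have key : Real.sin s * Real.sin θ *
      charSeries (fun n => chebU n (Real.cos s) / (n + 1) * b n) (Real.cos θ)
      = (cosSeries b (θ - s) - cosSeries b (θ + s)) / 2 := by
    rw [charSeries, ← tsum_mul_left, cosSeries, cosSeries,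
      ← (hb.summable_cos _).tsum_sub (hb.summable_cos _), ← tsum_div_const]
    refine tsum_congr fun n => ?_
    have hn : (n : ℝ) + 1 ≠ 0 := by positivity
    rw [mul_sub, mul_add, Real.cos_sub, Real.cos_add, ← chebU_cos_mul_sin, ← chebU_cos_mul_sin]
    field_simp
    ring
  have hanti := cosSeries_antitoneOn hb hbn
  -- By evenness and reflection at π both arguments fold into [0, π], where |θ - s| is at most both
  -- θ + s and 2π - (θ + s).
  have hmono : cosSeries b (θ + s) ≤ cosSeries b (θ - s) := by
    rw [← cosSeries_abs b (θ - s)]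
    obtain ⟨h1, h2⟩ := hs
    obtain ⟨h3, h4⟩ := hθ
    have habs : |θ - s| ≤ Real.pi := abs_le.2 ⟨by linarith, by linarith⟩
    rcases le_total (θ + s) Real.pi with h | h
    · exact hanti ⟨abs_nonneg _, habs⟩ ⟨by linarith, h⟩ (abs_le.2 ⟨by linarith, by linarith⟩)
    · rw [← cosSeries_two_pi_sub b (θ + s)]
      exact hanti ⟨abs_nonneg _, habs⟩ ⟨by linarith, by linarith⟩
        (abs_le.2 ⟨by linarith, by linarith⟩)
  have : 0 ≤ Real.sin s * Real.sin θ *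
      charSeries (fun n => chebU n (Real.cos s) / (n + 1) * b n) (Real.cos θ) := by
    rw [key]; linarith
  exact nonneg_of_mul_nonneg_right this (by positivity)

/-- Heat multipliers are positive, as limits of powers of averages over small conjugacy classes. -/
theorem PosMultiplier.heat {t : ℝ} (ht : 0 < t) :
    PosMultiplier fun n : ℕ => Real.exp (-t * (n * (n + 2))) := by
  -- The 3 compensates U_n'(1)/(n + 1) = n(n + 2)/3, so that the k-th power of U_n(1 - 3t/k)/(n + 1)
  -- tends to exp(-t n(n + 2)).
  have hx : Tendsto (fun k : ℕ => 1 - 3 * t / k) atTop (𝓝 1) := by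
    simpa using tendsto_const_nhds.sub (tendsto_const_div_atTop_nhds_zero_nat (3 * t))
  have hev : ∀ᶠ k : ℕ in atTop, 1 - 3 * t / k ∈ Set.Ioo (-1 : ℝ) 1 := by
    filter_upwards [hx.eventually (lt_mem_nhds (show (-1 : ℝ) < 1 by norm_num)),
      eventually_gt_atTop 0] with k hk hk0
    have : (0 : ℝ) < k := by exact_mod_cast hk0
    exact ⟨hk, by have : 0 < 3 * t / k := by positivity
                  linarith⟩
  -- The index is shifted by k₀ so that every term, not only eventually, is a genuine class average
  -- bounded by 1.
  obtain ⟨k₀, hk₀⟩ := eventually_atTop.1 hev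
  refine PosMultiplier.of_tendsto
    (a := fun k n => (chebU n (1 - 3 * t / (k + k₀ : ℕ)) / (n + 1)) ^ (k + k₀)) 1
    (fun k n => ?_) (fun n => ?_) (Eventually.of_forall fun k => PosMultiplier.pow ?_ _)
  · rw [abs_pow]
    refine pow_le_one₀ (abs_nonneg _) ?_
    rw [abs_div, abs_of_pos (show (0 : ℝ) < n + 1 by positivity), div_le_one (by positivity)]
    exact abs_chebU_le n (Set.Ioo_subset_Icc_self (hk₀ _ (by lia)))
  · refine (tendsto_add_atTop_iff_nat (f := fun k : ℕ =>
      (chebU n (1 - 3 * t / k) / (n + 1)) ^ k) k₀).2 ?_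
    have hd : HasDerivAt (fun y : ℝ => chebU n (1 - 3 * t * y) / (n + 1) - 1)
        (-t * (n * (n + 2))) 0 := by
      have h1 : HasDerivAt (fun y : ℝ => 1 - 3 * t * y) (-(3 * t)) 0 := by
        simpa using ((hasDerivAt_id (0 : ℝ)).const_mul (3 * t)).const_sub 1
      have h2 : HasDerivAt (chebU n) (((n : ℝ) + 2) * (n + 1) * n / 3) (1 - 3 * t * 0) := by
        have := (Polynomial.Chebyshev.U ℝ n).hasDerivAt (1 - 3 * t * 0)
        rw [mul_zero, sub_zero, Polynomial.Chebyshev.derivative_U_eval_one_eq_div] at this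
        rw [mul_zero, sub_zero]
        rw [Int.cast_natCast] at this
        exact this
      have h3 := ((h2.comp (0 : ℝ) h1).div_const ((n : ℝ) + 1)).sub_const 1
      refine h3.congr_deriv ?_
      have : (n : ℝ) + 1 ≠ 0 := by positivity
      field_simp
    have hs := hd.tendsto_slope_zero_right
    have hk : Tendsto (fun k : ℕ => ((k : ℝ))⁻¹) atTop (𝓝[>] 0) :=
      tendsto_inv_atTop_nhdsGT_zero.comp tendsto_natCast_atTop_atTop
    have hs' := hs.comp hk
    have hg : Tendsto (fun k : ℕ => (k : ℝ) * (chebU n (1 - 3 * t / k) / (n + 1) - 1)) atTop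
        (𝓝 (-t * (n * (n + 2)))) := by
      refine hs'.congr fun k => ?_
      have : (n : ℝ) + 1 ≠ 0 := by positivity
      simp [chebU_at_one, div_self this, div_eq_mul_inv]
    refine (Real.tendsto_one_add_pow_exp_of_tendsto hg).congr fun k => ?_
    congr 1
    ring
  · have hmem := hk₀ (k + k₀) (by lia)
    have := PosMultiplier.chebU_div (s := Real.arccos (1 - 3 * t / (k + k₀ : ℕ)))
      ⟨Real.arccos_pos.2 hmem.2, by
        rw [Real.arccos_lt_pi]; exact hmem.1⟩
    rwa [Real.cos_arccos hmem.1.le hmem.2.le] at this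

/-! ### Square roots of the generator -/

/-- Iterates converging to `1 - √(1 - x)`, all polynomials in `x` with nonnegative coefficients. -/
noncomputable def visser (x : ℝ) : ℕ → ℝ
  | 0 => 0
  | k + 1 => (x + visser x k ^ 2) / 2

theorem visser_mem {x : ℝ} (hx : x ∈ Set.Icc (0 : ℝ) 1) (k : ℕ) :
    0 ≤ visser x k ∧ visser x k ≤ 1 := by
  induction k with
  | zero => simp [visser]
  | succ k ih =>
    obtain ⟨h1, h2⟩ := ih
    obtain ⟨h3, h4⟩ := hx
    simp only [visser]
    constructor
    · positivity
    · nlinarith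

theorem visser_monotone {x : ℝ} (hx : x ∈ Set.Icc (0 : ℝ) 1) : Monotone (visser x) := by
  refine monotone_nat_of_le_succ fun k => ?_
  induction k with
  | zero => exact (visser_mem hx 1).1
  | succ k ih =>
    have h1 := (visser_mem hx k).1
    simp only [visser] at ih ⊢
    gcongr

/-- The iterates increase and stay below 1; the limit l satisfies (1 - l)² = 1 - x, and l ≤ 1
selects the root. -/
theorem tendsto_visser {x : ℝ} (hx : x ∈ Set.Icc (0 : ℝ) 1) :
    Tendsto (visser x) atTop (𝓝 (1 - √(1 - x))) := by
  obtain ⟨l, hl⟩ : ∃ l, Tendsto (visser x) atTop (𝓝 l) :=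
    ⟨_, tendsto_atTop_ciSup (visser_monotone hx) ⟨1, by
      rintro _ ⟨k, rfl⟩; exact (visser_mem hx k).2⟩⟩
  have hl1 : l ≤ 1 := le_of_tendsto' hl fun k => (visser_mem hx k).2
  have h2 : Tendsto (fun k => visser x (k + 1)) atTop (𝓝 ((x + l ^ 2) / 2)) :=
    ((hl.pow 2).const_add x).div_const 2
  have heq := tendsto_nhds_unique ((tendsto_add_atTop_iff_nat 1).2 hl) h2
  have : √(1 - x) = 1 - l := by
    rw [show 1 - x = (1 - l) ^ 2 by linarith, Real.sqrt_sq (by linarith)]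
  rw [this]
  simpa using hl

theorem PosMultiplier.one_sub_sqrt {a : ℕ → ℝ} (h : PosMultiplier a)
    (ha : ∀ n, a n ∈ Set.Icc (0 : ℝ) 1) : PosMultiplier fun n => 1 - √(1 - a n) := by
  refine PosMultiplier.of_tendsto (a := fun k n => visser (a n) k) 1 (fun k n => ?_)
    (fun n => tendsto_visser (ha n)) (Eventually.of_forall fun k => ?_)
  · obtain ⟨h1, h2⟩ := visser_mem (ha n) k
    rwa [abs_of_nonneg h1]
  · induction k with
    | zero => simpa [visser] using PosMultiplier.const le_rfl
    | succ k ih =>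
      have := (PosMultiplier.const (show (0 : ℝ) ≤ 1 / 2 by norm_num)).mul (h.add (ih.pow 2))
      convert this using 2
      simp only [visser]
      ring

/-- With c = m² + n(n + 2) and ε = 1/(k + 1), √c is the limit of √((1 - e^{-εc})/ε). Here e^{-εc} is
a heat multiplier times a constant, so 1 - √(1 - e^{-εc}) is a positive multiplier; it differs from
-√(1 - e^{-εc}) by the constant 1, and after exponentiation this constant is only a positive factor.
-/
theorem PosMultiplier.relativistic {t : ℝ} (ht : 0 ≤ t) (m : ℝ) :
    PosMultiplier fun n : ℕ => Real.exp (-t * (√(m ^ 2 + n * (n + 2)) - m)) := by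
  have hlim : ∀ c : ℝ, 0 ≤ c →
      Tendsto (fun k : ℕ => √((1 - Real.exp (-(1 / ((k : ℝ) + 1)) * c)) * (k + 1)))
        atTop (𝓝 √c) := by
    intro c hc
    refine (Real.continuous_sqrt.tendsto c).comp ?_
    have hd : HasDerivAt (fun y : ℝ => 1 - Real.exp (-y * c)) c 0 := by
      have := ((((hasDerivAt_id (0 : ℝ)).neg).mul_const c).exp).const_sub 1
      simpa using this
    have hs := hd.tendsto_slope_zero_right
    have hk : Tendsto (fun k : ℕ => 1 / ((k : ℝ) + 1)) atTop (𝓝[>] 0) :=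
      tendsto_nhdsWithin_iff.2 ⟨tendsto_one_div_add_atTop_nhds_zero_nat,
        Eventually.of_forall fun k => by simp only [Set.mem_Ioi]; positivity⟩
    refine (hs.comp hk).congr fun k => ?_
    simp [mul_comm]
  refine PosMultiplier.of_tendsto (a := fun (k n : ℕ) => Real.exp (t * m) *
      Real.exp (-t * √((1 - Real.exp (-(1 / ((k : ℝ) + 1)) * (m ^ 2 + n * (n + 2)))) * (k + 1))))
    (Real.exp (t * m)) (fun k n => ?_) (fun n => ?_) (Eventually.of_forall fun k => ?_)
  · rw [abs_of_pos (by positivity)]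
    refine mul_le_of_le_one_right (by positivity) (Real.exp_le_one_iff.2 ?_)
    have := Real.sqrt_nonneg ((1 - Real.exp (-(1 / ((k : ℝ) + 1)) * (m ^ 2 + n * (n + 2)))) * (k + 1))
    nlinarith
  · have h := ((hlim (m ^ 2 + n * (n + 2)) (by positivity)).const_mul (-t)).rexp.const_mul
      (Real.exp (t * m))
    rwa [← Real.exp_add, show t * m + -t * √(m ^ 2 + n * (n + 2)) =
      -t * (√(m ^ 2 + n * (n + 2)) - m) by ring] at h
  · have hε : (0 : ℝ) < 1 / ((k : ℝ) + 1) := by positivity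
    have hmul : PosMultiplier fun n : ℕ =>
        Real.exp (-(1 / ((k : ℝ) + 1)) * (m ^ 2 + n * (n + 2))) := by
      have := (PosMultiplier.const
        (Real.exp_pos (-(1 / ((k : ℝ) + 1)) * m ^ 2)).le).mul (PosMultiplier.heat hε)
      convert this using 2
      rw [← Real.exp_add]
      ring_nf
    have hS := hmul.one_sub_sqrt fun n => ⟨(Real.exp_pos _).le, Real.exp_le_one_iff.2 (by
      rw [neg_mul, neg_nonpos]; positivity)⟩
    have hE := hS.exp (t := t * √(k + 1)) (by positivity)
    have := (PosMultiplier.const (Real.exp_pos (t * m - t * √(k + 1))).le).mul hE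
    convert this using 2 with n
    rw [← Real.exp_add, ← Real.exp_add, Real.sqrt_mul' _ (by positivity)]
    ring_nf

/-! ### Poisson kernels as approximate identities -/

theorem summable_sq_mul_geometric {r : ℝ} (hr : |r| < 1) :
    Summable fun n : ℕ => ((n : ℝ) + 1) ^ 2 * r ^ n := by
  have h0 := summable_pow_mul_geometric_of_norm_lt_one 0 (r := r) hr
  have h1 := summable_pow_mul_geometric_of_norm_lt_one 1 (r := r) hr
  have h2 := summable_pow_mul_geometric_of_norm_lt_one 2 (r := r) hr
  refine ((h2.add (h1.mul_left 2)).add h0).congr fun n => ?_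
  ring

theorem rapidDecay_geometric {r : ℝ} (h0 : 0 ≤ r) (h1 : r < 1) : RapidDecay fun n => r ^ n := by
  refine (summable_sq_mul_geometric (r := r) (by rwa [abs_of_nonneg h0])).congr fun n => ?_
  rw [abs_of_nonneg (by positivity)]

/-- The Poisson kernel is nonnegative. -/
theorem charNonneg_geometric {r : ℝ} (h0 : 0 ≤ r) (h1 : r < 1) : CharNonneg fun n => r ^ n := by
  intro x hx
  have hR := rapidDecay_geometric h0 h1
  have hB : Summable fun n : ℕ => ((n : ℝ) + 1) * r ^ n * chebU n x := hR.summable hx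
  have hA : Summable fun n : ℕ => r ^ n * chebU n x := by
    refine Summable.of_norm_bounded hR fun n => ?_
    rw [norm_mul, Real.norm_eq_abs, Real.norm_eq_abs, mul_comm (((n : ℝ) + 1) ^ 2)]
    gcongr
    have : (0 : ℝ) ≤ n := by positivity
    refine (abs_chebU_le n hx).trans ?_
    nlinarith
  -- The recurrence for U_n gives linear equations for the two generating series. With D = 1 - 2rx +
  -- r² they read A D = 1 and B D² = 1 - r², so B is explicitly nonnegative.
  set A := ∑' n : ℕ, r ^ n * chebU n x with hAdef
  set B := ∑' n : ℕ, ((n : ℝ) + 1) * r ^ n * chebU n x with hBdef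
  have hA1 : ∑' n : ℕ, r ^ (n + 1) * chebU (n + 1) x = A - 1 := by
    rw [hAdef, hA.tsum_eq_zero_add]
    simp [chebU_zero]
  have hA2 : ∑' n : ℕ, r ^ (n + 2) * chebU (n + 2) x = A - 1 - r * (2 * x) := by
    rw [← hA1, ((summable_nat_add_iff 1).2 hA).tsum_eq_zero_add]
    simp [chebU_one]
  have hB1 : ∑' n : ℕ, ((n + 1 : ℕ) + 1 : ℝ) * r ^ (n + 1) * chebU (n + 1) x = B - 1 := by
    rw [hBdef, hB.tsum_eq_zero_add]
    simp [chebU_zero]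
  have hB2 : ∑' n : ℕ, ((n + 2 : ℕ) + 1 : ℝ) * r ^ (n + 2) * chebU (n + 2) x
      = B - 1 - 2 * r * (2 * x) := by
    have h := ((summable_nat_add_iff 1).2 hB).tsum_eq_zero_add
    simp only [Nat.zero_add, chebU_one, add_assoc, Nat.reduceAdd] at h hB1
    rw [hB1] at h
    norm_num at h ⊢
    linarith
  have sA1 := (summable_nat_add_iff 1).2 hA
  have sB1 := (summable_nat_add_iff 1).2 hB
  have eA : A - 1 - r * (2 * x) = 2 * x * r * (A - 1) - r ^ 2 * A := by
    rw [← hA2, ← hA1, hAdef, ← tsum_mul_left, ← tsum_mul_left,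
      ← (sA1.mul_left _).tsum_sub (hA.mul_left _)]
    refine tsum_congr fun n => ?_
    rw [chebU_add_two]
    ring
  have eB : B - 1 - 2 * r * (2 * x)
      = 2 * x * r * (B - 1 + (A - 1)) - r ^ 2 * (B + 2 * A) := by
    rw [← hB2, ← hB1, ← hA1, hAdef, hBdef, ← sB1.tsum_add sA1, ← tsum_mul_left, ← tsum_mul_left,
      ← hB.tsum_add (hA.mul_left 2), ← tsum_mul_left,
      ← ((sB1.add sA1).mul_left _).tsum_sub ((hB.add (hA.mul_left 2)).mul_left _)]
    refine tsum_congr fun n => ?_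
    rw [chebU_add_two]
    push_cast
    ring
  have hD : 0 < 1 - 2 * r * x + r ^ 2 := by
    obtain ⟨h3, h4⟩ := hx
    nlinarith [mul_nonneg h0 (sub_nonneg.2 h4)]
  have hBD : B * (1 - 2 * r * x + r ^ 2) ^ 2 = 1 - r ^ 2 := by
    have e1 : A * (1 - 2 * r * x + r ^ 2) = 1 := by linarith
    have e2 : B * (1 - 2 * r * x + r ^ 2) = 1 + (2 * x * r - 2 * r ^ 2) * A := by linarith
    calc _ = (B * (1 - 2 * r * x + r ^ 2)) * (1 - 2 * r * x + r ^ 2) := by ring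
      _ = (1 - 2 * r * x + r ^ 2)
          + (2 * x * r - 2 * r ^ 2) * (A * (1 - 2 * r * x + r ^ 2)) := by rw [e2]; ring
      _ = _ := by rw [e1]; ring
  have h2 : 0 ≤ 1 - r ^ 2 := by nlinarith
  rw [← hBD] at h2
  exact nonneg_of_mul_nonneg_left h2 (by positivity)

/-- Applied to the Poisson kernel with r = 1 - 1/(k + 1), the multiplier gives a nonnegative series
with coefficients a_n rⁿ; as r → 1 these converge to a_n, dominated by |a_n|. -/
theorem PosMultiplier.charNonneg {a : ℕ → ℝ} (h : PosMultiplier a) (ha : RapidDecay a) :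
    CharNonneg a := by
  have hr : ∀ k : ℕ, (0 : ℝ) ≤ 1 - 1 / ((k : ℝ) + 1) ∧ 1 - 1 / ((k : ℝ) + 1) < 1 := fun k => by
    have h1 : (0 : ℝ) < 1 / ((k : ℝ) + 1) := by positivity
    have h2 : 1 / ((k : ℝ) + 1) ≤ 1 := by
      rw [div_le_one (by positivity)]
      have : (0 : ℝ) ≤ k := by positivity
      linarith
    constructor <;> linarith
  refine CharNonneg.of_tendsto ha (c := fun k n => a n * (1 - 1 / ((k : ℝ) + 1)) ^ n)
    (fun k n => ?_) (fun n => ?_) (Eventually.of_forall fun k =>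
      h.nonneg _ (rapidDecay_geometric (hr k).1 (hr k).2) (charNonneg_geometric (hr k).1 (hr k).2))
  · rw [abs_mul]
    refine mul_le_of_le_one_right (abs_nonneg _) ?_
    rw [abs_of_nonneg (pow_nonneg (hr k).1 _)]
    exact pow_le_one₀ (hr k).1 (hr k).2.le
  · have : Tendsto (fun k : ℕ => 1 - 1 / ((k : ℝ) + 1)) atTop (𝓝 1) := by
      simpa using tendsto_one_div_add_atTop_nhds_zero_nat.const_sub (1 : ℝ)
    simpa using (this.pow n).const_mul (a n)

end Positivity

end CompactLie

namespace CompactLie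

/-! ### Short time asymptotics of the series at the identity -/

section Asymptotics

-- The step function x ↦ g(h⌈x/h⌉) is constant on each (hn, h(n+1)], so the right-endpoint Riemann
-- sum is exactly an integral. Limits of the sums then follow from dominated convergence.
open Set in
theorem hasSum_integral_ceil {g : ℝ → ℝ} {h : ℝ} (hh : 0 < h)
    (hint : IntegrableOn (fun x => g (h * ⌈x / h⌉₊)) (Ioi 0)) :
    HasSum (fun n : ℕ => h * g (h * (n + 1))) (∫ x in Ioi 0, g (h * ⌈x / h⌉₊)) := by
  have hU : ⋃ n : ℕ, Ioc (h * n) (h * (n + 1)) = Ioi (0 : ℝ) := by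
    ext x
    simp only [mem_iUnion, mem_Ioc, mem_Ioi]
    constructor
    · rintro ⟨n, h1, -⟩
      exact lt_of_le_of_lt (by positivity) h1
    · intro hx
      have hpos : 0 < ⌈x / h⌉₊ := Nat.ceil_pos.2 (div_pos hx hh)
      obtain ⟨n, hn⟩ := Nat.exists_eq_succ_of_ne_zero hpos.ne'
      have := (Nat.ceil_eq_iff (Nat.succ_ne_zero n)).1 hn
      simp only [Nat.succ_sub_one, Nat.cast_succ, Nat.succ_eq_add_one] at this
      exact ⟨n, by rw [mul_comm]; exact (lt_div_iff₀ hh).1 this.1,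
        by rw [mul_comm]; exact (div_le_iff₀ hh).1 this.2⟩
  have hceil : ∀ n : ℕ, ∀ x ∈ Ioc (h * n) (h * (n + 1)), ⌈x / h⌉₊ = n + 1 := by
    intro n x hx
    rw [Nat.ceil_eq_iff (Nat.succ_ne_zero n)]
    constructor
    · rw [lt_div_iff₀ hh, mul_comm]; simpa using hx.1
    · rw [div_le_iff₀ hh, mul_comm]; simpa using hx.2
  have hs := hasSum_integral_iUnion (μ := volume) (f := fun x => g (h * ⌈x / h⌉₊))
    (s := fun n : ℕ => Ioc (h * n) (h * (n + 1))) (fun n => measurableSet_Ioc) (by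
      intro m n hmn
      refine Set.disjoint_left.2 fun x hx hx' => hmn ?_
      have := (hceil m x hx).symm.trans (hceil n x hx')
      lia) (by rwa [hU])
  rw [hU] at hs
  refine hs.congr_fun fun n => ?_
  rw [setIntegral_congr_fun measurableSet_Ioc
    (g := fun _ => g (h * (n + 1))) fun x hx => by simp [hceil n x hx]]
  simp [hh.le, mul_add]

/-- `∑ N² exp (-(h N)ᵖ)`. -/
noncomputable def expPowSum (p : ℕ) (h : ℝ) : ℝ :=
  ∑' n : ℕ, ((n : ℝ) + 1) ^ 2 * Real.exp (-(h * (n + 1)) ^ p)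

theorem integrableOn_sq_mul_exp_neg_pow {p : ℕ} (hp : p ≠ 0) (j : ℕ) :
    IntegrableOn (fun x : ℝ => x ^ j * Real.exp (-x ^ p)) (Set.Ioi 0) := by
  have := integrableOn_rpow_mul_exp_neg_rpow (p := p) (s := j)
    (by have : (0 : ℝ) ≤ j := by positivity
        linarith) (by positivity)
  simpa only [Real.rpow_natCast] using this

theorem integral_sq_mul_exp_neg_pow {p : ℕ} (hp : p ≠ 0) :
    ∫ x in Set.Ioi (0 : ℝ), x ^ 2 * Real.exp (-x ^ p) = 1 / p * Real.Gamma (3 / p) := by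
  have := integral_rpow_mul_exp_neg_rpow (p := p) (q := (2 : ℕ)) (by positivity) (by norm_num)
  simp only [Real.rpow_natCast] at this
  rw [this]
  norm_num

theorem integrableOn_sq_add_mul_exp_neg_pow {p : ℕ} (hp : p ≠ 0) (h : ℝ) :
    IntegrableOn (fun x : ℝ => (x + h) ^ 2 * Real.exp (-x ^ p)) (Set.Ioi 0) := by
  have := ((integrableOn_sq_mul_exp_neg_pow hp 2).add
    ((integrableOn_sq_mul_exp_neg_pow hp 1).const_mul (2 * h))).add
    ((integrableOn_sq_mul_exp_neg_pow hp 0).const_mul (h ^ 2))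
  refine this.congr_fun (fun x _ => ?_) measurableSet_Ioi
  simp only [Pi.add_apply]
  ring

theorem ceil_mul_mem {h x : ℝ} (hh : 0 < h) (hx : 0 < x) :
    x ≤ h * ⌈x / h⌉₊ ∧ h * ⌈x / h⌉₊ ≤ x + h := by
  constructor
  · have := Nat.le_ceil (x / h)
    rwa [div_le_iff₀ hh, mul_comm] at this
  · have := (Nat.ceil_lt_add_one (div_pos hx hh).le).le
    calc _ ≤ h * (x / h + 1) := by gcongr
      _ = x + h := by field_simp

theorem sq_mul_exp_ceil_le {p : ℕ} {h x : ℝ} (hh : 0 < h) (hx : 0 < x) :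
    ‖(h * ⌈x / h⌉₊) ^ 2 * Real.exp (-(h * ⌈x / h⌉₊) ^ p)‖
      ≤ (x + h) ^ 2 * Real.exp (-x ^ p) := by
  obtain ⟨h1, h2⟩ := ceil_mul_mem hh hx
  rw [Real.norm_of_nonneg (by positivity)]
  gcongr

theorem integrableOn_sq_mul_exp_ceil {p : ℕ} (hp : p ≠ 0) {h : ℝ} (hh : 0 < h) :
    IntegrableOn (fun x : ℝ => (h * ⌈x / h⌉₊) ^ 2 * Real.exp (-(h * ⌈x / h⌉₊) ^ p))
      (Set.Ioi 0) := by
  refine Integrable.mono' (integrableOn_sq_add_mul_exp_neg_pow hp h) ?_ ?_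
  · have : Measurable fun x : ℝ => h * (⌈x / h⌉₊ : ℝ) :=
      (measurable_from_nat.comp (Nat.measurable_ceil.comp (measurable_id.div_const h))).const_mul h
    exact ((this.pow_const 2).mul (this.pow_const p).neg.exp).aestronglyMeasurable
  · exact (ae_restrict_iff' measurableSet_Ioi).2 (ae_of_all _ fun x hx => sq_mul_exp_ceil_le hh hx)

theorem summable_expPowSum {p : ℕ} (hp : p ≠ 0) {h : ℝ} (hh : 0 < h) :
    Summable fun n : ℕ => ((n : ℝ) + 1) ^ 2 * Real.exp (-(h * (n + 1)) ^ p) := by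
  have hs := (hasSum_integral_ceil (g := fun y => y ^ 2 * Real.exp (-y ^ p)) hh
    (integrableOn_sq_mul_exp_ceil hp hh)).summable
  refine (hs.mul_left (h ^ 3)⁻¹).congr fun n => ?_
  field_simp

theorem expPowSum_eq {p : ℕ} (hp : p ≠ 0) {h : ℝ} (hh : 0 < h) :
    h ^ 3 * expPowSum p h
      = ∫ x in Set.Ioi (0 : ℝ), (h * ⌈x / h⌉₊) ^ 2 * Real.exp (-(h * ⌈x / h⌉₊) ^ p) := by
  rw [← (hasSum_integral_ceil (g := fun y => y ^ 2 * Real.exp (-y ^ p)) hh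
    (integrableOn_sq_mul_exp_ceil hp hh)).tsum_eq, expPowSum, ← tsum_mul_left]
  exact tsum_congr fun n => by ring

/-- Rounding up moves x by at most h, so for h ≤ 1 the step functions are dominated by (x + 1)²
exp(-x^p) and converge pointwise. -/
theorem tendsto_expPowSum {p : ℕ} (hp : p ≠ 0) :
    Tendsto (fun h => h ^ 3 * expPowSum p h) (𝓝[>] 0) (𝓝 (1 / p * Real.Gamma (3 / p))) := by
  rw [← integral_sq_mul_exp_neg_pow hp]
  have hlim : Tendsto (fun h : ℝ => ∫ x in Set.Ioi (0 : ℝ),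
      (h * ⌈x / h⌉₊) ^ 2 * Real.exp (-(h * ⌈x / h⌉₊) ^ p)) (𝓝[>] 0)
      (𝓝 (∫ x in Set.Ioi (0 : ℝ), x ^ 2 * Real.exp (-x ^ p))) := by
    refine tendsto_integral_filter_of_dominated_convergence
      (fun x => (x + 1) ^ 2 * Real.exp (-x ^ p)) ?_ ?_
      (integrableOn_sq_add_mul_exp_neg_pow hp 1) ?_
    · filter_upwards [self_mem_nhdsWithin] with h hh
      exact (integrableOn_sq_mul_exp_ceil hp hh).aestronglyMeasurable
    · filter_upwards [Ioc_mem_nhdsGT (zero_lt_one' ℝ)] with h hh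
      refine (ae_restrict_iff' measurableSet_Ioi).2 (ae_of_all _ fun x hx => ?_)
      refine (sq_mul_exp_ceil_le hh.1 hx).trans ?_
      have hx' : (0 : ℝ) < x := hx
      have := hh.1
      gcongr
      exact hh.2
    · refine (ae_restrict_iff' measurableSet_Ioi).2 (ae_of_all _ fun x hx => ?_)
      have hc : Tendsto (fun h : ℝ => h * (⌈x / h⌉₊ : ℝ)) (𝓝[>] 0) (𝓝 x) := by
        refine tendsto_of_tendsto_of_tendsto_of_le_of_le' tendsto_const_nhds
          (h := fun h : ℝ => x + h) ?_ ?_ ?_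
        · have : Tendsto (fun h : ℝ => x + h) (𝓝 0) (𝓝 (x + 0)) :=
            tendsto_const_nhds.add tendsto_id
          rw [add_zero] at this
          exact this.mono_left nhdsWithin_le_nhds
        · filter_upwards [self_mem_nhdsWithin] with h hh using (ceil_mul_mem hh hx).1
        · filter_upwards [self_mem_nhdsWithin] with h hh using (ceil_mul_mem hh hx).2
      exact (hc.pow 2).mul ((hc.pow p).neg.rexp)
  refine hlim.congr' ?_
  filter_upwards [self_mem_nhdsWithin] with h hh using (expPowSum_eq hp hh).symm

/-- The even part of a coefficient sequence. -/
noncomputable def evenPart (b : ℕ → ℝ) (n : ℕ) : ℝ := if Even n then b n else 0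

theorem tsum_evenPart {f : ℕ → ℝ} (hf : Summable f) :
    ∑' n, evenPart f n = ∑' n, f n - ∑' l, f (2 * l + 1) := by
  have h0 : Summable fun l => f (2 * l) :=
    hf.comp_injective fun a b h => by simpa using h
  have h1 : Summable fun l => f (2 * l + 1) :=
    hf.comp_injective fun a b h => by simpa using h
  rw [← tsum_even_add_odd h0 h1]
  have e0 : ∀ l, evenPart f (2 * l) = f (2 * l) := fun l => by simp [evenPart]
  have e1 : ∀ l, evenPart f (2 * l + 1) = 0 := fun l => by simp [evenPart]
  rw [← tsum_even_add_odd (f := evenPart f) (by simpa only [e0]) (by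
    simp only [e1]; exact summable_zero)]
  simp only [e0, e1, tsum_zero]
  ring

/-- Even n means odd N = n + 1. The discarded terms N = 2M form the same series at step 2h, with the
factor 4 from N² = 4M². -/
theorem tsum_evenPart_expPow {p : ℕ} (hp : p ≠ 0) {h : ℝ} (hh : 0 < h) :
    ∑' n, evenPart (fun n : ℕ => ((n : ℝ) + 1) ^ 2 * Real.exp (-(h * (n + 1)) ^ p)) n
      = expPowSum p h - 4 * expPowSum p (2 * h) := by
  rw [tsum_evenPart (summable_expPowSum hp hh), expPowSum, expPowSum, ← tsum_mul_left]
  congr 1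
  refine tsum_congr fun l => ?_
  push_cast
  ring_nf

theorem tendsto_evenPart_expPow {p : ℕ} (hp : p ≠ 0) :
    Tendsto (fun h => h ^ 3 * ∑' n, evenPart
      (fun n : ℕ => ((n : ℝ) + 1) ^ 2 * Real.exp (-(h * (n + 1)) ^ p)) n) (𝓝[>] 0)
      (𝓝 (1 / p * Real.Gamma (3 / p) / 2)) := by
  have h1 := tendsto_expPowSum hp
  have h2 : Tendsto (fun h : ℝ => 2 * h) (𝓝[>] 0) (𝓝[>] 0) := by
    refine tendsto_nhdsWithin_iff.2 ⟨?_, ?_⟩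
    · have : Tendsto (fun h : ℝ => 2 * h) (𝓝 0) (𝓝 (2 * 0)) := tendsto_id.const_mul 2
      rw [mul_zero] at this
      exact this.mono_left nhdsWithin_le_nhds
    · filter_upwards [self_mem_nhdsWithin] with h hh
      have : (0 : ℝ) < h := hh
      simpa using this
  -- Since 4 h³ = (2h)³ / 2, the discarded even N carry half of the limit.
  have h3 := h1.sub ((h1.comp h2).div_const 2)
  have hval : 1 / (p : ℝ) * Real.Gamma (3 / p) - 1 / p * Real.Gamma (3 / p) / 2
      = 1 / p * Real.Gamma (3 / p) / 2 := by ring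
  rw [hval] at h3
  refine h3.congr' ?_
  filter_upwards [self_mem_nhdsWithin] with h hh
  rw [tsum_evenPart_expPow hp hh]
  simp only [Function.comp]
  ring

theorem charSeries_one (b : ℕ → ℝ) : charSeries b 1 = ∑' n : ℕ, ((n : ℝ) + 1) ^ 2 * b n :=
  tsum_congr fun n => by rw [chebU_at_one]; ring

theorem charSeries_evenPart_one (b : ℕ → ℝ) :
    charSeries (evenPart b) 1 = ∑' n, evenPart (fun n : ℕ => ((n : ℝ) + 1) ^ 2 * b n) n := by
  rw [charSeries_one]
  exact tsum_congr fun n => by simp only [evenPart]; split_ifs <;> simp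

/-- Coefficients comparable with `exp (-(h N)ᵖ)`, with a ratio tending to one as `t → 0`. -/
structure ExpPowComparable (p : ℕ) (h : ℝ → ℝ) (C : ℝ) (b : ℝ → ℕ → ℝ) : Prop where
  lower : ∀ t, 0 < t → ∀ n : ℕ, Real.exp (-(h t * (n + 1)) ^ p) ≤ b t n
  upper : ∀ t, 0 < t → ∀ n : ℕ, b t n ≤ Real.exp (C * t) * Real.exp (-(h t * (n + 1)) ^ p)
  pos : ∀ t, 0 < t → 0 < h t
  lim : Tendsto h (𝓝[>] 0) (𝓝 0)

variable {p : ℕ} {h : ℝ → ℝ} {C : ℝ} {b : ℝ → ℕ → ℝ}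

theorem ExpPowComparable.rapidDecay (H : ExpPowComparable p h C b) (hp : p ≠ 0) {t : ℝ}
    (ht : 0 < t) : RapidDecay (b t) := by
  refine Summable.of_nonneg_of_le (fun n => by positivity) (fun n => ?_)
    ((summable_expPowSum hp (H.pos t ht)).mul_left (Real.exp (C * t)))
  rw [abs_of_nonneg ((Real.exp_pos _).le.trans (H.lower t ht n))]
  calc _ ≤ ((n : ℝ) + 1) ^ 2 * (Real.exp (C * t) * Real.exp (-(h t * (n + 1)) ^ p)) := by
        gcongr; exact H.upper t ht n
    _ = _ := by ring

theorem ExpPowComparable.tendsto_of_bounds (H : ExpPowComparable p h C b)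
    {L S : ℝ → ℝ} {c : ℝ} (hL : Tendsto (fun h => h ^ 3 * L h) (𝓝[>] 0) (𝓝 c))
    (h1 : ∀ t, 0 < t → L (h t) ≤ S t) (h2 : ∀ t, 0 < t → S t ≤ Real.exp (C * t) * L (h t)) :
    Tendsto (fun t => h t ^ 3 * S t) (𝓝[>] 0) (𝓝 c) := by
  have hh : Tendsto h (𝓝[>] 0) (𝓝[>] 0) := tendsto_nhdsWithin_iff.2 ⟨H.lim, by
    filter_upwards [self_mem_nhdsWithin] with t ht using H.pos t ht⟩
  have hl := hL.comp hh
  have he : Tendsto (fun t : ℝ => Real.exp (C * t)) (𝓝[>] 0) (𝓝 1) := by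
    have : Tendsto (fun t : ℝ => Real.exp (C * t)) (𝓝 0) (𝓝 (Real.exp (C * 0))) :=
      (Real.continuous_exp.comp (continuous_const.mul continuous_id)).tendsto 0
    rw [mul_zero, Real.exp_zero] at this
    exact this.mono_left nhdsWithin_le_nhds
  have hu := he.mul hl
  rw [one_mul] at hu
  refine tendsto_of_tendsto_of_tendsto_of_le_of_le' hl hu ?_ ?_
  · filter_upwards [self_mem_nhdsWithin] with t ht
    have := H.pos t ht
    exact mul_le_mul_of_nonneg_left (h1 t ht) (by positivity)
  · filter_upwards [self_mem_nhdsWithin] with t ht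
    have := H.pos t ht
    calc _ ≤ h t ^ 3 * (Real.exp (C * t) * L (h t)) :=
          mul_le_mul_of_nonneg_left (h2 t ht) (by positivity)
      _ = _ := by simp only [Function.comp]; ring

theorem ExpPowComparable.tendsto_charSeries (H : ExpPowComparable p h C b) (hp : p ≠ 0) :
    Tendsto (fun t => h t ^ 3 * charSeries (b t) 1) (𝓝[>] 0)
      (𝓝 (1 / p * Real.Gamma (3 / p))) := by
  refine H.tendsto_of_bounds (tendsto_expPowSum hp) (fun t ht => ?_) (fun t ht => ?_)
  · rw [charSeries_one]
    refine (summable_expPowSum hp (H.pos t ht)).tsum_le_tsum (fun n => ?_) ?_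
    · exact mul_le_mul_of_nonneg_left (H.lower t ht n) (by positivity)
    · simpa [chebU_at_one, pow_two, mul_assoc, mul_comm, mul_left_comm] using
        (H.rapidDecay hp ht).summable (x := 1) (by norm_num)
  · rw [charSeries_one, expPowSum, ← tsum_mul_left]
    refine Summable.tsum_le_tsum (fun n => ?_) ?_
      ((summable_expPowSum hp (H.pos t ht)).mul_left _)
    · calc _ ≤ ((n : ℝ) + 1) ^ 2 * (Real.exp (C * t) * Real.exp (-(h t * (n + 1)) ^ p)) := by
            gcongr; exact H.upper t ht n
        _ = _ := by ring
    · simpa [chebU_at_one, pow_two, mul_assoc, mul_comm, mul_left_comm] using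
        (H.rapidDecay hp ht).summable (x := 1) (by norm_num)

theorem evenPart_le_evenPart {f g : ℕ → ℝ} (hfg : ∀ n, f n ≤ g n) (n : ℕ) :
    evenPart f n ≤ evenPart g n := by
  simp only [evenPart]
  split_ifs
  exacts [hfg n, le_rfl]

theorem Summable.evenPart {f : ℕ → ℝ} (hf : Summable f) : Summable (evenPart f) := by
  refine (hf.indicator {n | Even n}).congr fun n => ?_
  simp [CompactLie.evenPart, Set.indicator]

theorem ExpPowComparable.tendsto_charSeries_evenPart (H : ExpPowComparable p h C b) (hp : p ≠ 0) :
    Tendsto (fun t => h t ^ 3 * charSeries (evenPart (b t)) 1) (𝓝[>] 0)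
      (𝓝 (1 / p * Real.Gamma (3 / p) / 2)) := by
  have hsum : ∀ t, 0 < t → Summable fun n : ℕ => ((n : ℝ) + 1) ^ 2 * b t n := fun t ht => by
    simpa [chebU_at_one, pow_two, mul_assoc, mul_comm, mul_left_comm] using
        (H.rapidDecay hp ht).summable (x := 1) (by norm_num)
  refine H.tendsto_of_bounds (L := fun h => ∑' n, evenPart
      (fun n : ℕ => ((n : ℝ) + 1) ^ 2 * Real.exp (-(h * (n + 1)) ^ p)) n)
      (tendsto_evenPart_expPow hp) (fun t ht => ?_) (fun t ht => ?_)
  · rw [charSeries_evenPart_one]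
    refine Summable.tsum_le_tsum (evenPart_le_evenPart fun n => ?_)
      (Summable.evenPart (summable_expPowSum hp (H.pos t ht))) (Summable.evenPart (hsum t ht))
    exact mul_le_mul_of_nonneg_left (H.lower t ht n) (by positivity)
  · rw [charSeries_evenPart_one, ← tsum_mul_left]
    have e : ∀ n, Real.exp (C * t) * evenPart
        (fun n : ℕ => ((n : ℝ) + 1) ^ 2 * Real.exp (-(h t * (n + 1)) ^ p)) n
        = evenPart (fun n : ℕ => Real.exp (C * t) *
          (((n : ℝ) + 1) ^ 2 * Real.exp (-(h t * (n + 1)) ^ p))) n := fun n => by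
      simp only [evenPart]; split_ifs <;> simp
    simp only [e]
    refine Summable.tsum_le_tsum (evenPart_le_evenPart fun n => ?_)
      (Summable.evenPart (hsum t ht))
      (Summable.evenPart ((summable_expPowSum hp (H.pos t ht)).mul_left _))
    calc _ ≤ ((n : ℝ) + 1) ^ 2 * (Real.exp (C * t) * Real.exp (-(h t * (n + 1)) ^ p)) := by
            gcongr; exact H.upper t ht n
      _ = _ := by ring

theorem isEquivalent_of_tendsto_cube_mul {h S a : ℝ → ℝ} {c : ℝ} (hc : 0 < c)
    (hh : ∀ t, 0 < t → 0 < h t)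
    (hS : Tendsto (fun t => h t ^ 3 * S t) (𝓝[>] 0) (𝓝 c))
    (ha : ∀ t, 0 < t → a t = c / h t ^ 3) : S ~[𝓝[>] 0] a := by
  refine (isEquivalent_iff_tendsto_one ?_).2 ?_
  · filter_upwards [self_mem_nhdsWithin] with t ht
    have := hh t ht
    rw [ha t ht]
    positivity
  · have := hS.div_const c
    rw [div_self hc.ne'] at this
    refine this.congr' ?_
    filter_upwards [self_mem_nhdsWithin] with t ht
    have := (hh t ht).ne'
    simp only [Pi.div_apply, ha t ht]
    field_simp

/-- The Fourier coefficients of the semigroup induced by `η` on `SU(2)`. -/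
noncomputable def semigroupCoeff (η : ℝ → ℝ) (t : ℝ) (n : ℕ) : ℝ :=
  Real.exp (-t * η √(n * (n + 2)))

theorem sqrt_mul_add_two_mem (n : ℕ) :
    (n : ℝ) ≤ √(n * (n + 2)) ∧ √((n : ℝ) * (n + 2)) ≤ n + 1 :=
  ⟨Real.le_sqrt_of_sq_le (by nlinarith [(Nat.cast_nonneg n : (0 : ℝ) ≤ n)]),
    Real.sqrt_le_iff.2 ⟨by positivity, by nlinarith⟩⟩

/-- Replacing √(n(n+2)) by n + 1 changes the exponent by at most σ t. -/
theorem cauchy_comparable {σ : ℝ} (hσ : 0 < σ) :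
    ExpPowComparable 1 (fun t => σ * t) σ (semigroupCoeff (cauchyExponent σ)) where
  lower t ht n := by
    have h := (sqrt_mul_add_two_mem n).2
    simp only [semigroupCoeff, cauchyExponent, abs_of_nonneg (Real.sqrt_nonneg _), pow_one]
    refine Real.exp_le_exp.2 ?_
    have : 0 < t * σ := by positivity
    nlinarith
  upper t ht n := by
    have h := (sqrt_mul_add_two_mem n).1
    simp only [semigroupCoeff, cauchyExponent, abs_of_nonneg (Real.sqrt_nonneg _), pow_one]
    rw [← Real.exp_add]
    refine Real.exp_le_exp.2 ?_
    have : 0 < t * σ := by positivity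
    nlinarith
  pos t ht := by positivity
  lim := by
    have : Tendsto (fun t : ℝ => σ * t) (𝓝 0) (𝓝 (σ * 0)) := tendsto_id.const_mul σ
    rw [mul_zero] at this
    exact this.mono_left nhdsWithin_le_nhds

/-- From √κ ≤ √(m² + κ) ≤ m + √κ the mass shifts the exponent by at most m t, and rounding √κ to n +
1 by at most t; hence the constant 1 + m. -/
theorem relativistic_comparable {m : ℝ} (hm : 0 < m) :
    ExpPowComparable 1 (fun t => t) (1 + m) (semigroupCoeff (relativisticExponent m)) where
  lower t ht n := by
    have h := (sqrt_mul_add_two_mem n).2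
    simp only [semigroupCoeff, relativisticExponent, pow_one]
    refine Real.exp_le_exp.2 ?_
    have h2 : √(m ^ 2 + √((n : ℝ) * (n + 2)) ^ 2) ≤ m + √(n * (n + 2)) :=
      Real.sqrt_le_iff.2 ⟨by positivity, by nlinarith [Real.sqrt_nonneg ((n : ℝ) * (n + 2))]⟩
    nlinarith
  upper t ht n := by
    have h := (sqrt_mul_add_two_mem n).1
    simp only [semigroupCoeff, relativisticExponent, pow_one]
    rw [← Real.exp_add]
    refine Real.exp_le_exp.2 ?_
    have h2 : √((n : ℝ) * (n + 2)) ≤ √(m ^ 2 + √((n : ℝ) * (n + 2)) ^ 2) :=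
      Real.le_sqrt_of_sq_le (by nlinarith)
    nlinarith
  pos t ht := ht
  lim := tendsto_id.mono_left nhdsWithin_le_nhds

/-- Here n(n + 2) = (n + 1)² - 1, so the upper bound is an equality, with h² = σ² t / 2. -/
theorem gauss_comparable {σ : ℝ} (hσ : 0 < σ) :
    ExpPowComparable 2 (fun t => σ * √(t / 2)) (σ ^ 2 / 2)
      (semigroupCoeff (gaussExponent σ)) where
  lower t ht n := by
    simp only [semigroupCoeff, gaussExponent]
    refine Real.exp_le_exp.2 ?_
    rw [Real.sq_sqrt (by positivity), mul_pow, mul_pow, Real.sq_sqrt (by positivity)]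
    have : 0 < t * σ ^ 2 := by positivity
    nlinarith
  upper t ht n := by
    simp only [semigroupCoeff, gaussExponent]
    rw [← Real.exp_add]
    refine Real.exp_le_exp.2 ?_
    rw [Real.sq_sqrt (by positivity), mul_pow, mul_pow, Real.sq_sqrt (by positivity)]
    nlinarith
  pos t ht := by positivity
  lim := by
    have : Tendsto (fun t : ℝ => σ * √(t / 2)) (𝓝 0) (𝓝 (σ * √(0 / 2))) :=
      Continuous.tendsto (by fun_prop) 0
    rw [zero_div, Real.sqrt_zero, mul_zero] at this
    exact this.mono_left nhdsWithin_le_nhds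

theorem gamma_three_halves : Real.Gamma (3 / 2) = √Real.pi / 2 := by
  rw [show (3 / 2 : ℝ) = 1 / 2 + 1 by norm_num, Real.Gamma_add_one (by norm_num),
    Real.Gamma_one_half_eq]
  ring

theorem gauss_rate {σ t : ℝ} (hσ : 0 < σ) (ht : 0 < t) :
    √(Real.pi / 2) / σ ^ 3 * t ^ (-(3 / 2) : ℝ) = √Real.pi / 4 / (σ * √(t / 2)) ^ 3 := by
  have h1 : t ^ (-(3 / 2) : ℝ) = 1 / (t * √t) := by
    rw [Real.rpow_neg ht.le, show (3 / 2 : ℝ) = 1 + 1 / 2 by norm_num, Real.rpow_add ht,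
      Real.rpow_one, ← Real.sqrt_eq_rpow, one_div]
  have h2 : √2 * √2 = 2 := Real.mul_self_sqrt (by norm_num)
  have h3 : √t * √t = t := Real.mul_self_sqrt ht.le
  have ht' : 0 < √t := Real.sqrt_pos.2 ht
  have h2' : 0 < √(2 : ℝ) := Real.sqrt_pos.2 (by norm_num)
  rw [h1, Real.sqrt_div Real.pi_pos.le, Real.sqrt_div ht.le]
  field_simp
  rw [show √(2 : ℝ) ^ 4 = (√2 * √2) * (√2 * √2) by ring, h2, sq, h3]
  ring

end Asymptotics

end CompactLie

namespace CompactLie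

/-! ### Decomposition of unitary representations and density of matrix coefficients -/

section Representations

variable {G : Type} [Group G] [TopologicalSpace G]
variable {V : Type} [NormedAddCommGroup V] [InnerProductSpace ℂ V] [FiniteDimensional ℂ V]

local notation "⟪" v ", " w "⟫" => inner ℂ v w

/-- A finite dimensional unitary representation, differentiable along the one-parameter subgroups
`x i`, whose Casimir operator commutes with the group action. -/
structure DiffRep (x : Fin 3 → ℝ → G) (V : Type) [NormedAddCommGroup V] [InnerProductSpace ℂ V]
    [FiniteDimensional ℂ V] where
  A : G →* (V →ₗ[ℂ] V)
  unitary : ∀ g v w, ⟪A g v, w⟫ = ⟪v, A g⁻¹ w⟫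
  cont : ∀ v w, Continuous fun g => ⟪v, A g w⟫
  D : Fin 3 → V →ₗ[ℂ] V
  hasDeriv : ∀ k v w, HasDerivAt (fun s => ⟪v, A (x k s) w⟫) ⟪v, D k w⟫ 0
  skew : ∀ k v w, ⟪D k v, w⟫ = -⟪v, D k w⟫
  commutes : ∀ g v, (∑ k, D k * D k) (A g v) = A g ((∑ k, D k * D k) v)

namespace DiffRep

variable {x : Fin 3 → ℝ → G} (R : DiffRep x V)

/-- Subspaces invariant under the group. -/
def Invariant (W : Submodule ℂ V) : Prop := ∀ g, ∀ v ∈ W, R.A g v ∈ W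

/-- Nonzero invariant subspaces without proper invariant subspaces. -/
structure Irreducible (W : Submodule ℂ V) : Prop where
  invariant : R.Invariant W
  ne_bot : W ≠ ⊥
  eq_bot_or_eq : ∀ U ≤ W, R.Invariant U → U = ⊥ ∨ U = W

theorem Invariant.orthogonal_inf {R : DiffRep x V} {U W : Submodule ℂ V} (hU : R.Invariant U)
    (hW : R.Invariant W) : R.Invariant (Uᗮ ⊓ W) := by
  rintro g v ⟨h1, h2⟩
  refine ⟨?_, hW g v h2⟩
  rw [SetLike.mem_coe, Submodule.mem_orthogonal] at h1 ⊢
  intro u hu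
  have := R.unitary g⁻¹ u v
  rw [inv_inv] at this
  rw [← this]
  exact h1 _ (hU _ _ hu)

/-- Every property of vectors closed under addition and valid on irreducible subspaces holds. -/
theorem induction {P : V → Prop} (h0 : P 0) (hadd : ∀ v w, P v → P w → P (v + w))
    (hirr : ∀ W, R.Irreducible W → ∀ v ∈ W, P v) (v : V) : P v := by
  suffices H : ∀ n, ∀ W : Submodule ℂ V, Module.finrank ℂ W = n → R.Invariant W →
      ∀ v ∈ W, P v from
    H _ ⊤ rfl (fun _ _ _ => Submodule.mem_top) v Submodule.mem_top
  intro n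
  induction n using Nat.strong_induction_on with
  | _ n ih =>
    intro W hn hW v hv
    by_cases hb : W = ⊥
    · subst hb
      rw [Submodule.mem_bot] at hv
      rwa [hv]
    by_cases hir : R.Irreducible W
    · exact hirr W hir v hv
    obtain ⟨U, hUW, hU, hU0, hU1⟩ : ∃ U ≤ W, R.Invariant U ∧ U ≠ ⊥ ∧ U ≠ W := by
      by_contra! hcon
      exact hir ⟨hW, hb, fun U hUW hU => or_iff_not_imp_left.2 (hcon U hUW hU)⟩
    have hlt : U < W := lt_of_le_of_ne hUW hU1
    have hlt' : Uᗮ ⊓ W < W := by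
      refine lt_of_le_of_ne inf_le_right fun h => hU0 ?_
      rw [inf_eq_right] at h
      rw [eq_bot_iff]
      intro u hu
      have h1 := h (hUW hu)
      exact (Submodule.mem_bot ℂ).2 (inner_self_eq_zero.1 (h1 u hu))
    have hsup : U ⊔ Uᗮ ⊓ W = W := Submodule.sup_orthogonal_inf_of_hasOrthogonalProjection hUW
    rw [← hsup] at hv
    obtain ⟨a, ha, b, hb', rfl⟩ := Submodule.mem_sup.1 hv
    exact hadd _ _
      (ih _ (hn ▸ Submodule.finrank_lt_finrank_of_lt hlt) U rfl hU a ha)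
      (ih _ (hn ▸ Submodule.finrank_lt_finrank_of_lt hlt') _ rfl (hU.orthogonal_inf hW) b hb')

/-- W is its own double orthogonal complement, and for u ⊥ W the function s ↦ ⟪u, A(x_k(s)) v⟫
vanishes identically, hence so does its derivative. -/
theorem Invariant.derivative {R : DiffRep x V} {W : Submodule ℂ V} (hW : R.Invariant W)
    (k : Fin 3) : ∀ v ∈ W, R.D k v ∈ W := by
  intro v hv
  rw [← Submodule.orthogonal_orthogonal W, Submodule.mem_orthogonal]
  intro u hu
  have h1 := R.hasDeriv k u v
  have h2 : (fun s => ⟪u, R.A (x k s) v⟫) = fun _ => 0 := by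
    funext s
    rw [Submodule.mem_orthogonal'] at hu
    exact hu _ (hW _ _ hv)
  rw [h2] at h1
  exact h1.unique (hasDerivAt_const _ _)

variable {R}

/-- The representation on an invariant subspace. -/
def restrict {W : Submodule ℂ V} (hW : R.Invariant W) : G →* (W →ₗ[ℂ] W) where
  toFun g := (R.A g).restrict (hW g)
  map_one' := by ext v; simp
  map_mul' g h := by ext v; simp

theorem star_restrict {W : Submodule ℂ V} (hW : R.Invariant W) (g : G) :
    star (restrict hW g) = restrict hW g⁻¹ := by
  rw [LinearMap.star_eq_adjoint]
  refine ((LinearMap.eq_adjoint_iff _ _).2 fun v w => ?_).symm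
  have := R.unitary g⁻¹ v w
  rw [inv_inv] at this
  exact this

/-- The matrix of the representation on an invariant subspace in an orthonormal basis. -/
noncomputable def matrixRep {W : Submodule ℂ V} (hW : R.Invariant W) (g : G) :
    Matrix (Fin (Module.finrank ℂ W)) (Fin (Module.finrank ℂ W)) ℂ :=
  LinearMap.toMatrixOrthonormal (stdOrthonormalBasis ℂ W) (restrict hW g)

theorem matrixRep_apply {W : Submodule ℂ V} (hW : R.Invariant W) (g : G)
    (i j : Fin (Module.finrank ℂ W)) : matrixRep hW g i j
      = ⟪(stdOrthonormalBasis ℂ W i : V), R.A g (stdOrthonormalBasis ℂ W j)⟫ :=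
  LinearMap.toMatrixOrthonormal_apply_apply ..

theorem matrixRep_one {W : Submodule ℂ V} (hW : R.Invariant W) : matrixRep hW 1 = 1 := by
  rw [matrixRep, map_one, map_one]

theorem matrixRep_mul {W : Submodule ℂ V} (hW : R.Invariant W) (g h : G) :
    matrixRep hW (g * h) = matrixRep hW g * matrixRep hW h := by
  rw [matrixRep, map_mul, map_mul, matrixRep, matrixRep]

theorem matrixRep_mem {W : Submodule ℂ V} (hW : R.Invariant W) (g : G) :
    matrixRep hW g ∈ Matrix.unitaryGroup (Fin (Module.finrank ℂ W)) ℂ := by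
  rw [Matrix.mem_unitaryGroup_iff, matrixRep, ← map_star, star_restrict, ← map_mul, ← map_mul,
    mul_inv_cancel, map_one, map_one]

theorem apply_basis {W : Submodule ℂ V} (hW : R.Invariant W) (g : G)
    (j : Fin (Module.finrank ℂ W)) : R.A g (stdOrthonormalBasis ℂ W j)
      = ∑ i, matrixRep hW g i j • (stdOrthonormalBasis ℂ W i : V) := by
  have := (stdOrthonormalBasis ℂ W).sum_repr (restrict hW g (stdOrthonormalBasis ℂ W j))
  have h2 := congrArg W.subtype this
  rw [map_sum] at h2
  refine h2.symm.trans (Finset.sum_congr rfl fun i _ => ?_)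
  rw [map_smul, OrthonormalBasis.repr_apply_apply, matrixRep_apply]
  rfl

/-- The embedding of coordinate vectors in the subspace. -/
noncomputable def embed (W : Submodule ℂ V) : (Fin (Module.finrank ℂ W) → ℂ) →ₗ[ℂ] V :=
  W.subtype ∘ₗ (stdOrthonormalBasis ℂ W).toBasis.equivFun.symm.toLinearMap

theorem embed_apply (W : Submodule ℂ V) (c : Fin (Module.finrank ℂ W) → ℂ) :
    embed W c = ∑ i, c i • (stdOrthonormalBasis ℂ W i : V) := by
  simp only [embed, LinearMap.comp_apply, LinearEquiv.coe_coe, Module.Basis.equivFun_symm_apply,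
    map_sum, map_smul, OrthonormalBasis.coe_toBasis, Submodule.subtype_apply]

theorem embed_injective (W : Submodule ℂ V) : Function.Injective (embed W) :=
  W.subtype_injective.comp (LinearEquiv.injective _)

theorem range_embed (W : Submodule ℂ V) : LinearMap.range (embed W) = W := by
  rw [embed, LinearMap.range_comp, LinearEquiv.range, Submodule.map_subtype_top]

theorem apply_embed {W : Submodule ℂ V} (hW : R.Invariant W) (g : G)
    (c : Fin (Module.finrank ℂ W) → ℂ) :
    R.A g (embed W c) = embed W ((matrixRep hW g).mulVec c) := by
  simp only [embed_apply, map_sum, map_smul, apply_basis hW, Matrix.mulVec, dotProduct,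
    Finset.smul_sum, Finset.sum_smul, smul_smul]
  rw [Finset.sum_comm]
  exact Finset.sum_congr rfl fun i _ => Finset.sum_congr rfl fun j _ => by rw [mul_comm]

theorem Irreducible.matrix_irreducible {W : Submodule ℂ V} (hW : R.Irreducible W)
    (U : Submodule ℂ (Fin (Module.finrank ℂ W) → ℂ))
    (hU : ∀ g, ∀ v ∈ U, (matrixRep hW.invariant g).mulVec v ∈ U) : U = ⊥ ∨ U = ⊤ := by
  have hinv : R.Invariant (U.map (embed W)) := by
    rintro g _ ⟨u, hu, rfl⟩
    exact ⟨_, hU g u hu, (apply_embed hW.invariant g u).symm⟩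
  have hle : U.map (embed W) ≤ W := (LinearMap.map_le_range).trans (range_embed W).le
  rcases hW.eq_bot_or_eq _ hle hinv with h | h
  · left
    exact Submodule.map_injective_of_injective (embed_injective W) (h.trans (Submodule.map_bot _).symm)
  · right
    rw [eq_top_iff]
    intro u _
    have : embed W u ∈ U.map (embed W) := by
      rw [h]
      exact (range_embed W).le ⟨u, rfl⟩
    obtain ⟨u', hu', h3⟩ := this
    rwa [← embed_injective W h3]

/-- The irreducible representation in matrix form on an irreducible subspace. -/
noncomputable def Irreducible.toUnitaryIrrep {W : Submodule ℂ V} (hW : R.Irreducible W) :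
    UnitaryIrrep G (Module.finrank ℂ W) where
  toHom :=
    { toFun := fun g => ⟨matrixRep hW.invariant g, matrixRep_mem hW.invariant g⟩
      map_one' := Subtype.ext (matrixRep_one hW.invariant)
      map_mul' := fun g h => Subtype.ext (matrixRep_mul hW.invariant g h) }
  continuous_toHom := by
    refine Continuous.subtype_mk (continuous_matrix fun i j => ?_) _
    simp only [matrixRep_apply]
    exact R.cont _ _
  dim_pos := by
    rw [Module.finrank_pos_iff, Submodule.nontrivial_iff_ne_bot]
    exact hW.ne_bot
  irreducible := hW.matrix_irreducible

theorem Irreducible.toHom_apply {W : Submodule ℂ V} (hW : R.Irreducible W) (g : G) :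
    ((hW.toUnitaryIrrep.toHom g : Matrix.unitaryGroup _ ℂ) : Matrix _ _ ℂ)
      = matrixRep hW.invariant g := rfl

variable (R) in
/-- The Casimir operator. -/
noncomputable def casimirOp : V →ₗ[ℂ] V := ∑ k, R.D k * R.D k

theorem casimirOp_isSymmetric : R.casimirOp.IsSymmetric := by
  intro v w
  simp only [casimirOp, LinearMap.sum_apply, Module.End.mul_apply, sum_inner, inner_sum]
  refine Finset.sum_congr rfl fun k _ => ?_
  rw [R.skew, R.skew, neg_neg]

/-- Schur's lemma for the Casimir operator on an irreducible subspace. -/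
theorem Irreducible.exists_casimir {W : Submodule ℂ V} (hW : R.Irreducible W) :
    ∃ κ : ℝ, ∀ v ∈ W, R.casimirOp v = (-κ : ℂ) • v := by
  have hC : ∀ v ∈ W, R.casimirOp v ∈ W := fun v hv => by
    simp only [casimirOp, LinearMap.sum_apply]
    exact W.sum_mem fun k _ => hW.invariant.derivative k _ (hW.invariant.derivative k _ hv)
  have : Nontrivial W := W.nontrivial_iff_ne_bot.2 hW.ne_bot
  obtain ⟨μ, hμ⟩ := Module.End.exists_eigenvalue (R.casimirOp.restrict hC)
  obtain ⟨⟨v, hvW⟩, hv⟩ := hμ.exists_hasEigenvector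
  have hv1 : R.casimirOp v = μ • v := congrArg Subtype.val hv.apply_eq_smul
  have hv0 : v ≠ 0 := fun h => hv.2 (Subtype.ext h)
  have hreal : (starRingEnd ℂ) μ = μ :=
    casimirOp_isSymmetric.conj_eigenvalue_eq_self (Module.End.hasEigenvalue_of_hasEigenvector
      (x := v) ⟨Module.End.mem_eigenspace_iff.2 hv1, hv0⟩)
  -- The Casimir commutes with the group, so its eigenspace is invariant; meeting W nontrivially, it
  -- contains W.
  have hinv : R.Invariant (Module.End.eigenspace R.casimirOp μ ⊓ W) := by
    rintro g u ⟨h1, h2⟩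
    refine ⟨?_, hW.invariant g u h2⟩
    rw [SetLike.mem_coe, Module.End.mem_eigenspace_iff] at h1 ⊢
    rw [casimirOp, R.commutes, ← casimirOp, h1, map_smul]
  have heq : Module.End.eigenspace R.casimirOp μ ⊓ W = W := by
    refine (hW.eq_bot_or_eq _ inf_le_right hinv).resolve_left fun h => hv0 ?_
    rw [← Submodule.mem_bot ℂ, ← h]
    exact ⟨Module.End.mem_eigenspace_iff.2 hv1, hvW⟩
  refine ⟨-μ.re, fun w hw => ?_⟩
  rw [← heq] at hw
  rw [Module.End.mem_eigenspace_iff.1 hw.1, Complex.ofReal_neg, neg_neg,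
    Complex.conj_eq_iff_re.1 hreal]

theorem derivative_basis {W : Submodule ℂ V} (hW : R.Invariant W) (k : Fin 3)
    (j : Fin (Module.finrank ℂ W)) : R.D k (stdOrthonormalBasis ℂ W j)
      = ∑ i, ⟪(stdOrthonormalBasis ℂ W i : V), R.D k (stdOrthonormalBasis ℂ W j)⟫ •
        (stdOrthonormalBasis ℂ W i : V) := by
  have := (stdOrthonormalBasis ℂ W).sum_repr
    ((R.D k).restrict (hW.derivative k) (stdOrthonormalBasis ℂ W j))
  have h2 := congrArg W.subtype this
  rw [map_sum] at h2
  refine h2.symm.trans (Finset.sum_congr rfl fun i _ => ?_)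
  rw [map_smul, OrthonormalBasis.repr_apply_apply]
  rfl

theorem Irreducible.derived_apply {W : Submodule ℂ V} (hW : R.Irreducible W) (k : Fin 3)
    (i j : Fin (Module.finrank ℂ W)) : hW.toUnitaryIrrep.derived (x k) i j
      = ⟪(stdOrthonormalBasis ℂ W i : V), R.D k (stdOrthonormalBasis ℂ W j)⟫ := by
  simp only [UnitaryIrrep.derived, Matrix.of_apply, hW.toHom_apply, matrixRep_apply]
  exact (R.hasDeriv k _ _).deriv

theorem Irreducible.casimir_eq {W : Submodule ℂ V} (hW : R.Irreducible W) {κ : ℝ}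
    (hκ : ∀ v ∈ W, R.casimirOp v = (-κ : ℂ) • v) :
    hW.toUnitaryIrrep.casimir x = (-κ : ℂ) • 1 := by
  ext i j
  set b := stdOrthonormalBasis ℂ W
  have h1 : hW.toUnitaryIrrep.casimir x i j = ⟪(b i : V), R.casimirOp (b j)⟫ := by
    simp only [UnitaryIrrep.casimir, Matrix.sum_apply, Matrix.mul_apply, hW.derived_apply,
      casimirOp, LinearMap.sum_apply, Module.End.mul_apply, inner_sum]
    refine Finset.sum_congr rfl fun k _ => ?_
    conv_rhs => rw [derivative_basis hW.invariant k j, map_sum, inner_sum]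
    refine Finset.sum_congr rfl fun l _ => ?_
    rw [map_smul, inner_smul_right, mul_comm]
  rw [h1, hκ _ (b j).2, inner_smul_right, Matrix.smul_apply, smul_eq_mul, Matrix.one_apply,
    ← b.inner_eq_ite i j]
  rfl

/-- Submodules of `C(G, ℂ)` containing all matrix coefficients of irreducible representations on
which the Casimir operator is a real scalar. -/
def _root_.CompactLie.ContainsCoeffs (x : Fin 3 → ℝ → G) (S : Submodule ℂ C(G, ℂ)) : Prop :=
  ∀ (d : ℕ) (π : UnitaryIrrep G d) (κ : ℝ),
    π.casimir x = (-κ : ℂ) • (1 : Matrix (Fin d) (Fin d) ℂ) → ∀ i j, ∀ f : C(G, ℂ),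
      (∀ g, f g = (π.toHom g : Matrix (Fin d) (Fin d) ℂ) i j) → f ∈ S

/-- Additivity in w reduces to w in an irreducible subspace, where `Irreducible.exists_casimir`
supplies the scalar required by `ContainsCoeffs`. Thus only irreducibles found inside a given
`DiffRep` need a scalar Casimir, not arbitrary ones. -/
theorem coeff_mem (R : DiffRep x V) {S : Submodule ℂ C(G, ℂ)} (hS : ContainsCoeffs x S)
    (v w : V) (f : C(G, ℂ)) (hf : ∀ g, f g = ⟪v, R.A g w⟫) : f ∈ S := by
  suffices H : ∀ v, (⟨fun g => ⟪v, R.A g w⟫, R.cont v w⟩ : C(G, ℂ)) ∈ S by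
    have h : f = ⟨fun g => ⟪v, R.A g w⟫, R.cont v w⟩ := ContinuousMap.ext hf
    rw [h]
    exact H v
  refine R.induction (P := fun w => ∀ v, (⟨fun g => ⟪v, R.A g w⟫, R.cont v w⟩ : C(G, ℂ)) ∈ S)
    (fun v => ?_) (fun w₁ w₂ h₁ h₂ v => ?_) (fun W hW w hw v => ?_) w
  · have : (⟨fun g => ⟪v, R.A g 0⟫, R.cont v 0⟩ : C(G, ℂ)) = 0 := by
      ext g
      simp
    rw [this]
    exact S.zero_mem
  · have : (⟨fun g => ⟪v, R.A g (w₁ + w₂)⟫, R.cont v (w₁ + w₂)⟩ : C(G, ℂ))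
        = ⟨fun g => ⟪v, R.A g w₁⟫, R.cont v w₁⟩ + ⟨fun g => ⟪v, R.A g w₂⟫, R.cont v w₂⟩ := by
      ext g
      simp
    rw [this]
    exact S.add_mem (h₁ v) (h₂ v)
  · obtain ⟨κ, hκ⟩ := hW.exists_casimir
    obtain ⟨c, rfl⟩ : ∃ c, embed W c = w := by
      rw [← range_embed W] at hw
      exact hw
    have hcont : ∀ i j, Continuous fun g => matrixRep hW.invariant g i j := fun i j => by
      simp only [matrixRep_apply]
      exact R.cont _ _
    have hmem : ∀ i j, (⟨_, hcont i j⟩ : C(G, ℂ)) ∈ S := fun i j =>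
      hS _ hW.toUnitaryIrrep κ (hW.casimir_eq hκ) i j _ fun g => rfl
    have : (⟨fun g => ⟪v, R.A g (embed W c)⟫, R.cont v _⟩ : C(G, ℂ))
        = ∑ i, ∑ j, (c j * ⟪v, (stdOrthonormalBasis ℂ W i : V)⟫) •
          (⟨_, hcont i j⟩ : C(G, ℂ)) := by
      ext g
      simp only [ContinuousMap.coe_mk, ContinuousMap.sum_apply, ContinuousMap.smul_apply,
        smul_eq_mul]
      rw [apply_embed hW.invariant, embed_apply, inner_sum]
      refine Finset.sum_congr rfl fun i _ => ?_
      rw [inner_smul_right, Matrix.mulVec, dotProduct, Finset.sum_mul]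
      exact Finset.sum_congr rfl fun j _ => by ring
    rw [this]
    exact S.sum_mem fun i _ => S.sum_mem fun j _ => S.smul_mem _ (hmem i j)

end DiffRep
end Representations
end CompactLie

namespace CompactLie

/-! ### Tensor powers of the defining representation -/

section Tensor

variable {n m : ℕ}

/-- The Kronecker product of a family of square matrices. -/
def piKron (A : Fin n → Matrix (Fin m) (Fin m) ℂ) : Matrix (Fin n → Fin m) (Fin n → Fin m) ℂ :=
  Matrix.of fun I J => ∏ k, A k (I k) (J k)

theorem piKron_apply (A : Fin n → Matrix (Fin m) (Fin m) ℂ) (I J : Fin n → Fin m) :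
    piKron A I J = ∏ k, A k (I k) (J k) := rfl

theorem piKron_mul (A B : Fin n → Matrix (Fin m) (Fin m) ℂ) :
    piKron A * piKron B = piKron fun k => A k * B k := by
  ext I J
  simp only [Matrix.mul_apply, piKron_apply, ← Finset.prod_mul_distrib]
  rw [Finset.prod_univ_sum, Fintype.piFinset_univ]

theorem piKron_one : piKron (fun _ : Fin n => (1 : Matrix (Fin m) (Fin m) ℂ)) = 1 := by
  ext I J
  simp only [piKron_apply, Matrix.one_apply]
  rw [Fintype.prod_ite_zero]
  simp [funext_iff]

theorem star_piKron (A : Fin n → Matrix (Fin m) (Fin m) ℂ) :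
    star (piKron A) = piKron fun k => star (A k) := by
  ext I J
  simp [piKron_apply, Matrix.star_apply]

/-- The derivation of the tensor power induced by a matrix. -/
noncomputable def tensorDer (n : ℕ) (X : Matrix (Fin m) (Fin m) ℂ) :
    Matrix (Fin n → Fin m) (Fin n → Fin m) ℂ :=
  ∑ k, piKron (Function.update (fun _ => 1) k X)

theorem tensorDer_apply (X : Matrix (Fin m) (Fin m) ℂ) (I J : Fin n → Fin m) :
    tensorDer n X I J = ∑ k, X (I k) (J k) *
      ∏ l ∈ Finset.univ.erase k, (1 : Matrix (Fin m) (Fin m) ℂ) (I l) (J l) := by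
  rw [tensorDer, Matrix.sum_apply]
  refine Finset.sum_congr rfl fun k _ => ?_
  rw [piKron_apply, ← Finset.mul_prod_erase _ _ (Finset.mem_univ k), Function.update_self]
  congr 1
  refine Finset.prod_congr rfl fun l hl => ?_
  rw [Function.update_of_ne (Finset.ne_of_mem_erase hl)]

theorem conj_tensorDer {g : Matrix (Fin m) (Fin m) ℂ} (hg : g * star g = 1)
    (X : Matrix (Fin m) (Fin m) ℂ) :
    piKron (fun _ : Fin n => g) * tensorDer n X * piKron (fun _ => star g)
      = tensorDer n (g * X * star g) := by
  rw [tensorDer, tensorDer, Finset.mul_sum, Finset.sum_mul]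
  refine Finset.sum_congr rfl fun k _ => ?_
  rw [piKron_mul, piKron_mul]
  congr 1
  funext l
  rcases eq_or_ne l k with rfl | h
  · simp
  · simp [Function.update_of_ne h, hg]

/-- Each entry of the Casimir on the tensor power is a linear function of the tensor ∑ X_i ⊗ X_i, so
only that tensor matters. -/
theorem sum_tensorDer_mul_congr {X Y : Fin 3 → Matrix (Fin m) (Fin m) ℂ}
    (h : ∀ a b c d, ∑ i, X i a b * X i c d = ∑ i, Y i a b * Y i c d) :
    ∑ i, tensorDer n (X i) * tensorDer n (X i) = ∑ i, tensorDer n (Y i) * tensorDer n (Y i) := by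
  ext I J
  have key : ∀ Z : Fin 3 → Matrix (Fin m) (Fin m) ℂ,
      (∑ i, tensorDer n (Z i) * tensorDer n (Z i)) I J = ∑ L : Fin n → Fin m, ∑ k, ∑ l,
        (∑ i, Z i (I k) (L k) * Z i (L l) (J l)) *
        ((∏ r ∈ Finset.univ.erase k, (1 : Matrix (Fin m) (Fin m) ℂ) (I r) (L r)) *
        ∏ r ∈ Finset.univ.erase l, (1 : Matrix (Fin m) (Fin m) ℂ) (L r) (J r)) := by
    intro Z
    simp only [Matrix.sum_apply, Matrix.mul_apply, tensorDer_apply, Finset.sum_mul]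
    rw [Finset.sum_comm]
    refine Finset.sum_congr rfl fun L _ => ?_
    rw [Finset.sum_comm]
    refine Finset.sum_congr rfl fun k _ => ?_
    rw [Finset.sum_comm]
    refine Finset.sum_congr rfl fun i _ => ?_
    rw [Finset.mul_sum]
    refine Finset.sum_congr rfl fun l _ => ?_
    ring
  rw [key, key]
  simp only [h]

theorem star_tensorDer (X : Matrix (Fin m) (Fin m) ℂ) :
    star (tensorDer n X) = tensorDer n (star X) := by
  rw [tensorDer, star_sum, tensorDer]
  refine Finset.sum_congr rfl fun k _ => ?_
  rw [star_piKron]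
  congr 1
  funext l
  rcases eq_or_ne l k with rfl | h
  · simp
  · simp [Function.update_of_ne h]

theorem tensorDer_neg (X : Matrix (Fin m) (Fin m) ℂ) : tensorDer n (-X) = -tensorDer n X := by
  ext I J
  simp [tensorDer_apply]

theorem hasDerivAt_piKron {A : ℝ → Matrix (Fin m) (Fin m) ℂ} {X : Matrix (Fin m) (Fin m) ℂ}
    (hA : ∀ i j, HasDerivAt (fun s => A s i j) (X i j) 0) (h0 : A 0 = 1) (I J : Fin n → Fin m) :
    HasDerivAt (fun s => piKron (fun _ => A s) I J) (tensorDer n X I J) 0 := by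
  have := HasDerivAt.fun_finsetProd (u := Finset.univ) (x := (0 : ℝ))
    (f := fun k s => A s (I k) (J k)) (f' := fun k => X (I k) (J k)) fun k _ => hA _ _
  simp only [piKron_apply]
  refine this.congr_deriv ?_
  rw [tensorDer_apply]
  refine Finset.sum_congr rfl fun k _ => ?_
  rw [h0, smul_eq_mul, mul_comm]

/-- Endomorphisms of the tensor power given by matrices. -/
noncomputable def tensorOp (n m : ℕ) :
    Matrix (Fin n → Fin m) (Fin n → Fin m) ℂ ≃⋆ₐ[ℂ]
      (EuclideanSpace ℂ (Fin n → Fin m) →ₗ[ℂ] EuclideanSpace ℂ (Fin n → Fin m)) :=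
  (LinearMap.toMatrixOrthonormal (EuclideanSpace.basisFun (Fin n → Fin m) ℂ)).symm

theorem inner_tensorOp_star (M : Matrix (Fin n → Fin m) (Fin n → Fin m) ℂ)
    (v w : EuclideanSpace ℂ (Fin n → Fin m)) :
    inner ℂ (tensorOp n m M v) w = inner ℂ v (tensorOp n m (star M) w) := by
  rw [map_star, LinearMap.star_eq_adjoint, LinearMap.adjoint_inner_right]

theorem inner_tensorOp_basis (M : Matrix (Fin n → Fin m) (Fin n → Fin m) ℂ)
    (I J : Fin n → Fin m) :
    inner ℂ (EuclideanSpace.basisFun (Fin n → Fin m) ℂ I)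
      (tensorOp n m M (EuclideanSpace.basisFun (Fin n → Fin m) ℂ J)) = M I J := by
  rw [← LinearMap.toMatrixOrthonormal_apply_apply, tensorOp, StarAlgEquiv.apply_symm_apply]

theorem inner_tensorOp_eq_sum (M : Matrix (Fin n → Fin m) (Fin n → Fin m) ℂ)
    (v w : EuclideanSpace ℂ (Fin n → Fin m)) :
    inner ℂ v (tensorOp n m M w)
      = ∑ I, ∑ J, M I J * inner ℂ v (tensorOp n m (Matrix.single I J 1) w) := by
  conv_lhs => rw [Matrix.matrix_eq_sum_single M]
  simp only [map_sum, LinearMap.sum_apply, inner_sum]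
  refine Finset.sum_congr rfl fun I _ => Finset.sum_congr rfl fun J _ => ?_
  rw [show Matrix.single I J (M I J) = M I J • Matrix.single I J (1 : ℂ) by
    rw [Matrix.smul_single, smul_eq_mul, mul_one], map_smul, LinearMap.smul_apply,
    inner_smul_right]

variable {G : Type} [Group G] [TopologicalSpace G]

/-- A faithful unitary representation `ρ`, with derivatives `X i` along the one-parameter
subgroups `x i`, for which the Casimir tensor `∑ X i ⊗ X i` is invariant. -/
structure FaithfulFrame (x : Fin 3 → ℝ → G) (ρ : G →* Matrix.unitaryGroup (Fin m) ℂ)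
    (X : Fin 3 → Matrix (Fin m) (Fin m) ℂ) : Prop where
  continuous : Continuous ρ
  injective : Function.Injective ρ
  zero : ∀ k, x k 0 = 1
  deriv : ∀ k i j, HasDerivAt (fun s => (ρ (x k s) : Matrix (Fin m) (Fin m) ℂ) i j) (X k i j) 0
  skew : ∀ k, star (X k) = -X k
  invariant : ∀ g a b c d, ∑ k, ((ρ g : Matrix (Fin m) (Fin m) ℂ) * X k * star (ρ g).1) a b *
    ((ρ g : Matrix (Fin m) (Fin m) ℂ) * X k * star (ρ g).1) c d = ∑ k, X k a b * X k c d
  star_entry : ∀ i j, ∃ i' j', ∃ ε : ℂ, ∀ g, star ((ρ g : Matrix (Fin m) (Fin m) ℂ) i j)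
    = ε * (ρ g : Matrix (Fin m) (Fin m) ℂ) i' j'

variable {x : Fin 3 → ℝ → G} {ρ : G →* Matrix.unitaryGroup (Fin m) ℂ}
  {X : Fin 3 → Matrix (Fin m) (Fin m) ℂ}

theorem FaithfulFrame.continuous_entry (H : FaithfulFrame x ρ X) (i j : Fin m) :
    Continuous fun g => (ρ g : Matrix (Fin m) (Fin m) ℂ) i j :=
  (continuous_subtype_val.comp H.continuous).matrix_elem i j

/-- The tensor powers of the defining representation. -/
noncomputable def FaithfulFrame.tensorRep (H : FaithfulFrame x ρ X) (n : ℕ) :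
    DiffRep x (EuclideanSpace ℂ (Fin n → Fin m)) where
  A :=
    { toFun := fun g => tensorOp n m (piKron fun _ => (ρ g).1)
      map_one' := by
        rw [map_one]
        simp only [Submonoid.coe_one]
        rw [piKron_one, map_one]
      map_mul' := fun g h => by
        rw [← map_mul (tensorOp n m), piKron_mul, map_mul ρ]
        rfl }
  unitary g v w := by
    have h : ((ρ g⁻¹ : Matrix.unitaryGroup (Fin m) ℂ) : Matrix (Fin m) (Fin m) ℂ)
        = star (ρ g).1 := by rw [map_inv]; rfl
    simp only [MonoidHom.coe_mk, OneHom.coe_mk]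
    rw [inner_tensorOp_star, star_piKron, h]
  cont v w := by
    simp only [MonoidHom.coe_mk, OneHom.coe_mk]
    simp_rw [inner_tensorOp_eq_sum (piKron _), piKron_apply]
    refine continuous_finsetSum _ fun I _ => continuous_finsetSum _ fun J _ => ?_
    exact (continuous_finsetProd _ fun k _ => H.continuous_entry _ _).mul continuous_const
  D k := tensorOp n m (tensorDer n (X k))
  hasDeriv k v w := by
    simp only [MonoidHom.coe_mk, OneHom.coe_mk]
    rw [inner_tensorOp_eq_sum]
    simp_rw [inner_tensorOp_eq_sum (piKron _)]
    refine HasDerivAt.fun_sum fun I _ => HasDerivAt.fun_sum fun J _ => ?_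
    refine (hasDerivAt_piKron (A := fun s => (ρ (x k s)).1) (H.deriv k) ?_ I J).mul_const _
    rw [H.zero, map_one]
    rfl
  skew k v w := by
    rw [inner_tensorOp_star, star_tensorDer, H.skew, tensorDer_neg, map_neg, LinearMap.neg_apply,
      inner_neg_right]
  commutes g v := by
    have hg : (ρ g).1 * star (ρ g).1 = 1 := Matrix.mem_unitaryGroup_iff.1 (ρ g).2
    have hg' : star (ρ g).1 * (ρ g).1 = 1 := Matrix.mem_unitaryGroup_iff'.1 (ρ g).2
    have h1 : ∀ i, tensorDer n ((ρ g).1 * X i * star (ρ g).1)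
        = piKron (fun _ : Fin n => (ρ g).1) * tensorDer n (X i)
          * piKron (fun _ => star (ρ g).1) := fun i => (conj_tensorDer hg _).symm
    -- Conjugation by ρ(g) replaces the X_i by matrices with the same Casimir tensor; hence the
    -- Casimir on the tensor power commutes with g.
    have h2 := sum_tensorDer_mul_congr (n := n) (H.invariant g)
    have hT : piKron (fun _ : Fin n => star (ρ g).1) * piKron (fun _ => (ρ g).1) = 1 := by
      rw [piKron_mul]
      simp only [hg']
      exact piKron_one
    have h3 : (∑ i, tensorDer n (X i) * tensorDer n (X i)) * piKron (fun _ => (ρ g).1)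
        = piKron (fun _ => (ρ g).1) * ∑ i, tensorDer n (X i) * tensorDer n (X i) := by
      conv_lhs => rw [← h2]
      rw [Finset.sum_mul, Finset.mul_sum]
      refine Finset.sum_congr rfl fun i _ => ?_
      rw [h1]
      simp only [mul_assoc]
      rw [hT, mul_one, ← mul_assoc (piKron fun _ => star (ρ g).1), hT, one_mul]
    have h4 := congrArg (tensorOp n m) h3
    simp only [map_mul, map_sum] at h4
    exact LinearMap.congr_fun h4 v

theorem FaithfulFrame.tensorRep_coeff (H : FaithfulFrame x ρ X) (I J : Fin n → Fin m) (g : G) :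
    inner ℂ (EuclideanSpace.basisFun (Fin n → Fin m) ℂ I)
      ((H.tensorRep n).A g (EuclideanSpace.basisFun (Fin n → Fin m) ℂ J))
      = ∏ k, (ρ g : Matrix (Fin m) (Fin m) ℂ) (I k) (J k) :=
  inner_tensorOp_basis _ I J

/-- The matrix entries of the defining representation as continuous functions. -/
def FaithfulFrame.entry (H : FaithfulFrame x ρ X) (i j : Fin m) : C(G, ℂ) :=
  ⟨fun g => (ρ g : Matrix (Fin m) (Fin m) ℂ) i j, H.continuous_entry i j⟩

/-- The polynomial functions on the group. -/
noncomputable def FaithfulFrame.polynomials (H : FaithfulFrame x ρ X) : StarSubalgebra ℂ C(G, ℂ) where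
  toSubalgebra := Algebra.adjoin ℂ (Set.range fun p : Fin m × Fin m => H.entry p.1 p.2)
  star_mem' {f} hf := by
    -- By `star_entry`, the conjugate of an entry is a multiple of an entry, so the algebra is
    -- closed under conjugation and dual representations are not needed.
    have key : (Algebra.adjoin ℂ (Set.range fun p : Fin m × Fin m => H.entry p.1 p.2)) ≤
        star (Algebra.adjoin ℂ (Set.range fun p : Fin m × Fin m => H.entry p.1 p.2)) := by
      refine Algebra.adjoin_le ?_
      rintro _ ⟨⟨i, j⟩, rfl⟩
      obtain ⟨i', j', ε, h⟩ := H.star_entry i j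
      have : star (H.entry i j) = ε • H.entry i' j' := by
        ext g
        exact h g
      rw [SetLike.mem_coe, Subalgebra.mem_star_iff, this]
      exact Subalgebra.smul_mem _ (Algebra.subset_adjoin (Set.mem_range_self (i', j'))) ε
    exact (Subalgebra.mem_star_iff _ _).1 (key hf)

/-- The algebra is spanned by monomials in the entries, and a monomial of degree n is a matrix
coefficient of the n-th tensor power. -/
theorem FaithfulFrame.polynomials_subset (H : FaithfulFrame x ρ X) {S : Submodule ℂ C(G, ℂ)}
    (hS : ContainsCoeffs x S) {f : C(G, ℂ)} (hf : f ∈ H.polynomials) : f ∈ S := by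
  have hf' : f ∈ Subalgebra.toSubmodule
    (Algebra.adjoin ℂ (Set.range fun p : Fin m × Fin m => H.entry p.1 p.2)) := hf
  rw [Algebra.adjoin_eq_span] at hf'
  refine Submodule.span_le.2 ?_ hf'
  intro p hp
  obtain ⟨l, hl, rfl⟩ := Submonoid.exists_list_of_mem_closure hp
  have : ∃ n, ∃ I J : Fin n → Fin m, l.prod = ∏ k, H.entry (I k) (J k) := by
    clear hp
    induction l with
    | nil => exact ⟨0, Fin.elim0, Fin.elim0, by simp⟩
    | cons a l ih =>
      obtain ⟨n, I, J, h⟩ := ih fun y hy => hl y (List.mem_cons_of_mem _ hy)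
      obtain ⟨⟨i, j⟩, rfl⟩ := hl a List.mem_cons_self
      refine ⟨n + 1, Fin.cons i I, Fin.cons j J, ?_⟩
      rw [List.prod_cons, h, Fin.prod_univ_succ]
      simp
  obtain ⟨n, I, J, h⟩ := this
  rw [h]
  refine (H.tensorRep n).coeff_mem hS (EuclideanSpace.basisFun (Fin n → Fin m) ℂ I)
    (EuclideanSpace.basisFun (Fin n → Fin m) ℂ J) _ fun g => ?_
  rw [H.tensorRep_coeff I J, ContinuousMap.prod_apply]
  rfl

/-- A closed subspace of `C(G, ℂ)` containing the coefficients of the irreducible representations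
is everything. -/
theorem FaithfulFrame.eq_top [CompactSpace G] (H : FaithfulFrame x ρ X)
    {S : Submodule ℂ C(G, ℂ)} (hS : ContainsCoeffs x S) (hcl : IsClosed (S : Set C(G, ℂ))) :
    S = ⊤ := by
  have hsep : H.polynomials.SeparatesPoints := by
    intro g h hgh
    obtain ⟨i, j, hij⟩ : ∃ i j, (ρ g : Matrix (Fin m) (Fin m) ℂ) i j
        ≠ (ρ h : Matrix (Fin m) (Fin m) ℂ) i j := by
      by_contra! hcon
      exact hgh (H.injective (Subtype.ext (Matrix.ext hcon)))
    exact ⟨_, ⟨H.entry i j, Algebra.subset_adjoin ⟨(i, j), rfl⟩, rfl⟩, hij⟩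
  have hdense := ContinuousMap.starSubalgebra_topologicalClosure_eq_top_of_separatesPoints _ hsep
  rw [eq_top_iff]
  intro f _
  have hf : f ∈ H.polynomials.topologicalClosure := hdense ▸ StarSubalgebra.mem_top
  have hf' : f ∈ closure (H.polynomials : Set C(G, ℂ)) := hf
  exact closure_minimal (fun p hp => H.polynomials_subset hS hp) hcl hf'

end Tensor
end CompactLie

namespace CompactLie

/-! ### Uniqueness of measures with given Fourier transform -/

section Uniqueness

theorem UnitaryIrrep.continuous_entry {G : Type} [Group G] [TopologicalSpace G] {d : ℕ} (π : UnitaryIrrep G d)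
    (i j : Fin d) :
    Continuous fun g => (π.toHom g : Matrix (Fin d) (Fin d) ℂ) i j :=
  (continuous_subtype_val.comp π.continuous_toHom).matrix_elem i j

variable {G : Type} [TopologicalSpace G] [CompactSpace G] [MeasurableSpace G]

theorem integrable_continuousMap [BorelSpace G] [SecondCountableTopology G] (μ : Measure G)
    [IsFiniteMeasure μ] (f : C(G, ℂ)) : Integrable f μ :=
  f.continuous.integrable_of_hasCompactSupport (HasCompactSupport.of_compactSpace f)

theorem norm_integral_continuousMap_le (μ : Measure G) [IsFiniteMeasure μ] (f : C(G, ℂ)) :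
    ‖∫ g, f g ∂μ‖ ≤ ‖f‖ * μ.real Set.univ :=
  norm_integral_le_of_norm_le_const (ae_of_all _ fun g => f.norm_coe_le_norm g)

/-- Integration of continuous functions against a finite measure. -/
noncomputable def integralCLM [BorelSpace G] [SecondCountableTopology G] (μ : Measure G)
    [IsFiniteMeasure μ] : C(G, ℂ) →L[ℂ] ℂ :=
  LinearMap.mkContinuous
    { toFun := fun f => ∫ g, f g ∂μ
      map_add' := fun f f' =>
        integral_add (integrable_continuousMap μ f) (integrable_continuousMap μ f')
      map_smul' := fun c f => integral_const_mul c _ }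
    (μ.real Set.univ) fun f => by
      rw [mul_comm]
      exact norm_integral_continuousMap_le μ f

variable [Group G] [BorelSpace G] {x : Fin 3 → ℝ → G} {m : ℕ}
  {ρ : G →* Matrix.unitaryGroup (Fin m) ℂ} {X : Fin 3 → Matrix (Fin m) (Fin m) ℂ}

/-- The continuous functions with equal integrals form a closed subspace containing the relevant
coefficients, hence all of C(G, ℂ). -/
theorem FaithfulFrame.measure_ext [T2Space G] [SecondCountableTopology G]
    (H : FaithfulFrame x ρ X) {μ ν : Measure G} [IsFiniteMeasure μ] [IsFiniteMeasure ν]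
    (h : ∀ (d : ℕ) (π : UnitaryIrrep G d) (κ : ℝ),
      π.casimir x = (-κ : ℂ) • (1 : Matrix (Fin d) (Fin d) ℂ) → π.fourier μ = π.fourier ν) :
    μ = ν := by
  have htop := H.eq_top (S := LinearMap.eqLocus (integralCLM μ).toLinearMap
    (integralCLM ν).toLinearMap) (fun d π κ hκ i j f hf => by
      have := congrFun (congrFun (h d π κ hκ) i) j
      simp only [UnitaryIrrep.fourier, Matrix.of_apply, ← hf] at this
      exact this) (isClosed_eq (integralCLM μ).continuous (integralCLM ν).continuous)
  refine ext_of_forall_integral_eq_of_IsFiniteMeasure fun f => ?_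
  have hf : (⟨fun g => (f g : ℂ), Complex.continuous_ofReal.comp f.continuous⟩ : C(G, ℂ)) ∈
    LinearMap.eqLocus (integralCLM μ).toLinearMap (integralCLM ν).toLinearMap := by
    rw [htop]; trivial
  have hf' : ∫ g, (f g : ℂ) ∂μ = ∫ g, (f g : ℂ) ∂ν := hf
  rw [integral_complex_ofReal, integral_complex_ofReal] at hf'
  exact Complex.ofReal_injective hf'

theorem UnitaryIrrep.integrable_entry [SecondCountableTopology G] {d : ℕ} (π : UnitaryIrrep G d)
    (i j : Fin d) (μ : Measure G) [IsFiniteMeasure μ] :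
    Integrable (fun g => (π.toHom g : Matrix (Fin d) (Fin d) ℂ) i j) μ :=
  integrable_continuousMap μ ⟨_, π.continuous_entry i j⟩

theorem UnitaryIrrep.fourier_mconv [IsTopologicalGroup G] [SecondCountableTopology G] {d : ℕ}
    (π : UnitaryIrrep G d) (μ ν : Measure G) [IsFiniteMeasure μ] [IsFiniteMeasure ν] :
    π.fourier (μ.mconv ν) = π.fourier μ * π.fourier ν := by
  ext i j
  simp only [UnitaryIrrep.fourier, Matrix.of_apply, Matrix.mul_apply]
  rw [Measure.mconv, integral_map (by fun_prop)
    (π.continuous_entry i j).aestronglyMeasurable]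
  simp only [map_mul, Submonoid.coe_mul, Matrix.mul_apply]
  rw [integral_finsetSum _ fun k _ =>
    (π.integrable_entry i k μ).mul_prod (π.integrable_entry k j ν)]
  exact Finset.sum_congr rfl fun k _ => integral_prod_mul
    (fun g => (π.toHom g : Matrix (Fin d) (Fin d) ℂ) i k) fun g =>
      (π.toHom g : Matrix (Fin d) (Fin d) ℂ) k j

/-- The semigroup and continuity properties follow from the Fourier transform. -/
theorem FaithfulFrame.isInducedSemigroup [T2Space G] [IsTopologicalGroup G]
    [SecondCountableTopology G]
    (H : FaithfulFrame x ρ X) {η : ℝ → ℝ} {μ : ℝ → Measure G}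
    (prob : ∀ t, 0 ≤ t → IsProbabilityMeasure (μ t)) (zero : μ 0 = Measure.dirac 1)
    (fourier : ∀ t, 0 ≤ t → ∀ (d : ℕ) (π : UnitaryIrrep G d) (κ : ℝ),
      π.casimir x = (-κ : ℂ) • (1 : Matrix (Fin d) (Fin d) ℂ) →
        π.fourier (μ t) = (Real.exp (-t * η (√κ)) : ℂ) • (1 : Matrix (Fin d) (Fin d) ℂ)) :
    IsInducedSemigroup x η μ where
  prob := prob
  zero := zero
  fourier := fourier
  conv s t hs ht := by
    have := prob s hs
    have := prob t ht
    have := prob (s + t) (by positivity)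
    refine H.measure_ext fun d π κ hκ => ?_
    rw [π.fourier_mconv, fourier _ (by positivity) d π κ hκ, fourier s hs d π κ hκ,
      fourier t ht d π κ hκ, Matrix.smul_mul, Matrix.one_mul, smul_smul]
    congr 1
    rw [← Complex.ofReal_mul, ← Real.exp_add]
    congr 2
    ring
  cont f := by
    -- The functions whose integrals depend continuously on t form a subspace. It is closed, because
    -- for probability measures sup-norm approximation of f approximates the integrals uniformly in
    -- t.
    let S : Submodule ℂ C(G, ℂ) :=
      { carrier := {f | ContinuousOn (fun t => ∫ g, f g ∂(μ t)) (Set.Ici 0)}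
        add_mem' := fun {f f'} hf hf' => by
          refine (hf.add hf').congr fun t ht => ?_
          have := prob t ht
          exact integral_add (integrable_continuousMap _ f) (integrable_continuousMap _ f')
        zero_mem' := by
          refine continuousOn_const (c := (0 : ℂ)) |>.congr fun t ht => ?_
          exact integral_zero _ _
        smul_mem' := fun c f hf => by
          refine (hf.const_smul c).congr fun t ht => ?_
          exact integral_const_mul c _ }
    have htop : S = ⊤ := by
      refine H.eq_top (fun d π κ hκ i j f hf => ?_) ?_
      · have hc : ContinuousOn (fun t : ℝ => ((Real.exp (-t * η (√κ)) : ℂ) •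
            (1 : Matrix (Fin d) (Fin d) ℂ)) i j) (Set.Ici 0) := by
          simp only [Matrix.smul_apply]
          fun_prop
        refine hc.congr fun t ht => ?_
        refine Eq.trans ?_ (congrFun (congrFun (fourier t ht d π κ hκ) i) j)
        simp only [UnitaryIrrep.fourier, Matrix.of_apply, hf]
      · refine isClosed_of_closure_subset fun f hf => ?_
        refine continuousOn_of_uniform_approx_of_continuousOn fun u hu => ?_
        obtain ⟨ε, hε, hεu⟩ := Metric.mem_uniformity_dist.1 hu
        obtain ⟨f', hf', hd⟩ := Metric.mem_closure_iff.1 hf ε hε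
        refine ⟨_, hf', fun t ht => hεu ?_⟩
        have := prob t ht
        rw [dist_eq_norm] at hd ⊢
        rw [← integral_sub (integrable_continuousMap _ f) (integrable_continuousMap _ f')]
        refine lt_of_le_of_lt ?_ hd
        simpa using norm_integral_continuousMap_le (μ t) (f - f')
    have hf : (⟨fun g => (f g : ℂ), Complex.continuous_ofReal.comp f.continuous⟩ : C(G, ℂ)) ∈ S := by
      rw [htop]; trivial
    have hf' : ContinuousOn (fun t => ∫ g, (f g : ℂ) ∂(μ t)) (Set.Ici 0) := hf
    simp only [integral_complex_ofReal] at hf'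
    exact Complex.continuous_re.comp_continuousOn hf'

theorem FaithfulFrame.semigroup_unique [T2Space G] [SecondCountableTopology G]
    (H : FaithfulFrame x ρ X) {η : ℝ → ℝ} {μ ν : ℝ → Measure G}
    (hμ : IsInducedSemigroup x η μ) (hν : IsInducedSemigroup x η ν) {t : ℝ} (ht : 0 ≤ t) :
    μ t = ν t := by
  have := hμ.prob t ht
  have := hν.prob t ht
  refine H.measure_ext fun d π κ hκ => ?_
  rw [hμ.fourier t ht d π κ hκ, hν.fourier t ht d π κ hκ]

variable [IsTopologicalGroup G]

theorem IsContinuousDensity.unique [SecondCountableTopology G] {μ : ℝ → Measure G}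
    {k k' : ℝ → G → ℝ} (hk : IsContinuousDensity μ k) (hk' : IsContinuousDensity μ k') {t : ℝ}
    (ht : 0 < t) : k t = k' t := by
  obtain ⟨hc, hn, he⟩ := hk t ht
  obtain ⟨hc', hn', he'⟩ := hk' t ht
  have hae := (withDensity_eq_iff_of_sigmaFinite hc.measurable.ennreal_ofReal.aemeasurable
    hc'.measurable.ennreal_ofReal.aemeasurable).1 (he.symm.trans he')
  refine (hc.ae_eq_iff_eq (Measure.haarMeasure (⊤ : TopologicalSpace.PositiveCompacts G)) hc').1 ?_
  filter_upwards [hae] with g hg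
  exact (ENNReal.ofReal_eq_ofReal_iff (hn g) (hn' g)).1 hg

/-- The semigroup and its continuous density are unique, so one explicit pair settles the claim for
all. -/
theorem FaithfulFrame.hasDensityAsymptotics [T2Space G] [SecondCountableTopology G]
    (H : FaithfulFrame x ρ X) {η a : ℝ → ℝ} {μ : ℝ → Measure G} {k : ℝ → G → ℝ}
    (hμ : IsInducedSemigroup x η μ) (hk : IsContinuousDensity μ k)
    (ha : (fun t => k t 1) ~[𝓝[>] 0] a) : HasDensityAsymptotics x η a := by
  refine ⟨⟨μ, hμ⟩, fun ν hν => ?_⟩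
  have heq : ∀ t, 0 < t → ν t = μ t := fun t ht => H.semigroup_unique hν hμ ht.le
  have hkν : IsContinuousDensity ν k := fun t ht => by
    rw [heq t ht]
    exact hk t ht
  refine ⟨⟨k, hkν⟩, fun k' hk' => ?_⟩
  refine ha.congr_left ?_
  filter_upwards [self_mem_nhdsWithin] with t ht
  rw [hkν.unique hk' ht]

instance : IsProbabilityMeasure (Measure.haarMeasure (⊤ : TopologicalSpace.PositiveCompacts G)) :=
  ⟨Measure.haarMeasure_self⟩

/-- A right translate of Haar measure is again a left Haar probability measure, and such a measure
is unique. -/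
theorem haar_isMulRightInvariant [T2Space G] [SecondCountableTopology G] :
    (Measure.haarMeasure (⊤ : TopologicalSpace.PositiveCompacts G)).IsMulRightInvariant := by
  refine ⟨fun g => ?_⟩
  have : IsProbabilityMeasure (Measure.map (· * g)
      (Measure.haarMeasure (⊤ : TopologicalSpace.PositiveCompacts G))) :=
    Measure.isProbabilityMeasure_map (by fun_prop)
  exact Measure.isHaarMeasure_eq_of_isProbabilityMeasure _ _

end Uniqueness
end CompactLie

namespace CompactLie

/-! ### The defining representations of `SU(2)` and `SO(3)` -/

section Frames

/-- The first two contractions of Kronecker deltas are preserved by every unitary conjugation. The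
third pairs two unconjugated indices, and is preserved when g is real, that is, orthogonal. -/
theorem conj_casimirTensor {m : ℕ} {X : Fin 3 → Matrix (Fin m) (Fin m) ℂ} {α β γ : ℂ}
    (hX : ∀ p q r s, ∑ k, X k p q * X k r s = α * ((1 : Matrix (Fin m) (Fin m) ℂ) p q *
      (1 : Matrix (Fin m) (Fin m) ℂ) r s) + β * ((1 : Matrix (Fin m) (Fin m) ℂ) p s *
      (1 : Matrix (Fin m) (Fin m) ℂ) r q) + γ * ((1 : Matrix (Fin m) (Fin m) ℂ) p r *
      (1 : Matrix (Fin m) (Fin m) ℂ) q s))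
    {g : Matrix (Fin m) (Fin m) ℂ} (hg : g * star g = 1)
    (hγ : γ ≠ 0 → g.map star = g) (a b c d : Fin m) :
    ∑ k, (g * X k * star g) a b * (g * X k * star g) c d = ∑ k, X k a b * X k c d := by
  have hent : ∀ a b, ∑ p, g a p * star (g b p) = (1 : Matrix (Fin m) (Fin m) ℂ) a b := by
    intro a b
    rw [← hg, Matrix.mul_apply]
    rfl
  have h2 : ∀ k a b, (g * X k * star g) a b
      = ∑ p : Fin m × Fin m, g a p.1 * star (g b p.2) * X k p.1 p.2 := by
    intro k a b
    simp only [Matrix.mul_apply, Finset.sum_mul, Matrix.star_apply, Fintype.sum_prod_type]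
    rw [Finset.sum_comm]
    exact Finset.sum_congr rfl fun p _ => Finset.sum_congr rfl fun q _ => by ring
  have h1 : ∑ k, (g * X k * star g) a b * (g * X k * star g) c d
      = ∑ p : Fin m × Fin m, ∑ q : Fin m × Fin m, g a p.1 * star (g b p.2) *
        (g c q.1 * star (g d q.2)) * ∑ k, X k p.1 p.2 * X k q.1 q.2 := by
    simp only [h2, Finset.mul_sum]
    conv_rhs => rw [Finset.sum_comm]
    rw [Finset.sum_comm]
    refine Finset.sum_congr rfl fun p _ => ?_
    simp only [Finset.sum_mul]
    rw [Finset.sum_comm]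
    refine Finset.sum_congr rfl fun q _ => Finset.sum_congr rfl fun k _ => ?_
    ring
  have hα : (1 : Matrix (Fin m) (Fin m) ℂ) a b * (1 : Matrix (Fin m) (Fin m) ℂ) c d
      = ∑ p : Fin m × Fin m, ∑ q : Fin m × Fin m, g a p.1 * star (g b p.2) *
        (g c q.1 * star (g d q.2)) * ((1 : Matrix (Fin m) (Fin m) ℂ) p.1 p.2 *
        (1 : Matrix (Fin m) (Fin m) ℂ) q.1 q.2) := by
    rw [← hent a b, ← hent c d]
    simp only [Matrix.one_apply, Fintype.sum_prod_type, Finset.sum_mul_sum, mul_ite,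
      mul_one, mul_zero, Finset.sum_ite_eq, Finset.mem_univ, if_true, Finset.sum_ite_irrel,
      Finset.sum_const_zero]
  have hβ : (1 : Matrix (Fin m) (Fin m) ℂ) a d * (1 : Matrix (Fin m) (Fin m) ℂ) c b
      = ∑ p : Fin m × Fin m, ∑ q : Fin m × Fin m, g a p.1 * star (g b p.2) *
        (g c q.1 * star (g d q.2)) * ((1 : Matrix (Fin m) (Fin m) ℂ) p.1 q.2 *
        (1 : Matrix (Fin m) (Fin m) ℂ) q.1 p.2) := by
    rw [← hent a d, ← hent c b]
    simp only [Matrix.one_apply, Fintype.sum_prod_type, Finset.sum_mul_sum, mul_ite,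
      mul_one, mul_zero, Finset.sum_ite_eq, Finset.sum_ite_eq', Finset.mem_univ, if_true,
      Finset.sum_ite_irrel, Finset.sum_const_zero]
    exact Finset.sum_congr rfl fun p _ => Finset.sum_congr rfl fun q _ => by ring
  have hγ' : γ * ((1 : Matrix (Fin m) (Fin m) ℂ) a c * (1 : Matrix (Fin m) (Fin m) ℂ) b d)
      = γ * ∑ p : Fin m × Fin m, ∑ q : Fin m × Fin m, g a p.1 * star (g b p.2) *
        (g c q.1 * star (g d q.2)) * ((1 : Matrix (Fin m) (Fin m) ℂ) p.1 q.1 *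
        (1 : Matrix (Fin m) (Fin m) ℂ) p.2 q.2) := by
    by_cases h0 : γ = 0
    · rw [h0, zero_mul, zero_mul]
    have hr : ∀ i j, star (g i j) = g i j := fun i j => congrFun (congrFun (hγ h0) i) j
    congr 1
    rw [← hent a c, ← hent b d]
    simp only [hr, Matrix.one_apply, Fintype.sum_prod_type, Finset.sum_mul_sum, mul_ite,
      mul_one, mul_zero, Finset.sum_ite_eq, Finset.mem_univ, if_true]
    exact Finset.sum_congr rfl fun p _ => Finset.sum_congr rfl fun q _ => by ring
  rw [h1, hX, hα, hβ, hγ']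
  simp only [hX, Finset.mul_sum, ← Finset.sum_add_distrib]
  exact Finset.sum_congr rfl fun p _ => Finset.sum_congr rfl fun q _ => by ring

/-- Both are the inverse of g. Comparing entries yields the unit quaternion form, in which the first
row determines g. -/
theorem star_eq_adjugate (g : SU2) : star g.1 = g.1.adjugate := by
  obtain ⟨h1, h2⟩ := Matrix.mem_specialUnitaryGroup_iff.1 g.2
  have h3 : g.1 * g.1.adjugate = 1 := by rw [Matrix.mul_adjugate, h2, one_smul]
  have h4 : star g.1 * g.1 = 1 := Matrix.mem_unitaryGroup_iff'.1 h1
  calc _ = star g.1 * (g.1 * g.1.adjugate) := by rw [h3, mul_one]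
    _ = _ := by rw [← mul_assoc, h4, one_mul]

theorem su2_apply_one_one (g : SU2) : g.1 1 1 = star (g.1 0 0) := by
  have := congrFun (congrFun (star_eq_adjugate g) 0) 0
  rw [Matrix.star_apply, Matrix.adjugate_fin_two] at this
  simpa using this.symm

theorem su2_apply_one_zero (g : SU2) : g.1 1 0 = -star (g.1 0 1) := by
  have := congrFun (congrFun (star_eq_adjugate g) 1) 0
  rw [Matrix.star_apply, Matrix.adjugate_fin_two] at this
  simp only [Matrix.of_apply, Matrix.cons_val', Matrix.cons_val_zero, Matrix.cons_val_one,
    Matrix.cons_val_fin_one] at this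
  rw [this, neg_neg]

theorem su2_normSq (g : SU2) : Complex.normSq (g.1 0 0) + Complex.normSq (g.1 0 1) = 1 := by
  have h := (Matrix.mem_specialUnitaryGroup_iff.1 g.2).2
  rw [Matrix.det_fin_two, su2_apply_one_one, su2_apply_one_zero] at h
  have h2 : ((Complex.normSq (g.1 0 0) + Complex.normSq (g.1 0 1) : ℝ) : ℂ) = 1 := by
    rw [← h, Complex.ofReal_add, ← Complex.mul_conj, ← Complex.mul_conj]
    simp
  exact_mod_cast h2

/-- The element of `SU(2)` with first row `(a, b)`. -/
noncomputable def mkSU2 (a b : ℂ) (h : Complex.normSq a + Complex.normSq b = 1) : SU2 :=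
  ⟨!![a, b; -star b, star a], by
    have h' : a * star a + b * star b = 1 := by
      have := congrArg (Complex.ofReal) h
      rwa [Complex.ofReal_add, ← Complex.mul_conj, ← Complex.mul_conj, Complex.ofReal_one] at this
    rw [Matrix.mem_specialUnitaryGroup_iff, Matrix.mem_unitaryGroup_iff]
    constructor
    · ext i j
      fin_cases i <;> fin_cases j <;>
        simp [Matrix.mul_apply, Fin.sum_univ_two, Matrix.star_apply] at h' ⊢ <;>
        first | ring1 | linear_combination h'
    · rw [Matrix.det_fin_two]
      simp at h' ⊢
      linear_combination h'⟩

theorem su2_ext {g h : SU2} (h0 : g.1 0 0 = h.1 0 0) (h1 : g.1 0 1 = h.1 0 1) : g = h := by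
  refine Subtype.ext (Matrix.ext fun i j => ?_)
  fin_cases i <;> fin_cases j
  · exact h0
  · exact h1
  · change g.1 1 0 = h.1 1 0
    rw [su2_apply_one_zero, su2_apply_one_zero, h1]
  · change g.1 1 1 = h.1 1 1
    rw [su2_apply_one_one, su2_apply_one_one, h0]

/-- The inclusion of `SU(2)` in the unitary group. -/
def inclSU2 : SU2 →* Matrix.unitaryGroup (Fin 2) ℂ :=
  Submonoid.inclusion Matrix.specialUnitaryGroup_le_unitaryGroup

/-- The basis `i σ_x, i σ_y, i σ_z` of `su(2)`. -/
noncomputable def basisSU2 : Fin 3 → Matrix (Fin 2) (Fin 2) ℂ :=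
  ![!![0, Complex.I; Complex.I, 0], !![0, 1; -1, 0], !![Complex.I, 0; 0, -Complex.I]]

theorem faithfulFrameSU2 : FaithfulFrame frameSU2 inclSU2 basisSU2 where
  continuous := Continuous.subtype_mk continuous_subtype_val _
  injective := Submonoid.inclusion_injective _
  zero k := by
    refine su2_ext ?_ ?_ <;> fin_cases k <;> simp [frameSU2]
  deriv k i j := by
    have hc : HasDerivAt (fun s : ℝ => (Real.cos s : ℂ)) 0 0 := by
      simpa using (Real.hasDerivAt_cos 0).ofReal_comp
    have hs : HasDerivAt (fun s : ℝ => (Real.sin s : ℂ)) 1 0 := by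
      simpa using (Real.hasDerivAt_sin 0).ofReal_comp
    have hI : HasDerivAt (fun s : ℝ => Complex.I * (s : ℂ)) Complex.I 0 := by
      simpa using (Complex.ofRealCLM.hasDerivAt (x := 0)).const_mul Complex.I
    have he : HasDerivAt (fun s : ℝ => Complex.exp (Complex.I * s)) Complex.I 0 := by
      simpa using hI.cexp
    have he' : HasDerivAt (fun s : ℝ => Complex.exp (-(Complex.I * s))) (-Complex.I) 0 := by
      simpa using hI.neg.cexp
    have h0 : HasDerivAt (fun _ : ℝ => (0 : ℂ)) 0 0 := hasDerivAt_const _ _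
    have hIs : HasDerivAt (fun s : ℝ => Complex.I * (Real.sin s : ℂ)) Complex.I 0 := by
      simpa using hs.const_mul Complex.I
    have hns : HasDerivAt (fun s : ℝ => -(Real.sin s : ℂ)) (-1) 0 := hs.neg
    fin_cases k <;> fin_cases i <;> fin_cases j
    exacts [hc, hIs, hIs, hc, hc, hs, hns, hc, he, h0, h0, he']
  skew k := by
    ext i j
    fin_cases k <;> fin_cases i <;> fin_cases j <;> simp [basisSU2, Matrix.star_apply]
  invariant g := by
    -- Fierz identity for the Pauli matrices: ∑ σ_pq σ_rs = 2 δ_ps δ_rq - δ_pq δ_rs, with a sign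
    -- from i² = -1.
    refine conj_casimirTensor (α := 1) (β := -2) (γ := 0) (fun p q r s => ?_)
      (Matrix.mem_unitaryGroup_iff.1 (inclSU2 g).2) (fun h => absurd rfl h)
    fin_cases p <;> fin_cases q <;> fin_cases r <;> fin_cases s <;>
      simp [basisSU2, Fin.sum_univ_three] <;> norm_num
  star_entry i j := by
    fin_cases i <;> fin_cases j
    · exact ⟨1, 1, 1, fun g => by rw [one_mul]; exact (su2_apply_one_one g).symm⟩
    · refine ⟨1, 0, -1, fun g => ?_⟩
      have := su2_apply_one_zero g
      change star (g.1 0 1) = -1 * g.1 1 0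
      rw [this]; ring
    · refine ⟨0, 1, -1, fun g => ?_⟩
      have := su2_apply_one_zero g
      change star (g.1 1 0) = -1 * g.1 0 1
      rw [this]; simp
    · refine ⟨0, 0, 1, fun g => ?_⟩
      have := su2_apply_one_one g
      change star (g.1 1 1) = 1 * g.1 0 0
      rw [this]; simp

/-- The complexification of the defining representation of `SO(3)`. -/
noncomputable def inclSO3 : SO3 →* Matrix.unitaryGroup (Fin 3) ℂ where
  toFun g := ⟨g.1.map Complex.ofReal, by
    have h := Matrix.mem_unitaryGroup_iff.1 (Matrix.mem_specialUnitaryGroup_iff.1 g.2).1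
    rw [Matrix.mem_unitaryGroup_iff]
    have h2 := congrArg (Complex.ofRealHom.mapMatrix (m := Fin 3)) h
    rw [map_mul, map_one] at h2
    rw [← h2]
    congr 1
    ext i j
    simp [Matrix.star_apply]⟩
  map_one' := Subtype.ext (by simp)
  map_mul' g h := Subtype.ext (by
    change ((g.1 * h.1).map Complex.ofReal) = g.1.map Complex.ofReal * h.1.map Complex.ofReal
    exact (Matrix.map_mul (f := Complex.ofRealHom)))

/-- The standard generators of `so(3)`. -/
noncomputable def basisSO3 : Fin 3 → Matrix (Fin 3) (Fin 3) ℂ :=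
  ![!![0, 0, 0; 0, 0, -1; 0, 1, 0], !![0, 0, 1; 0, 0, 0; -1, 0, 0],
    !![0, -1, 0; 1, 0, 0; 0, 0, 0]]

theorem faithfulFrameSO3 : FaithfulFrame frameSO3 inclSO3 basisSO3 where
  continuous := by
    refine Continuous.subtype_mk ?_ _
    exact continuous_subtype_val.matrix_map Complex.continuous_ofReal
  injective g h hgh := by
    refine Subtype.ext (Matrix.ext fun i j => ?_)
    have := congrFun (congrFun (congrArg Subtype.val hgh) i) j
    exact Complex.ofReal_injective this
  zero k := by
    refine Subtype.ext (Matrix.ext fun i j => ?_)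
    fin_cases k <;> fin_cases i <;> fin_cases j <;> simp [frameSO3]
  deriv k i j := by
    have hc : HasDerivAt (fun s : ℝ => (Real.cos s : ℂ)) 0 0 := by
      simpa using (Real.hasDerivAt_cos 0).ofReal_comp
    have hs : HasDerivAt (fun s : ℝ => (Real.sin s : ℂ)) 1 0 := by
      simpa using (Real.hasDerivAt_sin 0).ofReal_comp
    have hns : HasDerivAt (fun s : ℝ => ((-Real.sin s : ℝ) : ℂ)) (-1) 0 := by
      simpa using (Real.hasDerivAt_sin 0).neg.ofReal_comp
    have h0 : HasDerivAt (fun _ : ℝ => ((0 : ℝ) : ℂ)) 0 0 := hasDerivAt_const _ _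
    have h1 : HasDerivAt (fun _ : ℝ => ((1 : ℝ) : ℂ)) 0 0 := hasDerivAt_const _ _
    fin_cases k <;> fin_cases i <;> fin_cases j
    exacts [h1, h0, h0, h0, hc, hns, h0, hs, hc, hc, h0, hs, h0, h1, h0, hns, h0, hc,
      hc, hns, h0, hs, hc, h0, h0, h0, h1]
  skew k := by
    ext i j
    fin_cases k <;> fin_cases i <;> fin_cases j <;> simp [basisSO3, Matrix.star_apply]
  invariant g := by
    -- Contraction of Levi-Civita symbols: ∑ ε_kpq ε_krs = δ_pr δ_qs - δ_ps δ_rq. The term with γ is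
    -- allowed because the entries are real.
    refine conj_casimirTensor (α := 0) (β := -1) (γ := 1) (fun p q r s => ?_)
      (Matrix.mem_unitaryGroup_iff.1 (inclSO3 g).2) (fun _ => ?_)
    · fin_cases p <;> fin_cases q <;> fin_cases r <;> fin_cases s <;>
        simp [basisSO3, Fin.sum_univ_three]
    · ext i j
      simp [inclSO3]
  star_entry i j := ⟨i, j, 1, fun g => by
    rw [one_mul]
    exact Complex.conj_ofReal _⟩

instance : SecondCountableTopology SU2 :=
  inferInstanceAs (SecondCountableTopology {A : Fin 2 → Fin 2 → ℂ //
    A ∈ (Matrix.specialUnitaryGroup (Fin 2) ℂ : Set (Matrix (Fin 2) (Fin 2) ℂ))})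

instance : SecondCountableTopology SO3 :=
  inferInstanceAs (SecondCountableTopology {A : Fin 3 → Fin 3 → ℝ //
    A ∈ (Matrix.specialUnitaryGroup (Fin 3) ℝ : Set (Matrix (Fin 3) (Fin 3) ℝ))})

end Frames
end CompactLie

namespace CompactLie

/-! ### Haar measure of `SU(2)` on class functions -/

section Haar

/-- Half the trace of an element of `SU(2)`. -/
noncomputable def halfTrace (g : SU2) : ℝ := (g.1 0 0).re

/-- The imaginary coordinates of an element of `SU(2)` seen as a unit quaternion. -/
noncomputable def vecPart (k : Fin 3) (g : SU2) : ℝ :=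
  ![(g.1 0 1).im, (g.1 0 1).re, (g.1 0 0).im] k

/-- Normalized Haar measure of `SU(2)`. -/
noncomputable abbrev haarSU2 : Measure SU2 :=
  Measure.haarMeasure (⊤ : TopologicalSpace.PositiveCompacts SU2)

theorem continuous_halfTrace : Continuous halfTrace :=
  Complex.continuous_re.comp (continuous_subtype_val.matrix_elem 0 0)

theorem continuous_vecPart (k : Fin 3) : Continuous (vecPart k) := by
  fin_cases k
  · exact Complex.continuous_im.comp (continuous_subtype_val.matrix_elem 0 1)
  · exact Complex.continuous_re.comp (continuous_subtype_val.matrix_elem 0 1)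
  · exact Complex.continuous_im.comp (continuous_subtype_val.matrix_elem 0 0)

theorem halfTrace_sq_add (g : SU2) : halfTrace g ^ 2 + ∑ k, vecPart k g ^ 2 = 1 := by
  have := su2_normSq g
  rw [Complex.normSq_apply, Complex.normSq_apply] at this
  simp [Fin.sum_univ_three, halfTrace, vecPart]
  linarith

theorem halfTrace_mem (g : SU2) : halfTrace g ∈ Set.Icc (-1 : ℝ) 1 := by
  have h := halfTrace_sq_add g
  have h2 : 0 ≤ ∑ k, vecPart k g ^ 2 := Finset.sum_nonneg fun k _ => sq_nonneg _
  exact abs_le.1 ((sq_le_one_iff_abs_le_one _).1 (by linarith))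

theorem abs_vecPart_le (k : Fin 3) (g : SU2) : |vecPart k g| ≤ 1 := by
  have h := halfTrace_sq_add g
  have h2 : vecPart k g ^ 2 ≤ ∑ k, vecPart k g ^ 2 :=
    Finset.single_le_sum (f := fun k => vecPart k g ^ 2) (fun k _ => sq_nonneg _)
      (Finset.mem_univ k)
  exact (sq_le_one_iff_abs_le_one _).1 (by nlinarith [sq_nonneg (halfTrace g)])

theorem halfTrace_one : halfTrace 1 = 1 := by simp [halfTrace]

theorem halfTrace_mul_frame (g : SU2) (k : Fin 3) (s : ℝ) :
    halfTrace (g * frameSU2 k s) = halfTrace g * Real.cos s - vecPart k g * Real.sin s := by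
  fin_cases k <;>
    simp [halfTrace, vecPart, frameSU2, Matrix.mul_apply, Fin.sum_univ_two, Complex.exp_re,
      Complex.exp_im, -Complex.ofReal_cos, -Complex.ofReal_sin] <;> ring

theorem vecPart_mul_frame (g : SU2) (k : Fin 3) (s : ℝ) :
    vecPart k (g * frameSU2 k s) = vecPart k g * Real.cos s + halfTrace g * Real.sin s := by
  fin_cases k <;>
    simp [halfTrace, vecPart, frameSU2, Matrix.mul_apply, Fin.sum_univ_two, Complex.exp_re,
      Complex.exp_im, -Complex.ofReal_cos, -Complex.ofReal_sin] <;> ring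

theorem integrable_real {f : SU2 → ℝ} (hf : Continuous f) (μ : Measure SU2) [IsFiniteMeasure μ] :
    Integrable f μ :=
  hf.integrable_of_hasCompactSupport (HasCompactSupport.of_compactSpace f)

/-- By right invariance the integral of w^j v_k over g · x_k(s) does not depend on s, where w is the
half trace. The pair (w, v_k) rotates, w' = -v_k and v_k' = w, and the integrand is the derivative
at s = 0. For j = 0 the coefficient j makes the truncated exponent harmless. -/
theorem integral_frame_derivative (k : Fin 3) (j : ℕ) :
    ∫ g, (-(j * halfTrace g ^ (j - 1) * vecPart k g ^ 2) + halfTrace g ^ (j + 1)) ∂haarSU2 = 0 := by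
  have : haarSU2.IsMulRightInvariant := haar_isMulRightInvariant
  have hF : ∀ s : ℝ, ∫ g, halfTrace (g * frameSU2 k s) ^ j * vecPart k (g * frameSU2 k s) ∂haarSU2
      = ∫ g, halfTrace g ^ j * vecPart k g ∂haarSU2 := fun s =>
    integral_mul_right_eq_self (fun g => halfTrace g ^ j * vecPart k g) (frameSU2 k s)
  have hw : ∀ g s, HasDerivAt (fun s => halfTrace (g * frameSU2 k s))
      (-vecPart k (g * frameSU2 k s)) s := fun g s => by
    simp only [halfTrace_mul_frame, vecPart_mul_frame]
    refine (((Real.hasDerivAt_cos s).const_mul _).sub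
      ((Real.hasDerivAt_sin s).const_mul _)).congr_deriv ?_
    ring
  have hv : ∀ g s, HasDerivAt (fun s => vecPart k (g * frameSU2 k s))
      (halfTrace (g * frameSU2 k s)) s := fun g s => by
    simp only [halfTrace_mul_frame, vecPart_mul_frame]
    refine (((Real.hasDerivAt_cos s).const_mul _).add
      ((Real.hasDerivAt_sin s).const_mul _)).congr_deriv ?_
    ring
  have hd := hasDerivAt_integral_of_dominated_loc_of_deriv_le (μ := haarSU2) (s := Set.univ)
    (F := fun s g => halfTrace (g * frameSU2 k s) ^ j * vecPart k (g * frameSU2 k s))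
    (F' := fun s g => -(j * halfTrace (g * frameSU2 k s) ^ (j - 1) *
      vecPart k (g * frameSU2 k s) ^ 2) + halfTrace (g * frameSU2 k s) ^ (j + 1))
    (x₀ := 0) (bound := fun _ => (j : ℝ) + 1) Filter.univ_mem
    (Eventually.of_forall fun s => (((continuous_halfTrace.comp (continuous_mul_const _)).pow j).mul
      ((continuous_vecPart k).comp (continuous_mul_const _))).aestronglyMeasurable)
    (integrable_real (((continuous_halfTrace.comp (continuous_mul_const _)).pow j).mul
      ((continuous_vecPart k).comp (continuous_mul_const _))) _)
    ((((continuous_const.mul ((continuous_halfTrace.comp (continuous_mul_const _)).pow _)).mul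
      (((continuous_vecPart k).comp (continuous_mul_const _)).pow 2)).neg.add
      ((continuous_halfTrace.comp (continuous_mul_const _)).pow _)).aestronglyMeasurable)
    (ae_of_all _ fun g s _ => by
      have h1 := abs_le.2 (halfTrace_mem (g * frameSU2 k s))
      have h2 := abs_vecPart_le k (g * frameSU2 k s)
      rw [Real.norm_eq_abs]
      refine (abs_add_le _ _).trans ?_
      rw [abs_neg, abs_mul, abs_mul, abs_pow, abs_pow, abs_pow, Nat.abs_cast]
      gcongr
      · calc _ ≤ (j : ℝ) * 1 * 1 := by
              gcongr
              · exact pow_le_one₀ (abs_nonneg _) h1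
              · exact pow_le_one₀ (abs_nonneg _) h2
          _ = j := by ring
      · exact pow_le_one₀ (abs_nonneg _) h1)
    (integrable_const _)
    (ae_of_all _ fun g s _ => by
      refine (((hw g s).fun_pow j).mul (hv g s)).congr_deriv ?_
      ring)
  have hconst := hd.2
  simp only [hF] at hconst
  have h0 := hconst.unique (hasDerivAt_const _ _)
  have hz := (faithfulFrameSU2).zero k
  simpa only [hz, mul_one] using h0

/-- Summing over the three directions and using ∑ v_k² = 1 - w² eliminates the v_k. The exponent j -
1 + 2 keeps the factorisation valid for j = 0 too, where the right side is 0. -/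
theorem moment_recursion (j : ℕ) :
    3 * ∫ g, halfTrace g ^ (j + 1) ∂haarSU2
      = j * (∫ g, halfTrace g ^ (j - 1) ∂haarSU2 - ∫ g, halfTrace g ^ (j - 1 + 2) ∂haarSU2) := by
  have hint : ∀ i : ℕ, Integrable (fun g => halfTrace g ^ i) haarSU2 := fun i =>
    integrable_real (continuous_halfTrace.pow i) _
  have hint' : ∀ k, Integrable (fun g => j * halfTrace g ^ (j - 1) * vecPart k g ^ 2) haarSU2 :=
    fun k => integrable_real ((continuous_const.mul (continuous_halfTrace.pow _)).mul
      ((continuous_vecPart k).pow 2)) _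
  have h1 : ∀ k, ∫ g, halfTrace g ^ (j + 1) ∂haarSU2
      = ∫ g, j * halfTrace g ^ (j - 1) * vecPart k g ^ 2 ∂haarSU2 := fun k => by
    have := integral_frame_derivative k j
    have hn : Integrable (fun g => -(j * halfTrace g ^ (j - 1) * vecPart k g ^ 2)) haarSU2 :=
      (hint' k).neg
    rw [integral_add hn (hint _), integral_neg] at this
    linarith
  calc _ = ∑ k : Fin 3, ∫ g, halfTrace g ^ (j + 1) ∂haarSU2 := by
        rw [Fin.sum_univ_three]; ring
    _ = ∑ k : Fin 3, ∫ g, j * halfTrace g ^ (j - 1) * vecPart k g ^ 2 ∂haarSU2 :=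
        Finset.sum_congr rfl fun k _ => h1 k
    _ = ∫ g, j * (halfTrace g ^ (j - 1) - halfTrace g ^ (j - 1 + 2)) ∂haarSU2 := by
        rw [← integral_finsetSum _ fun k _ => hint' k]
        refine integral_congr_ae (ae_of_all _ fun g => ?_)
        have := halfTrace_sq_add g
        simp only
        rw [← Finset.mul_sum, pow_add]
        linear_combination (j * halfTrace g ^ (j - 1)) * this
    _ = _ := by rw [integral_const_mul, integral_sub (hint _) (hint _)]

theorem integral_cos_pow_mul_sin_sq (j : ℕ) :
    ∫ θ in 0..Real.pi, Real.cos θ ^ j * Real.sin θ ^ 2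
      = (∫ θ in 0..Real.pi, Real.cos θ ^ j) / (j + 2) := by
  have h : ∀ θ, Real.cos θ ^ j * Real.sin θ ^ 2 = Real.cos θ ^ j - Real.cos θ ^ (j + 2) :=
    fun θ => by rw [Real.sin_sq]; ring
  simp only [h]
  have hc : ∀ i : ℕ, IntervalIntegrable (fun θ => Real.cos θ ^ i) volume 0 Real.pi := fun i =>
    (Real.continuous_cos.pow i).intervalIntegrable _ _
  rw [intervalIntegral.integral_sub (hc _) (hc _), integral_cos_pow]
  simp only [Real.sin_pi, Real.sin_zero, mul_zero, sub_zero, zero_div, zero_add]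
  have : (j : ℝ) + 2 ≠ 0 := by positivity
  field_simp
  ring

/-- The distribution of half the trace is the semicircle law. -/
theorem integral_halfTrace_pow (j : ℕ) : ∫ g, halfTrace g ^ j ∂haarSU2
    = 2 / Real.pi * ∫ θ in 0..Real.pi, Real.cos θ ^ j * Real.sin θ ^ 2 := by
  induction j using Nat.twoStepInduction with
  | zero =>
    rw [integral_cos_pow_mul_sin_sq]
    simp
  | one =>
    have := moment_recursion 0
    rw [integral_cos_pow_mul_sin_sq]
    simp at this ⊢
    exact this
  | more j ih _ =>
    have h := moment_recursion (j + 1)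
    simp only [Nat.add_sub_cancel] at h
    rw [ih] at h
    rw [integral_cos_pow_mul_sin_sq] at h ⊢
    rw [integral_cos_pow]
    simp only [Real.sin_pi, Real.sin_zero, mul_zero, sub_zero, zero_div, zero_add]
    have h4 : (j : ℝ) + 4 ≠ 0 := by positivity
    have h2 : (j : ℝ) + 2 ≠ 0 := by positivity
    push_cast at h ⊢
    rw [show (j : ℝ) + 2 + 2 = j + 4 by ring]
    refine mul_left_cancel₀ h4 ?_
    have e : ((j : ℝ) + 4) * ∫ g, halfTrace g ^ (j + 2) ∂haarSU2 = (j + 1) *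
        (2 / Real.pi * ((∫ θ in 0..Real.pi, Real.cos θ ^ j) / (j + 2))) := by
      rw [show j + 1 + 1 = j + 2 from rfl] at h
      linarith
    rw [e]
    field_simp

theorem integral_polynomial_halfTrace (P : Polynomial ℝ) : ∫ g, P.eval (halfTrace g) ∂haarSU2
    = 2 / Real.pi * ∫ θ in 0..Real.pi, P.eval (Real.cos θ) * Real.sin θ ^ 2 := by
  induction P using Polynomial.induction_on' with
  | add p q hp hq =>
    simp only [Polynomial.eval_add, add_mul]
    have h1 : ∀ r : Polynomial ℝ, Integrable (fun g => r.eval (halfTrace g)) haarSU2 := fun r =>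
      integrable_real (r.continuous.comp continuous_halfTrace) _
    have h2 : ∀ r : Polynomial ℝ, IntervalIntegrable
        (fun θ => r.eval (Real.cos θ) * Real.sin θ ^ 2) volume 0 Real.pi := fun r =>
      ((r.continuous.comp Real.continuous_cos).mul
        (Real.continuous_sin.pow 2)).intervalIntegrable _ _
    rw [integral_add (h1 p) (h1 q), hp, hq, intervalIntegral.integral_add (h2 p) (h2 q), mul_add]
  | monomial n a =>
    simp only [Polynomial.eval_monomial, mul_assoc]
    rw [integral_const_mul, integral_halfTrace_pow, intervalIntegral.integral_const_mul]
    ring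

theorem integral_cos_int_mul (k : ℤ) :
    ∫ θ in 0..Real.pi, Real.cos (k * θ) = if k = 0 then Real.pi else 0 := by
  split_ifs with h
  · simp [h]
  · have hk : (k : ℝ) ≠ 0 := by exact_mod_cast h
    rw [intervalIntegral.integral_comp_mul_left _ hk, integral_cos]
    simp [Real.sin_int_mul_pi]

/-- The weight sin² θ of the semicircle law turns U_n U_m into sin((n+1)θ) sin((m+1)θ), so
orthonormality is that of sines on [0, π]. -/
theorem integral_chebU_mul_chebU (n m : ℕ) :
    ∫ g, chebU n (halfTrace g) * chebU m (halfTrace g) ∂haarSU2 = if n = m then 1 else 0 := by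
  have h := integral_polynomial_halfTrace
    (Polynomial.Chebyshev.U ℝ n * Polynomial.Chebyshev.U ℝ m)
  simp only [Polynomial.eval_mul] at h
  change ∫ g, chebU n (halfTrace g) * chebU m (halfTrace g) ∂haarSU2 = _ at h
  rw [h]
  have h2 : ∀ θ, (Polynomial.Chebyshev.U ℝ n).eval (Real.cos θ) *
      (Polynomial.Chebyshev.U ℝ m).eval (Real.cos θ) * Real.sin θ ^ 2
      = (Real.cos (((n - m : ℤ) : ℝ) * θ) - Real.cos (((n + m + 2 : ℤ) : ℝ) * θ)) / 2 := by
    intro θ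
    have e1 := chebU_cos_mul_sin n θ
    have e2 := chebU_cos_mul_sin m θ
    rw [show ((n - m : ℤ) : ℝ) * θ = (n + 1) * θ - (m + 1) * θ by push_cast; ring,
      show ((n + m + 2 : ℤ) : ℝ) * θ = (n + 1) * θ + (m + 1) * θ by push_cast; ring,
      Real.cos_sub, Real.cos_add, ← e1, ← e2]
    simp only [chebU]
    ring
  simp only [h2]
  have hc : ∀ k : ℤ, Continuous fun θ : ℝ => Real.cos (k * θ) := fun k => by fun_prop
  rw [intervalIntegral.integral_div, intervalIntegral.integral_sub
    ((hc _).intervalIntegrable _ _) ((hc _).intervalIntegrable _ _), integral_cos_int_mul,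
    integral_cos_int_mul, if_neg (show ¬ ((n : ℤ) + m + 2 = 0) by lia)]
  have hpi := Real.pi_ne_zero
  by_cases hnm : n = m
  · simp only [hnm, sub_self, if_true]
    field_simp
    ring
  · rw [if_neg hnm, if_neg (by lia)]
    simp

end Haar
end CompactLie

namespace CompactLie

/-! ### Characters of irreducible representations of `SU(2)` -/

section OneParameter

/-- Continuous one-parameter groups in a Banach algebra are differentiable. -/
theorem exists_hasDerivAt_of_add {𝔸 : Type*} [NormedRing 𝔸] [NormedAlgebra ℝ 𝔸] [CompleteSpace 𝔸]
    {f : ℝ → 𝔸} (hf : Continuous f) (h0 : f 0 = 1) (hadd : ∀ s t, f (s + t) = f s * f t) :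
    ∃ A, ∀ s, HasDerivAt f (f s * A) s := by
  have hF : ∀ δ, HasDerivAt (fun δ => ∫ s in 0..δ, f s) (f δ) δ := fun δ =>
    intervalIntegral.integral_hasDerivAt_right (hf.intervalIntegrable _ _)
      (hf.stronglyMeasurableAtFilter _ _) hf.continuousAt
  -- The mean of f over [0, δ] tends to f(0) = 1 and units are open, so the integral J is invertible
  -- for some δ. Then f(t) J is the integral of f over [t, t + δ], which is differentiable in t.
  obtain ⟨δ, hδ0, hδ⟩ : ∃ δ : ℝ, δ ≠ 0 ∧ IsUnit (∫ s in 0..δ, f s) := by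
    have hs := (hF 0).tendsto_slope_zero
    rw [h0] at hs
    have hu : ∀ᶠ y in 𝓝 (1 : 𝔸), IsUnit y := Units.isOpen.mem_nhds isUnit_one
    obtain ⟨δ, h1, h2⟩ := ((hs.eventually hu).and self_mem_nhdsWithin).exists
    refine ⟨δ, h2, ?_⟩
    simp only [zero_add, intervalIntegral.integral_same, sub_zero] at h1
    have h3 : IsUnit (δ • (1 : 𝔸)) := by
      rw [← Algebra.algebraMap_eq_smul_one]
      exact (IsUnit.mk0 δ h2).map (algebraMap ℝ 𝔸)
    have h4 := h3.mul h1
    rwa [smul_mul_assoc, one_mul, smul_smul, mul_inv_cancel₀ h2, one_smul] at h4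
  obtain ⟨J, hJ⟩ := hδ
  have hfJ : ∀ t, f t * J = (∫ s in 0..(t + δ), f s) - ∫ s in 0..t, f s := fun t => by
    have h1 := (ContinuousLinearMap.mul ℝ 𝔸 (f t)).intervalIntegral_comp_comm
      (μ := volume) (hf.intervalIntegrable 0 δ)
    simp only [ContinuousLinearMap.mul_apply', ← hadd] at h1
    rw [hJ, intervalIntegral.integral_interval_sub_left (hf.intervalIntegrable _ _)
      (hf.intervalIntegrable _ _), ← h1,
      intervalIntegral.integral_comp_add_left (fun s => f s) t, add_zero]
  have hft : ∀ t, f t = ((∫ s in 0..(t + δ), f s) - ∫ s in 0..t, f s) * ↑J⁻¹ := fun t => by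
    rw [← hfJ, Units.mul_inv_cancel_right]
  refine ⟨(f δ - 1) * ↑J⁻¹, fun s => ?_⟩
  have h1 : HasDerivAt (fun t => ((∫ u in 0..(t + δ), f u) - ∫ u in 0..t, f u) * (↑J⁻¹ : 𝔸))
      ((f (s + δ) - f s) * ↑J⁻¹) s :=
    ((((hF (s + δ)).comp_add_const s δ)).sub (hF s)).mul_const _
  rw [hadd, ← mul_sub_one, mul_assoc] at h1
  exact h1.congr_of_eventuallyEq (Eventually.of_forall hft)

open scoped Matrix.Norms.Operator in
theorem matrix_hasDerivAt_of_add {d : ℕ} {M : ℝ → Matrix (Fin d) (Fin d) ℂ}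
    (hM : ∀ i j, Continuous fun s => M s i j) (h0 : M 0 = 1)
    (hadd : ∀ s t, M (s + t) = M s * M t) (i j : Fin d) (s : ℝ) :
    HasDerivAt (fun s => M s i j)
      ((M s * Matrix.of fun i j => deriv (fun s => M s i j) 0) i j) s := by
  obtain ⟨A, hA⟩ := exists_hasDerivAt_of_add (f := M) (continuous_matrix hM) h0 hadd
  have hent : ∀ i j s, HasDerivAt (fun s => M s i j) ((M s * A) i j) s := fun i j s =>
    (LinearMap.toContinuousLinearMap
      (Matrix.entryLinearMap ℝ ℂ i j)).hasFDerivAt.comp_hasDerivAt s (hA s)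
  have hAe : A = Matrix.of fun i j => deriv (fun s => M s i j) 0 := by
    ext i j
    rw [Matrix.of_apply, (hent i j 0).deriv, h0, one_mul]
  rw [← hAe]
  exact hent i j s

end OneParameter

/-! ### Conjugation into the diagonal torus -/

section Conjugacy

theorem frameSU2_add (k : Fin 3) (s t : ℝ) :
    frameSU2 k (s + t) = frameSU2 k s * frameSU2 k t := by
  refine su2_ext ?_ ?_ <;> fin_cases k <;>
    simp [frameSU2, Complex.cos_add, Complex.sin_add, mul_add, Complex.exp_add] <;>
    ring_nf <;> simp [Complex.I_sq] <;> ring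

theorem continuous_frameSU2 (k : Fin 3) : Continuous (frameSU2 k) := by
  refine Continuous.subtype_mk (continuous_matrix fun i j => ?_) _
  fin_cases k <;> fin_cases i <;> fin_cases j <;> simp <;> fun_prop

/-- Every element of `SU(2)` is conjugate to a diagonal one. -/
theorem exists_conj_frame (g : SU2) :
    ∃ h : SU2, g * h = h * frameSU2 2 (Real.arccos (halfTrace g)) := by
  set θ := Real.arccos (halfTrace g) with hθ
  set l : ℂ := Complex.exp (Complex.I * θ) with hl
  have hcos : Real.cos θ = halfTrace g :=
    Real.cos_arccos (halfTrace_mem g).1 (halfTrace_mem g).2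
  have hl' : star l = Complex.exp (-(Complex.I * θ)) := by
    rw [hl, Complex.star_def, ← Complex.exp_conj]
    simp
  have hll : l * star l = 1 := by
    rw [hl', hl, ← Complex.exp_add, add_neg_cancel, Complex.exp_zero]
  have hadd : l + star l = g.1 0 0 + star (g.1 0 0) := by
    have : l.re = (g.1 0 0).re := by
      rw [hl, Complex.exp_re]
      simp [hcos, halfTrace]
    exact (Complex.add_conj l).trans (this ▸ (Complex.add_conj (g.1 0 0)).symm)
  set a := g.1 0 0 with ha
  set b := g.1 0 1 with hb
  have hab : a * star a + b * star b = 1 := by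
    have := congrArg Complex.ofReal (su2_normSq g)
    rwa [Complex.ofReal_add, ← Complex.mul_conj, ← Complex.mul_conj, Complex.ofReal_one] at this
  have hD0 : (frameSU2 2 θ).1 0 0 = l := rfl
  have hD1 : (frameSU2 2 θ).1 0 1 = 0 := rfl
  have hD3 : (frameSU2 2 θ).1 1 1 = star l := by rw [hl']; rfl
  -- The vector (b, l - a) is an eigenvector of g with eigenvalue l, used after normalisation as
  -- first column of h. It vanishes exactly in the excluded case, where g is already the diagonal
  -- element.
  by_cases hz : b = 0 ∧ a = l
  · refine ⟨1, ?_⟩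
    rw [mul_one, one_mul]
    exact su2_ext hz.2 hz.1
  set N := Complex.normSq b + Complex.normSq (l - a) with hN
  have hNpos : 0 < N := by
    by_cases hb0 : b = 0
    · have : l - a ≠ 0 := fun h => hz ⟨hb0, (sub_eq_zero.1 h).symm⟩
      exact add_pos_of_nonneg_of_pos (Complex.normSq_nonneg _) (Complex.normSq_pos.2 this)
    · exact add_pos_of_pos_of_nonneg (Complex.normSq_pos.2 hb0) (Complex.normSq_nonneg _)
  set r : ℂ := (((√N)⁻¹ : ℝ) : ℂ) with hr
  have hnorm : Complex.normSq (r * b) + Complex.normSq (r * -star (l - a)) = 1 := by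
    rw [Complex.normSq_mul, Complex.normSq_mul, Complex.normSq_neg, Complex.star_def,
      Complex.normSq_conj, ← mul_add, hr, Complex.normSq_ofReal, ← mul_inv,
      Real.mul_self_sqrt hNpos.le, inv_mul_cancel₀ hNpos.ne']
  refine ⟨mkSU2 (r * b) (r * -star (l - a)) hnorm, ?_⟩
  have hrs : star r = r := by rw [hr, Complex.star_def, Complex.conj_ofReal]
  have hm0 : (mkSU2 (r * b) (r * -star (l - a)) hnorm).1 0 0 = r * b := rfl
  have hm1 : (mkSU2 (r * b) (r * -star (l - a)) hnorm).1 0 1 = r * -star (l - a) := rfl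
  have hm2 : (mkSU2 (r * b) (r * -star (l - a)) hnorm).1 1 0 = r * (l - a) := by
    change -star (r * -star (l - a)) = _
    rw [star_mul', hrs, star_neg, star_star]
    ring
  have hm3 : (mkSU2 (r * b) (r * -star (l - a)) hnorm).1 1 1 = r * star b := by
    change star (r * b) = _
    rw [star_mul', hrs]
  have hstar : star (l - a) = star l - star a := star_sub _ _
  refine su2_ext ?_ ?_
  · rw [Submonoid.coe_mul, Submonoid.coe_mul, Matrix.mul_apply, Matrix.mul_apply,
      Fin.sum_univ_two, Fin.sum_univ_two, hm0, hm1, hm2, hD0]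
    have : (frameSU2 2 θ).1 1 0 = 0 := rfl
    rw [this, ← ha, ← hb]
    ring
  · rw [Submonoid.coe_mul, Submonoid.coe_mul, Matrix.mul_apply, Matrix.mul_apply,
      Fin.sum_univ_two, Fin.sum_univ_two, hm0, hm1, hm3, hD1, hD3, ← ha, ← hb, hstar]
    linear_combination r * hab - r * hll + r * star l * hadd

end Conjugacy
end CompactLie

namespace CompactLie

/-! ### The radial Casimir equation and its solutions -/

section CharacterEquation

theorem frameSU2_zero (k : Fin 3) : frameSU2 k 0 = 1 := by
  have := frameSU2_add k 0 0
  rw [add_zero] at this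
  exact left_eq_mul.1 this

variable {d : ℕ} (π : UnitaryIrrep SU2 d)

theorem UnitaryIrrep.hasDerivAt_trace_mul_frame (k : Fin 3) (B : Matrix (Fin d) (Fin d) ℂ) (s : ℝ) :
    HasDerivAt (fun s => (B * (π.toHom (frameSU2 k s)).1).trace)
      (B * (π.toHom (frameSU2 k s)).1 * π.derived (frameSU2 k)).trace s := by
  have h0 : (π.toHom (frameSU2 k 0)).1 = 1 := by rw [frameSU2_zero, map_one]; rfl
  have hM := matrix_hasDerivAt_of_add (M := fun s => (π.toHom (frameSU2 k s)).1)
    (fun i j => (π.continuous_entry i j).comp (continuous_frameSU2 k)) h0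
    (fun s t => by rw [frameSU2_add, map_mul]; rfl)
  have htr : ∀ C : Matrix (Fin d) (Fin d) ℂ, (B * C).trace = ∑ i, ∑ j, B i j * C j i :=
    fun C => by simp only [Matrix.trace, Matrix.diag_apply, Matrix.mul_apply]
  rw [mul_assoc, htr]
  simp only [htr]
  exact HasDerivAt.fun_sum fun i _ => HasDerivAt.fun_sum fun j _ => (hM j i s).const_mul _

/-- The character of `π` along the diagonal torus. -/
noncomputable def UnitaryIrrep.torusChar (θ : ℝ) : ℂ := (π.toHom (frameSU2 2 θ)).1.trace

/-- The derivative of the character along the diagonal torus. -/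
noncomputable def UnitaryIrrep.torusCharDeriv (θ : ℝ) : ℂ :=
  ((π.toHom (frameSU2 2 θ)).1 * π.derived (frameSU2 2)).trace

theorem UnitaryIrrep.hasDerivAt_torusChar (θ : ℝ) :
    HasDerivAt π.torusChar (π.torusCharDeriv θ) θ := by
  have := π.hasDerivAt_trace_mul_frame 2 1 θ
  simp only [one_mul] at this
  exact this

theorem UnitaryIrrep.hasDerivAt_torusCharDeriv (θ : ℝ) :
    HasDerivAt π.torusCharDeriv ((π.toHom (frameSU2 2 θ)).1 *
      (π.derived (frameSU2 2) * π.derived (frameSU2 2))).trace θ := by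
  have := π.hasDerivAt_trace_mul_frame 2 (π.derived (frameSU2 2)) θ
  rw [Matrix.mul_assoc, Matrix.trace_mul_comm, Matrix.mul_assoc] at this
  refine this.congr_of_eventuallyEq (Eventually.of_forall fun s => ?_)
  exact Matrix.trace_mul_comm _ _

theorem UnitaryIrrep.trace_eq_torusChar (g : SU2) :
    (π.toHom g).1.trace = π.torusChar (Real.arccos (halfTrace g)) := by
  obtain ⟨h, hh⟩ := exists_conj_frame g
  have h1 : g = h * frameSU2 2 (Real.arccos (halfTrace g)) * h⁻¹ := eq_mul_inv_of_mul_eq hh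
  have h2 : (π.toHom h⁻¹).1 * (π.toHom h).1 = 1 := by
    have := congrArg Subtype.val (map_mul π.toHom h⁻¹ h)
    rw [inv_mul_cancel, map_one] at this
    exact this.symm
  have h3 : (π.toHom (h * frameSU2 2 (Real.arccos (halfTrace g)) * h⁻¹)).1 =
      (π.toHom h).1 * (π.toHom (frameSU2 2 (Real.arccos (halfTrace g)))).1 *
        (π.toHom h⁻¹).1 := by
    rw [map_mul, map_mul]
    rfl
  conv_lhs => rw [h1]
  rw [h3, Matrix.trace_mul_comm, ← Matrix.mul_assoc, h2, Matrix.one_mul]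
  rfl

theorem halfTrace_frame_two (θ : ℝ) : halfTrace (frameSU2 2 θ) = Real.cos θ := by
  simp [halfTrace, frameSU2, Complex.exp_re]

theorem vecPart_frame_two (θ : ℝ) {k : Fin 3} (hk : k ≠ 2) : vecPart k (frameSU2 2 θ) = 0 := by
  fin_cases k <;> first | exact absurd rfl hk | simp [vecPart, frameSU2]

/-- Contribution to the radial Laplacian of the directions orthogonal to the torus. -/
theorem UnitaryIrrep.trace_mul_derived_sq {θ : ℝ} (hθ : θ ∈ Set.Ioo 0 Real.pi) {k : Fin 3}
    (hk : k ≠ 2) :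
    ((π.toHom (frameSU2 2 θ)).1 * (π.derived (frameSU2 k) * π.derived (frameSU2 k))).trace
      = π.torusCharDeriv θ * (Real.cos θ / Real.sin θ : ℝ) := by
  have hsin : 0 < Real.sin θ := Real.sin_pos_of_pos_of_lt_pi hθ.1 hθ.2
  set c := Real.cos θ with hc
  have hcc : c ^ 2 < 1 := by nlinarith [Real.sin_sq_add_cos_sq θ]
  have hlt : ∀ s : ℝ, (c * Real.cos s) ^ 2 < 1 := fun s => by
    rw [mul_pow]
    nlinarith [Real.cos_sq_le_one s, sq_nonneg c, sq_nonneg (Real.cos s)]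
  have hne : ∀ s : ℝ, c * Real.cos s ≠ -1 ∧ c * Real.cos s ≠ 1 := fun s =>
    ⟨fun h => by have := hlt s; rw [h] at this; norm_num at this,
     fun h => by have := hlt s; rw [h] at this; norm_num at this⟩
  -- For k ≠ 2 the product of the torus element θ with x_k(s) has half trace cos θ cos s, so its
  -- character is `torusChar` at φ(s). Here φ' = w sin s, hence φ'(0) = 0 and φ''(0) = w(0) = cot θ.
  set φ : ℝ → ℝ := fun s => Real.arccos (c * Real.cos s) with hφ
  set w : ℝ → ℝ := fun s => c / √(1 - (c * Real.cos s) ^ 2) with hw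
  have hcos : ∀ s : ℝ, HasDerivAt (fun s => c * Real.cos s) (c * -Real.sin s) s := fun s =>
    (Real.hasDerivAt_cos s).const_mul c
  have hφd : ∀ s, HasDerivAt φ (w s * Real.sin s) s := fun s => by
    have := (Real.hasDerivAt_arccos (hne s).1 (hne s).2).comp s (hcos s)
    refine this.congr_deriv ?_
    simp only [hw]
    ring
  have hG : ∀ s, ((π.toHom (frameSU2 2 θ)).1 * (π.toHom (frameSU2 k s)).1).trace
      = π.torusChar (φ s) := fun s => by
    have h1 := π.trace_eq_torusChar (frameSU2 2 θ * frameSU2 k s)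
    rw [halfTrace_mul_frame, halfTrace_frame_two, vecPart_frame_two θ hk, zero_mul, sub_zero,
      map_mul] at h1
    exact h1
  have hG1 : ∀ s, ((π.toHom (frameSU2 2 θ)).1 * (π.toHom (frameSU2 k s)).1 *
      π.derived (frameSU2 k)).trace = π.torusCharDeriv (φ s) * (w s : ℂ) * (Real.sin s : ℂ) := by
    intro s
    have h1 := π.hasDerivAt_trace_mul_frame k (π.toHom (frameSU2 2 θ)).1 s
    have h2 := (π.hasDerivAt_torusChar (φ s)).scomp s (hφd s)
    have h3 := h1.unique (h2.congr_of_eventuallyEq (Eventually.of_forall hG))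
    rw [h3, Complex.real_smul]
    push_cast
    ring
  have hφ0 : φ 0 = θ := by
    simp only [hφ, Real.cos_zero, mul_one, hc]
    exact Real.arccos_cos hθ.1.le hθ.2.le
  have hw0 : w 0 = c / Real.sin θ := by
    simp only [hw, Real.cos_zero, mul_one, hc]
    rw [← Real.sin_sq, Real.sqrt_sq hsin.le]
  have hwd : DifferentiableAt ℝ w 0 := by
    refine (differentiableAt_const c).div ?_ ?_
    · refine DifferentiableAt.sqrt ?_ (sub_pos.2 (hlt 0)).ne'
      fun_prop
    · exact (Real.sqrt_pos.2 (sub_pos.2 (hlt 0))).ne'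
  have h1 := π.hasDerivAt_trace_mul_frame k
    (π.derived (frameSU2 k) * (π.toHom (frameSU2 2 θ)).1) 0
  -- Second derivative of the character at s = 0. The factor sin s vanishes there, so only the term
  -- with cos 0 = 1 survives and the value of w' is irrelevant.
  have h2 := ((((π.hasDerivAt_torusCharDeriv (φ 0)).scomp 0 (hφd 0)).mul
    hwd.hasDerivAt.ofReal_comp).mul (Real.hasDerivAt_sin 0).ofReal_comp)
  have h3 := h1.unique (h2.congr_of_eventuallyEq (Eventually.of_forall fun s => by
    simp only [Pi.mul_apply, Function.comp_apply]
    rw [← hG1, Matrix.mul_assoc, Matrix.trace_mul_comm]))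
  simp only [Pi.mul_apply, Function.comp_apply, Real.sin_zero, Real.cos_zero, hφ0, hw0,
    Complex.ofReal_zero, mul_zero, zero_add, Complex.ofReal_one, mul_one] at h3
  have hk0 : (π.toHom (frameSU2 k 0)).1 = 1 := by rw [frameSU2_zero, map_one]; rfl
  rw [hk0, Matrix.mul_one, Matrix.trace_mul_comm, ← Matrix.mul_assoc, Matrix.trace_mul_comm] at h3
  exact h3

theorem UnitaryIrrep.continuous_trace_mul_frame (k : Fin 3) (B : Matrix (Fin d) (Fin d) ℂ) :
    Continuous fun s => ((π.toHom (frameSU2 k s)).1 * B).trace := by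
  simp only [Matrix.trace_mul_comm _ B]
  exact continuous_iff_continuousAt.2 fun s => (π.hasDerivAt_trace_mul_frame k B s).continuousAt

/-- The radial part of the Casimir equation on the torus. -/
theorem UnitaryIrrep.torusChar_equation {κ : ℝ}
    (hκ : π.casimir frameSU2 = (-κ : ℂ) • (1 : Matrix (Fin d) (Fin d) ℂ)) {θ : ℝ}
    (hθ : θ ∈ Set.Icc 0 Real.pi) :
    (Real.sin θ : ℂ) * ((π.toHom (frameSU2 2 θ)).1 *
        (π.derived (frameSU2 2) * π.derived (frameSU2 2))).trace
      + 2 * (Real.cos θ : ℂ) * π.torusCharDeriv θ = -κ * Real.sin θ * π.torusChar θ := by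
  have hint : Set.EqOn (fun θ : ℝ => (Real.sin θ : ℂ) * ((π.toHom (frameSU2 2 θ)).1 *
        (π.derived (frameSU2 2) * π.derived (frameSU2 2))).trace
      + 2 * (Real.cos θ : ℂ) * π.torusCharDeriv θ)
      (fun θ : ℝ => -κ * Real.sin θ * π.torusChar θ) (Set.Ioo 0 Real.pi) := by
    intro θ hθ
    have hsin : 0 < Real.sin θ := Real.sin_pos_of_pos_of_lt_pi hθ.1 hθ.2
    have h1 : ((π.toHom (frameSU2 2 θ)).1 * π.casimir frameSU2).trace = -κ * π.torusChar θ := by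
      rw [hκ, Matrix.mul_smul, Matrix.mul_one, Matrix.trace_smul, smul_eq_mul]
      rfl
    rw [UnitaryIrrep.casimir, Fin.sum_univ_three, Matrix.mul_add, Matrix.mul_add,
      Matrix.trace_add, Matrix.trace_add, π.trace_mul_derived_sq hθ (k := 0) (by decide),
      π.trace_mul_derived_sq hθ (k := 1) (by decide)] at h1
    have h2 : (Real.sin θ : ℂ) ≠ 0 := Complex.ofReal_ne_zero.2 hsin.ne'
    rw [Complex.ofReal_div] at h1
    field_simp at h1
    simp only
    linear_combination h1
  -- Having been multiplied by sin θ, the equation has no cotangent singularity and extends to 0 and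
  -- π by continuity.
  have hcl := hint.closure
    (((Complex.continuous_ofReal.comp Real.continuous_sin).mul
        (π.continuous_trace_mul_frame 2 _)).add
      ((continuous_const.mul (Complex.continuous_ofReal.comp Real.continuous_cos)).mul
        (π.continuous_trace_mul_frame 2 _)))
    ((continuous_const.mul (Complex.continuous_ofReal.comp Real.continuous_sin)).mul
      (continuous_iff_continuousAt.2 fun s => (π.hasDerivAt_torusChar s).continuousAt))
  rw [closure_Ioo Real.pi_pos.ne] at hcl
  exact hcl hθ

/-- A solution of `y'' = -ω² y` on `[0, π]` with `y 0 = y π = 0` and `y' 0 ≠ 0` is a multiple of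
`sin (n ·)` for a nonzero integer `n = ω`. -/
theorem exists_int_of_oscillator {y y' : ℝ → ℂ} {ω c : ℂ} (hc : c ≠ 0)
    (hy : ∀ θ, HasDerivAt y (y' θ) θ)
    (hy' : ∀ θ ∈ Set.Icc 0 Real.pi, HasDerivAt y' (-ω ^ 2 * y θ) θ)
    (h0 : y 0 = 0) (hπ : y Real.pi = 0) (hc0 : y' 0 = c) :
    ∃ n : ℤ, n ≠ 0 ∧ ω = n ∧ ∀ θ ∈ Set.Icc 0 Real.pi, ω * y θ = c * Complex.sin (ω * θ) := by
  -- The derivative of (y' + αy) e^{-αθ} is (y'' - α² y) e^{-αθ} = 0. The choices α = ±iω give the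
  -- sine formula, and α = 0 treats ω = 0.
  have key : ∀ α : ℂ, α ^ 2 = -ω ^ 2 → ∀ θ ∈ Set.Icc 0 Real.pi,
      y' θ + α * y θ = c * Complex.exp (α * θ) := by
    intro α hα
    have hd : ∀ θ ∈ Set.Icc 0 Real.pi,
        HasDerivAt (fun θ : ℝ => (y' θ + α * y θ) * Complex.exp (-α * θ)) 0 θ := by
      intro θ hθ
      have h1 : HasDerivAt (fun θ : ℝ => Complex.exp (-α * θ))
          (Complex.exp (-α * θ) * (-α * 1)) θ :=
        ((Complex.ofRealCLM.hasDerivAt (x := θ)).const_mul (-α)).cexp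
      refine (((hy' θ hθ).fun_add ((hy θ).const_mul α)).fun_mul h1).congr_deriv ?_
      linear_combination (-Complex.exp (-α * θ) * y θ) * hα
    intro θ hθ
    have h2 := constant_of_has_deriv_right_zero
      (fun x hx => (hd x hx).continuousAt.continuousWithinAt)
      (fun x hx => (hd x (Set.Ico_subset_Icc_self hx)).hasDerivWithinAt) θ hθ
    simp only [hc0, h0, mul_zero, add_zero, Complex.ofReal_zero, Complex.exp_zero, mul_one] at h2
    rw [← h2, mul_assoc, ← Complex.exp_add]
    simp
  have hsin : ∀ θ ∈ Set.Icc 0 Real.pi, ω * y θ = c * Complex.sin (ω * θ) := by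
    intro θ hθ
    have h1 := key (ω * Complex.I) (by rw [mul_pow, Complex.I_sq]; ring) θ hθ
    have h2 := key (-(ω * Complex.I)) (by rw [neg_sq, mul_pow, Complex.I_sq]; ring) θ hθ
    have e1 : ω * Complex.I * θ = ω * θ * Complex.I := by ring
    have e2 : -(ω * Complex.I) * θ = -(ω * θ * Complex.I) := by ring
    rw [e1] at h1
    rw [e2] at h2
    rw [Complex.sin, neg_mul]
    linear_combination (-Complex.I / 2) * (h1 - h2) + ω * y θ * Complex.I_sq
  have hmem : Real.pi ∈ Set.Icc 0 Real.pi := ⟨Real.pi_pos.le, le_rfl⟩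
  have hpi := hsin Real.pi hmem
  rw [hπ, mul_zero] at hpi
  obtain ⟨n, hn⟩ := Complex.sin_eq_zero_iff.1 ((mul_eq_zero.1 hpi.symm).resolve_left hc)
  have hpiC : (Real.pi : ℂ) ≠ 0 := Complex.ofReal_ne_zero.2 Real.pi_ne_zero
  have hω : ω = n := mul_right_cancel₀ hpiC hn
  refine ⟨n, fun hn0 => ?_, hω, hsin⟩
  -- If ω = 0 then y' = c throughout, so y(π) = cπ ≠ 0.
  have hω0 : ω = 0 := by rw [hω, hn0, Int.cast_zero]
  have hd : ∀ θ ∈ Set.Icc 0 Real.pi, HasDerivAt (fun θ : ℝ => y θ - θ * c) 0 θ := by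
    intro θ hθ
    refine ((hy θ).sub ((Complex.ofRealCLM.hasDerivAt (x := θ)).mul_const c)).congr_deriv ?_
    have := key 0 (by rw [hω0]; ring) θ hθ
    simp only [zero_mul, add_zero, Complex.exp_zero, mul_one] at this
    simp [this]
  have h2 := constant_of_has_deriv_right_zero
    (fun x hx => (hd x hx).continuousAt.continuousWithinAt)
    (fun x hx => (hd x (Set.Ico_subset_Icc_self hx)).hasDerivWithinAt) Real.pi hmem
  simp only [hπ, h0, Complex.ofReal_zero, zero_mul, sub_zero, zero_sub] at h2
  exact mul_ne_zero hpiC hc (neg_eq_zero.1 h2)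

theorem UnitaryIrrep.torusChar_zero : π.torusChar 0 = d := by
  rw [UnitaryIrrep.torusChar, frameSU2_zero, map_one]
  exact (Matrix.trace_one).trans (by rw [Fintype.card_fin])

/-- The Casimir eigenvalue of an irreducible representation of `SU(2)` is `m (m + 2)` for some `m`,
and its character is then a multiple of the Chebyshev polynomial of degree `m`. -/
theorem UnitaryIrrep.exists_character {κ : ℝ}
    (hκ : π.casimir frameSU2 = (-κ : ℂ) • (1 : Matrix (Fin d) (Fin d) ℂ)) :
    ∃ m : ℕ, κ = m * (m + 2) ∧
      ∀ g, (π.toHom g).1.trace = d * (chebU m (halfTrace g) / (m + 1) : ℝ) := by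
  -- With y = sin θ · χ(θ) the radial equation becomes y'' = -(κ + 1) y, with y'(0) = d. The root ω
  -- is taken in ℂ because the sign of κ + 1 is not yet known.
  obtain ⟨ω, hω⟩ := IsAlgClosed.exists_pow_nat_eq ((κ : ℂ) + 1) (n := 2) (by norm_num)
  set F2 : ℝ → ℂ := fun θ => ((π.toHom (frameSU2 2 θ)).1 *
        (π.derived (frameSU2 2) * π.derived (frameSU2 2))).trace with hF2
  have hy : ∀ θ, HasDerivAt (fun θ : ℝ => (Real.sin θ : ℂ) * π.torusChar θ)
      ((Real.cos θ : ℂ) * π.torusChar θ + (Real.sin θ : ℂ) * π.torusCharDeriv θ) θ := fun θ =>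
    (Real.hasDerivAt_sin θ).ofReal_comp.mul (π.hasDerivAt_torusChar θ)
  have hy' : ∀ θ ∈ Set.Icc 0 Real.pi, HasDerivAt
      (fun θ : ℝ => (Real.cos θ : ℂ) * π.torusChar θ + (Real.sin θ : ℂ) * π.torusCharDeriv θ)
      (-ω ^ 2 * ((Real.sin θ : ℂ) * π.torusChar θ)) θ := by
    intro θ hθ
    refine (((Real.hasDerivAt_cos θ).ofReal_comp.mul (π.hasDerivAt_torusChar θ)).add
      ((Real.hasDerivAt_sin θ).ofReal_comp.mul (π.hasDerivAt_torusCharDeriv θ))).congr_deriv ?_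
    have h1 := π.torusChar_equation hκ hθ
    rw [hω, Complex.ofReal_neg]
    linear_combination h1
  have hd : (d : ℂ) ≠ 0 := Nat.cast_ne_zero.2 π.dim_pos.ne'
  obtain ⟨n, hn0, hωn, hsol⟩ := exists_int_of_oscillator hd hy hy' (by simp) (by simp)
    (by simp [π.torusChar_zero])
  obtain ⟨m, hm⟩ : ∃ m : ℕ, n.natAbs = m + 1 :=
    Nat.exists_eq_succ_of_ne_zero (Int.natAbs_ne_zero.2 hn0)
  have hsq : (n : ℝ) ^ 2 = (m + 1) ^ 2 := by
    have h1 : n ^ 2 = ((m : ℤ) + 1) ^ 2 := by rw [← Int.natAbs_sq, hm]; push_cast; ring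
    exact_mod_cast h1
  have hκm : κ = m * (m + 2) := by
    rw [hωn] at hω
    have : (n : ℝ) ^ 2 = κ + 1 := by exact_mod_cast hω
    linarith
  have hm1 : ((m : ℂ) + 1) ≠ 0 := by exact_mod_cast Nat.succ_ne_zero m
  have hF : Set.EqOn π.torusChar
      (fun θ => d * (chebU m (Real.cos θ) / (m + 1) : ℝ)) (Set.Ioo 0 Real.pi) := by
    intro θ hθ
    have hsin : (Real.sin θ : ℂ) ≠ 0 :=
      Complex.ofReal_ne_zero.2 (Real.sin_pos_of_pos_of_lt_pi hθ.1 hθ.2).ne'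
    have h1 : ((m : ℂ) + 1) * ((Real.sin θ : ℂ) * π.torusChar θ)
        = d * (Real.sin ((m + 1) * θ) : ℂ) := by
      have h2 := hsol θ (Set.Ioo_subset_Icc_self hθ)
      rw [hωn] at h2
      rcases Int.natAbs_eq n with h3 | h3
      · rw [h3, hm] at h2
        push_cast at h2 ⊢
        exact h2
      · rw [h3, hm] at h2
        push_cast at h2 ⊢
        rw [neg_mul, neg_mul, Complex.sin_neg, mul_neg, neg_inj] at h2
        exact h2
    rw [← chebU_cos_mul_sin] at h1
    push_cast at h1 ⊢
    have hsin' : Complex.sin θ ≠ 0 := by rwa [Complex.ofReal_sin] at hsin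
    rw [mul_div_assoc', eq_div_iff hm1]
    refine mul_right_cancel₀ hsin' ?_
    linear_combination h1
  have hcl := hF.closure
    (continuous_iff_continuousAt.2 fun s => (π.hasDerivAt_torusChar s).continuousAt)
    (continuous_const.mul (Complex.continuous_ofReal.comp
      (((continuous_chebU m).comp Real.continuous_cos).div_const _)))
  rw [closure_Ioo Real.pi_pos.ne] at hcl
  refine ⟨m, hκm, fun g => ?_⟩
  rw [π.trace_eq_torusChar, hcl ⟨Real.arccos_nonneg _, Real.arccos_le_pi _⟩]
  simp only [Real.cos_arccos (halfTrace_mem g).1 (halfTrace_mem g).2]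

end CharacterEquation
end CompactLie

namespace CompactLie

/-! ### The induced semigroups on `SU(2)` -/

section SchurLemma

variable {G : Type} [Group G] [TopologicalSpace G] {d : ℕ}

/-- Schur's lemma. -/
theorem UnitaryIrrep.exists_eq_smul_one (π : UnitaryIrrep G d) {B : Matrix (Fin d) (Fin d) ℂ}
    (hB : ∀ g, (π.toHom g).1 * B = B * (π.toHom g).1) : ∃ c : ℂ, B = c • 1 := by
  have : Nonempty (Fin d) := ⟨⟨0, π.dim_pos⟩⟩
  obtain ⟨c, hc⟩ := Module.End.exists_eigenvalue (Matrix.toLin' B)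
  have hmem : ∀ v, v ∈ Module.End.eigenspace (Matrix.toLin' B) c ↔ B.mulVec v = c • v := fun v => by
    rw [Module.End.mem_eigenspace_iff, Matrix.toLin'_apply]
  have htop := (π.irreducible (Module.End.eigenspace (Matrix.toLin' B) c) fun g v hv => by
    rw [hmem] at hv ⊢
    rw [Matrix.mulVec_mulVec, ← hB, ← Matrix.mulVec_mulVec, hv, Matrix.mulVec_smul]).resolve_left hc
  refine ⟨c, Matrix.toLin'.injective (LinearMap.ext fun v => ?_)⟩
  rw [Matrix.toLin'_apply, Matrix.toLin'_apply, Matrix.smul_mulVec, Matrix.one_mulVec]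
  exact (hmem v).1 (htop ▸ Submodule.mem_top)

end SchurLemma

/-! ### Fourier transforms of central densities -/

section Fourier

variable {G : Type} [Group G] [TopologicalSpace G] [MeasurableSpace G] [BorelSpace G] {d : ℕ}

theorem UnitaryIrrep.fourier_withDensity (π : UnitaryIrrep G d) (μ : Measure G) {k : G → ℝ}
    (hk : Continuous k) (hk0 : ∀ g, 0 ≤ k g) (i j : Fin d) :
    π.fourier (μ.withDensity fun g => ENNReal.ofReal (k g)) i j =
      ∫ g, (k g : ℂ) * (π.toHom g).1 i j ∂μ := by
  rw [UnitaryIrrep.fourier, Matrix.of_apply, integral_withDensity_eq_integral_toReal_smul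
    hk.measurable.ennreal_ofReal (ae_of_all _ fun _ => ENNReal.ofReal_lt_top)]
  refine integral_congr_ae (ae_of_all _ fun g => ?_)
  simp only [ENNReal.toReal_ofReal (hk0 g), Complex.real_smul]

theorem UnitaryIrrep.fourier_dirac_one (π : UnitaryIrrep G d) :
    π.fourier (Measure.dirac (1 : G)) = 1 := by
  ext i j
  rw [UnitaryIrrep.fourier, Matrix.of_apply,
    integral_dirac' _ _ (π.continuous_entry i j).stronglyMeasurable, map_one]
  rfl

/-- The Fourier transform of a measure with a central density is scalar. -/
theorem UnitaryIrrep.fourier_central [IsTopologicalGroup G] [CompactSpace G]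
    [SecondCountableTopology G] [T2Space G] (π : UnitaryIrrep G d) {k : G → ℝ}
    (hk : Continuous k) (hk0 : ∀ g, 0 ≤ k g) (hc : ∀ g h, k (g * h) = k (h * g)) :
    ∃ c : ℂ, π.fourier ((Measure.haarMeasure (⊤ : TopologicalSpace.PositiveCompacts G)).withDensity
      fun g => ENNReal.ofReal (k g)) = c • 1 := by
  set μ := Measure.haarMeasure (⊤ : TopologicalSpace.PositiveCompacts G) with hμ
  have : μ.IsMulRightInvariant := haar_isMulRightInvariant
  have hint : ∀ i j, Integrable (fun g => (k g : ℂ) * (π.toHom g).1 i j) μ := fun i j =>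
    integrable_continuousMap μ ⟨_, (Complex.continuous_ofReal.comp hk).mul (π.continuous_entry i j)⟩
  refine π.exists_eq_smul_one fun h => ?_
  ext i j
  simp only [Matrix.mul_apply, π.fourier_withDensity μ hk hk0, ← integral_const_mul,
    ← integral_mul_const]
  rw [← integral_finsetSum _ fun l _ => (hint l j).const_mul _,
    ← integral_finsetSum _ fun l _ => (hint i l).mul_const _]
  have h1 : ∀ g, (∑ l, (π.toHom h).1 i l * ((k g : ℂ) * (π.toHom g).1 l j))
      = (k g : ℂ) * (π.toHom (h * g)).1 i j := fun g => by
    rw [map_mul, Submonoid.coe_mul, Matrix.mul_apply, Finset.mul_sum]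
    exact Finset.sum_congr rfl fun l _ => by ring
  have h2 : ∀ g, (∑ l, (k g : ℂ) * (π.toHom g).1 i l * (π.toHom h).1 l j)
      = (k g : ℂ) * (π.toHom (g * h)).1 i j := fun g => by
    rw [map_mul, Submonoid.coe_mul, Matrix.mul_apply, Finset.mul_sum]
    exact Finset.sum_congr rfl fun l _ => by ring
  simp only [h1, h2]
  -- Substituting hg in one integral and gh in the other puts π(hgh) in both; the weights k(hg) and
  -- k(gh) agree because k is central.
  rw [← integral_mul_left_eq_self (fun g => (k g : ℂ) * (π.toHom (g * h)).1 i j) h,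
    ← integral_mul_right_eq_self (fun g => (k g : ℂ) * (π.toHom (h * g)).1 i j) h]
  refine integral_congr_ae (ae_of_all _ fun g => ?_)
  simp only [hc h g, mul_assoc]

end Fourier

/-! ### The semigroup on `SU(2)` from its character series -/

section SemigroupSU2

theorem halfTrace_mul_comm (g h : SU2) : halfTrace (g * h) = halfTrace (h * g) := by
  have htr : ∀ g : SU2, g.1.trace = (2 * halfTrace g : ℝ) := fun g => by
    rw [Matrix.trace_fin_two, su2_apply_one_one]
    exact Complex.add_conj _
  have := Matrix.trace_mul_comm g.1 h.1
  rw [← Submonoid.coe_mul, ← Submonoid.coe_mul, htr, htr] at this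
  have := Complex.ofReal_injective this
  linarith

variable {b : ℕ → ℝ}

/-- The central function on `SU(2)` with character coefficients `b`. -/
noncomputable def centralSU2 (b : ℕ → ℝ) (g : SU2) : ℝ := charSeries b (halfTrace g)

theorem RapidDecay.continuous_centralSU2 (hb : RapidDecay b) : Continuous (centralSU2 b) :=
  hb.continuousOn_charSeries.comp_continuous continuous_halfTrace halfTrace_mem

theorem RapidDecay.integral_centralSU2_mul_chebU (hb : RapidDecay b) (m : ℕ) :
    ∫ g, centralSU2 b g * chebU m (halfTrace g) ∂haarSU2 = (m + 1) * b m := by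
  have hc : ∀ n : ℕ, Continuous fun g : SU2 =>
      (n + 1) * b n * chebU n (halfTrace g) * chebU m (halfTrace g) := fun n =>
    (continuous_const.mul ((continuous_chebU n).comp continuous_halfTrace)).mul
      ((continuous_chebU m).comp continuous_halfTrace)
  have hint : ∀ n : ℕ, Integrable (fun g : SU2 =>
      (n + 1) * b n * chebU n (halfTrace g) * chebU m (halfTrace g)) haarSU2 := fun n =>
    integrable_real (hc n) _
  have hsum : Summable fun n : ℕ => ∫ g : SU2,
      ‖(n + 1) * b n * chebU n (halfTrace g) * chebU m (halfTrace g)‖ ∂haarSU2 := by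
    refine Summable.of_nonneg_of_le (fun n => integral_nonneg fun _ => norm_nonneg _)
      (fun n => ?_) (Summable.mul_right ((m : ℝ) + 1) hb)
    refine (integral_mono (hint n).norm (integrable_const
      (((n : ℝ) + 1) ^ 2 * |b n| * (m + 1))) fun g => ?_).trans_eq (by simp)
    rw [norm_mul]
    exact mul_le_mul (abs_charTerm_le b n (halfTrace_mem g)) (abs_chebU_le m (halfTrace_mem g))
      (norm_nonneg _) (by positivity)
  have h := hasSum_integral_of_summable_integral_norm hint hsum
  have hl : ∀ g : SU2, ∑' n : ℕ, (n + 1) * b n * chebU n (halfTrace g) * chebU m (halfTrace g)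
      = centralSU2 b g * chebU m (halfTrace g) := fun g => tsum_mul_right
  simp only [hl] at h
  simp only [mul_assoc _ (chebU _ _) (chebU _ _), integral_const_mul,
    integral_chebU_mul_chebU] at h
  have hite : (fun n : ℕ => ((n : ℝ) + 1) * b n * if n = m then 1 else 0)
      = fun n => if n = m then ((m : ℝ) + 1) * b m else 0 := by
    ext n
    split_ifs with h
    · rw [h, mul_one]
    · rw [mul_zero]
  rw [hite] at h
  exact h.unique (hasSum_ite_eq m _)

/-- By `UnitaryIrrep.fourier_central` the transform is c · 1. Its trace c d is the integral of the
density against the character d U_m/(m + 1), which is d b_m by orthogonality; the actual value of d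
is never needed. -/
theorem UnitaryIrrep.fourier_centralSU2 (hb : RapidDecay b) (hpos : CharNonneg b) {d : ℕ}
    (π : UnitaryIrrep SU2 d) {m : ℕ} 
    (hm : ∀ g, (π.toHom g).1.trace = d * (chebU m (halfTrace g) / (m + 1) : ℝ)) :
    π.fourier (haarSU2.withDensity fun g => ENNReal.ofReal (centralSU2 b g)) = (b m : ℂ) • 1 := by
  have hk0 : ∀ g, 0 ≤ centralSU2 b g := fun g => hpos _ (halfTrace_mem g)
  obtain ⟨c, hc⟩ := π.fourier_central hb.continuous_centralSU2 hk0 fun g h => by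
    rw [centralSU2, halfTrace_mul_comm]; rfl
  have hint : ∀ i, Integrable (fun g => (centralSU2 b g : ℂ) * (π.toHom g).1 i i) haarSU2 := fun i =>
    integrable_continuousMap _ ⟨_, (Complex.continuous_ofReal.comp hb.continuous_centralSU2).mul
      (π.continuous_entry i i)⟩
  have htr : (c • (1 : Matrix (Fin d) (Fin d) ℂ)).trace = d * b m := by
    rw [← hc, Matrix.trace]
    simp only [Matrix.diag_apply, π.fourier_withDensity _ hb.continuous_centralSU2 hk0]
    rw [← integral_finsetSum _ fun i _ => hint i]
    have h1 : ∀ g, ∑ i, (centralSU2 b g : ℂ) * (π.toHom g).1 i i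
        = d * (((centralSU2 b g * chebU m (halfTrace g) : ℝ) : ℂ) / (m + 1)) := fun g => by
      rw [← Finset.mul_sum]
      refine (congrArg _ (hm g)).trans ?_
      push_cast
      ring
    simp only [h1]
    rw [integral_const_mul, integral_div, integral_complex_ofReal]
    have h2 := hb.integral_centralSU2_mul_chebU m
    have hm1 : ((m : ℂ) + 1) ≠ 0 := by exact_mod_cast Nat.succ_ne_zero m
    refine (congrArg (fun z : ℝ => (d : ℂ) * ((z : ℂ) / (m + 1))) h2).trans ?_
    push_cast
    field_simp
  have hd : (d : ℂ) ≠ 0 := Nat.cast_ne_zero.2 π.dim_pos.ne'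
  rw [Matrix.trace_smul, Matrix.trace_one, Fintype.card_fin, smul_eq_mul, mul_comm] at htr
  rw [hc, mul_left_cancel₀ hd htr]

theorem isProbabilityMeasure_centralSU2 (hb : RapidDecay b) (hpos : CharNonneg b) (h0 : b 0 = 1) :
    IsProbabilityMeasure (haarSU2.withDensity fun g => ENNReal.ofReal (centralSU2 b g)) := by
  refine ⟨?_⟩
  rw [withDensity_apply _ MeasurableSet.univ, setLIntegral_univ,
    ← ofReal_integral_eq_lintegral_ofReal (integrable_real hb.continuous_centralSU2 _)
      (ae_of_all _ fun g => hpos _ (halfTrace_mem g))]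
  have := hb.integral_centralSU2_mul_chebU 0
  simp only [chebU_zero, mul_one, Nat.cast_zero, zero_add, h0] at this
  rw [this, ENNReal.ofReal_one]

/-- The candidate for the semigroup on `SU(2)` induced by `η`. -/
noncomputable def semigroupSU2 (η : ℝ → ℝ) (t : ℝ) : Measure SU2 :=
  if 0 < t then haarSU2.withDensity fun g => ENNReal.ofReal (centralSU2 (semigroupCoeff η t) g)
  else Measure.dirac 1

variable {η : ℝ → ℝ}

theorem isContinuousDensity_semigroupSU2 (hb : ∀ t, 0 < t → RapidDecay (semigroupCoeff η t))
    (hpos : ∀ t, 0 < t → CharNonneg (semigroupCoeff η t)) :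
    IsContinuousDensity (semigroupSU2 η) fun t => centralSU2 (semigroupCoeff η t) := fun t ht =>
  ⟨(hb t ht).continuous_centralSU2, fun g => hpos t ht _ (halfTrace_mem g), if_pos ht⟩

theorem isInducedSemigroup_semigroupSU2 (h0 : η 0 = 0)
    (hb : ∀ t, 0 < t → RapidDecay (semigroupCoeff η t))
    (hpos : ∀ t, 0 < t → CharNonneg (semigroupCoeff η t)) :
    IsInducedSemigroup frameSU2 η (semigroupSU2 η) := by
  refine faithfulFrameSU2.isInducedSemigroup (fun t _ => ?_) (if_neg (lt_irrefl 0))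
    fun t ht d π κ hκ => ?_
  · unfold semigroupSU2
    split_ifs with ht
    · exact isProbabilityMeasure_centralSU2 (hb t ht) (hpos t ht) (by simp [semigroupCoeff, h0])
    · infer_instance
  · rcases ht.lt_or_eq with ht | rfl
    · obtain ⟨m, rfl, hm⟩ := π.exists_character hκ
      rw [semigroupSU2, if_pos ht, π.fourier_centralSU2 (hb t ht) (hpos t ht) hm]
      rfl
    · rw [semigroupSU2, if_neg (lt_irrefl 0), π.fourier_dirac_one]
      simp

theorem hasDensityAsymptotics_SU2 {a : ℝ → ℝ} (h0 : η 0 = 0)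
    (hb : ∀ t, 0 < t → RapidDecay (semigroupCoeff η t))
    (hpos : ∀ t, 0 < t → CharNonneg (semigroupCoeff η t))
    (ha : (fun t => charSeries (semigroupCoeff η t) 1) ~[𝓝[>] 0] a) :
    HasDensityAsymptotics frameSU2 η a :=
  faithfulFrameSU2.hasDensityAsymptotics (isInducedSemigroup_semigroupSU2 h0 hb hpos)
    (isContinuousDensity_semigroupSU2 hb hpos) (by simpa only [centralSU2, halfTrace_one] using ha)

end SemigroupSU2
end CompactLie

namespace CompactLie

/-! ### The double cover of `SO(3)` by `SU(2)` -/

section DoubleCover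

/-- The rotation matrix of the quaternion `w - x i - y j - z k`. -/
def quatRotation (w x y z : ℝ) : Matrix (Fin 3) (Fin 3) ℝ :=
  !![w ^ 2 + x ^ 2 - y ^ 2 - z ^ 2, 2 * (x * y + w * z), 2 * (x * z - w * y);
     2 * (x * y - w * z), w ^ 2 - x ^ 2 + y ^ 2 - z ^ 2, 2 * (y * z + w * x);
     2 * (x * z + w * y), 2 * (y * z - w * x), w ^ 2 - x ^ 2 - y ^ 2 + z ^ 2]

theorem quatRotation_mul (w x y z w' x' y' z' : ℝ) :
    quatRotation w x y z * quatRotation w' x' y' z' =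
      quatRotation (w * w' - x * x' - y * y' - z * z')
        (w * x' + w' * x - (y * z' - z * y')) (w * y' + w' * y - (z * x' - x * z'))
        (w * z' + w' * z - (x * y' - y * x')) := by
  ext i j
  fin_cases i <;> fin_cases j <;>
    simp [quatRotation, Matrix.mul_apply, Fin.sum_univ_three] <;> ring

theorem star_quatRotation (w x y z : ℝ) :
    star (quatRotation w x y z) = quatRotation w (-x) (-y) (-z) := by
  ext i j
  fin_cases i <;> fin_cases j <;> simp [quatRotation, Matrix.star_apply] <;> ring

theorem quatRotation_real (w : ℝ) : quatRotation w 0 0 0 = w ^ 2 • 1 := by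
  ext i j
  fin_cases i <;> fin_cases j <;> simp [quatRotation]

theorem det_quatRotation (w x y z : ℝ) :
    (quatRotation w x y z).det = (w ^ 2 + x ^ 2 + y ^ 2 + z ^ 2) ^ 3 := by
  simp [quatRotation, Matrix.det_fin_three]
  ring

theorem quatRotation_mem {w x y z : ℝ} (h : w ^ 2 + x ^ 2 + y ^ 2 + z ^ 2 = 1) :
    quatRotation w x y z ∈ Matrix.specialUnitaryGroup (Fin 3) ℝ := by
  rw [Matrix.mem_specialUnitaryGroup_iff, Matrix.mem_unitaryGroup_iff]
  refine ⟨?_, by rw [det_quatRotation, h, one_pow]⟩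
  rw [star_quatRotation, quatRotation_mul]
  have h1 : quatRotation 1 0 0 0 = 1 := by rw [quatRotation_real, one_pow, one_smul]
  rw [← h1]
  congr 1
  · linear_combination h
  all_goals ring

theorem halfTrace_mul (g h : SU2) : halfTrace (g * h) = halfTrace g * halfTrace h
    - vecPart 0 g * vecPart 0 h - vecPart 1 g * vecPart 1 h - vecPart 2 g * vecPart 2 h := by
  simp [halfTrace, vecPart, Matrix.mul_apply, Fin.sum_univ_two, su2_apply_one_zero]
  ring

theorem vecPart_zero_mul (g h : SU2) : vecPart 0 (g * h) =
    halfTrace g * vecPart 0 h + halfTrace h * vecPart 0 g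
      - (vecPart 1 g * vecPart 2 h - vecPart 2 g * vecPart 1 h) := by
  simp [halfTrace, vecPart, Matrix.mul_apply, Fin.sum_univ_two, su2_apply_one_one]
  ring

theorem vecPart_one_mul (g h : SU2) : vecPart 1 (g * h) =
    halfTrace g * vecPart 1 h + halfTrace h * vecPart 1 g
      - (vecPart 2 g * vecPart 0 h - vecPart 0 g * vecPart 2 h) := by
  simp [halfTrace, vecPart, Matrix.mul_apply, Fin.sum_univ_two, su2_apply_one_one]
  ring

theorem vecPart_two_mul (g h : SU2) : vecPart 2 (g * h) =
    halfTrace g * vecPart 2 h + halfTrace h * vecPart 2 g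
      - (vecPart 0 g * vecPart 1 h - vecPart 1 g * vecPart 0 h) := by
  simp [halfTrace, vecPart, Matrix.mul_apply, Fin.sum_univ_two, su2_apply_one_zero]
  ring

theorem sum_sq_su2 (g : SU2) :
    halfTrace g ^ 2 + vecPart 0 g ^ 2 + vecPart 1 g ^ 2 + vecPart 2 g ^ 2 = 1 := by
  have := halfTrace_sq_add g
  rw [Fin.sum_univ_three] at this
  linarith

/-- The double cover `SU(2) → SO(3)`. -/
noncomputable def doubleCover : SU2 →* SO3 where
  toFun g := ⟨quatRotation (halfTrace g) (vecPart 0 g) (vecPart 1 g) (vecPart 2 g),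
    quatRotation_mem (sum_sq_su2 g)⟩
  map_one' := by
    refine Subtype.ext ?_
    have h1 : quatRotation 1 0 0 0 = 1 := by rw [quatRotation_real, one_pow, one_smul]
    refine Eq.trans ?_ h1
    simp [halfTrace, vecPart]
  map_mul' g h := by
    refine Subtype.ext (Eq.trans ?_ (quatRotation_mul _ _ _ _ _ _ _ _).symm)
    simp only [halfTrace_mul, vecPart_zero_mul, vecPart_one_mul, vecPart_two_mul]

theorem doubleCover_val (g : SU2) : (doubleCover g).1 =
    quatRotation (halfTrace g) (vecPart 0 g) (vecPart 1 g) (vecPart 2 g) := rfl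

theorem continuous_doubleCover : Continuous doubleCover := by
  refine Continuous.subtype_mk (continuous_matrix fun i j => ?_) _
  have h0 := continuous_halfTrace
  have h1 := continuous_vecPart
  fin_cases i <;> fin_cases j <;> simp [quatRotation] <;> fun_prop

/-- Rotation angles double under the cover, and the sign comes from the conjugate quaternion in
`quatRotation`. This factor is the source of the ratio 4 between the Casimir operators. -/
theorem doubleCover_frame (k : Fin 3) (s : ℝ) :
    doubleCover (frameSU2 k s) = frameSO3 k (-2 * s) := by
  have h := Real.cos_sq' s
  refine Subtype.ext (Matrix.ext fun i j => ?_)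
  rw [doubleCover_val]
  fin_cases k <;> fin_cases i <;> fin_cases j <;>
    simp [quatRotation, frameSO3, frameSU2, halfTrace, vecPart, Real.cos_two_mul,
      Real.sin_two_mul, Complex.exp_re, Complex.exp_im, -Complex.ofReal_cos, -Complex.ofReal_sin] <;>
    (try ring_nf) <;> (try rw [h]) <;> (try ring)

theorem trace_doubleCover (g : SU2) : (doubleCover g).1.trace = 4 * halfTrace g ^ 2 - 1 := by
  rw [doubleCover_val, Matrix.trace_fin_three]
  simp [quatRotation]
  linarith [sum_sq_su2 g]

theorem exists_polar (a b : ℝ) : ∃ r θ : ℝ, 0 ≤ r ∧ r * Real.cos θ = a ∧ r * Real.sin θ = b :=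
  ⟨‖(⟨a, b⟩ : ℂ)‖, Complex.arg ⟨a, b⟩, norm_nonneg _, Complex.norm_mul_cos_arg _,
    Complex.norm_mul_sin_arg _⟩

theorem frameSO3_mem_range (k : Fin 3) (s : ℝ) : frameSO3 k s ∈ doubleCover.range :=
  ⟨frameSU2 k (-s / 2), by rw [doubleCover_frame]; congr 1; ring⟩

theorem so3_mul_apply (S T : SO3) (i j : Fin 3) : (S * T).1 i j =
    S.1 i 0 * T.1 0 j + S.1 i 1 * T.1 1 j + S.1 i 2 * T.1 2 j := by
  rw [Submonoid.coe_mul, Matrix.mul_apply, Fin.sum_univ_three]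

theorem so3_orthonormal (S : SO3) (i j : Fin 3) :
    S.1 i 0 * S.1 j 0 + S.1 i 1 * S.1 j 1 + S.1 i 2 * S.1 j 2 = if i = j then 1 else 0 := by
  have h := congrFun (congrFun (Matrix.mem_unitaryGroup_iff.1
    (Matrix.mem_specialUnitaryGroup_iff.1 S.2).1) i) j
  rw [Matrix.mul_apply, Fin.sum_univ_three, Matrix.one_apply] at h
  exact h

theorem so3_orthonormal_col (S : SO3) (i j : Fin 3) :
    S.1 0 i * S.1 0 j + S.1 1 i * S.1 1 j + S.1 2 i * S.1 2 j = if i = j then 1 else 0 := by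
  have h := congrFun (congrFun (Matrix.mem_unitaryGroup_iff'.1
    (Matrix.mem_specialUnitaryGroup_iff.1 S.2).1) i) j
  rw [Matrix.mul_apply, Fin.sum_univ_three, Matrix.one_apply] at h
  exact h

/-- A rotation fixing the last coordinate vector is a rotation about the last axis. -/
theorem exists_eq_frameSO3_two (S : SO3) (h0 : S.1 0 2 = 0) (h1 : S.1 1 2 = 0)
    (h2 : S.1 2 2 = 1) : ∃ θ, S = frameSO3 2 θ := by
  have e22 := so3_orthonormal S 2 2
  have e00 := so3_orthonormal S 0 0
  have e11 := so3_orthonormal S 1 1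
  simp only [h0, h1, h2, if_true, mul_zero, add_zero, mul_one] at e22 e00 e11
  have h20 : S.1 2 0 = 0 := by nlinarith [mul_self_nonneg (S.1 2 0), mul_self_nonneg (S.1 2 1)]
  have h21 : S.1 2 1 = 0 := by nlinarith [mul_self_nonneg (S.1 2 0), mul_self_nonneg (S.1 2 1)]
  have hdet := (Matrix.mem_specialUnitaryGroup_iff.1 S.2).2
  rw [Matrix.det_fin_three] at hdet
  simp only [h0, h1, h2, h20, h21, mul_zero, zero_mul, sub_zero, add_zero, mul_one] at hdet
  -- The first two squared row norms minus twice the determinant form a sum of squares equal to 1 +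
  -- 1 - 2 = 0; this forces the rotation shape of the 2 × 2 block.
  have hs : (S.1 0 0 - S.1 1 1) ^ 2 + (S.1 0 1 + S.1 1 0) ^ 2 = 0 := by
    linear_combination e00 + e11 - 2 * hdet
  have hd : S.1 1 1 = S.1 0 0 := by
    nlinarith [sq_nonneg (S.1 0 0 - S.1 1 1), sq_nonneg (S.1 0 1 + S.1 1 0)]
  have ho : S.1 0 1 = -S.1 1 0 := by
    nlinarith [sq_nonneg (S.1 0 0 - S.1 1 1), sq_nonneg (S.1 0 1 + S.1 1 0)]
  obtain ⟨r, θ, hr, hc, hsn⟩ := exists_polar (S.1 0 0) (S.1 1 0)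
  have hr1 : r = 1 := by
    have hr2 : r ^ 2 = 1 := by
      rw [ho, ← hc, ← hsn] at e00
      linear_combination e00 - r ^ 2 * Real.sin_sq_add_cos_sq θ
    nlinarith
  rw [hr1, one_mul] at hc hsn
  refine ⟨θ, Subtype.ext (Matrix.ext fun i j => ?_)⟩
  fin_cases i <;> fin_cases j <;> simp [frameSO3, h0, h1, h2, h20, h21, hd, ho, hc, hsn]

/-- Euler angles: polar coordinates of the last column of R give rotations about the third and
second axes that carry it to the last coordinate vector. What remains is a rotation about the third
axis, and all axis rotations lie in the range. -/
theorem doubleCover_surjective : Function.Surjective doubleCover := by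
  intro R
  change R ∈ doubleCover.range
  obtain ⟨r, φ, hr, hrc, hrs⟩ := exists_polar (R.1 0 2) (R.1 1 2)
  obtain ⟨ρ, θ, hρ, hρc, hρs⟩ := exists_polar (R.1 2 2) r
  have hcol := so3_orthonormal_col R 2 2
  have hc1 := Real.sin_sq_add_cos_sq φ
  have hc2 := Real.sin_sq_add_cos_sq θ
  rw [if_pos rfl] at hcol
  have hρ1 : ρ = 1 := by
    have : ρ ^ 2 = 1 := by
      rw [← hrc, ← hrs, ← hρc, ← hρs] at hcol
      linear_combination hcol - ρ ^ 2 * hc2 - (ρ * Real.sin θ) ^ 2 * hc1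
    nlinarith
  rw [hρ1, one_mul] at hρc hρs
  obtain ⟨ψ, hψ⟩ := exists_eq_frameSO3_two (frameSO3 1 (-θ) * (frameSO3 2 (-φ) * R))
    (by
      rw [so3_mul_apply, so3_mul_apply, so3_mul_apply, so3_mul_apply]
      simp [frameSO3]
      rw [← hrc, ← hrs, ← hρs, ← hρc]
      linear_combination Real.cos θ * Real.sin θ * hc1)
    (by
      rw [so3_mul_apply, so3_mul_apply, so3_mul_apply, so3_mul_apply]
      simp [frameSO3]
      rw [← hrc, ← hrs]
      ring)
    (by
      rw [so3_mul_apply, so3_mul_apply, so3_mul_apply, so3_mul_apply]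
      simp [frameSO3]
      rw [← hrc, ← hrs, ← hρs, ← hρc]
      linear_combination hc2 + Real.sin θ ^ 2 * hc1)
  have h3 : frameSO3 1 (-θ) * (frameSO3 2 (-φ) * R) ∈ doubleCover.range :=
    hψ ▸ frameSO3_mem_range 2 ψ
  exact ((Subgroup.mul_mem_cancel_left _ (frameSO3_mem_range 2 _)).1
    ((Subgroup.mul_mem_cancel_left _ (frameSO3_mem_range 1 _)).1 h3))

end DoubleCover
end CompactLie

namespace CompactLie

/-! ### The induced semigroups on `SO(3)` -/

section EvenPart

variable {b : ℕ → ℝ}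

theorem RapidDecay.evenPart (hb : RapidDecay b) : RapidDecay (evenPart b) := by
  refine Summable.of_nonneg_of_le (fun n => by positivity) (fun n => ?_) hb
  unfold CompactLie.evenPart
  split_ifs
  · exact le_rfl
  · rw [abs_zero, mul_zero]
    positivity

theorem charSeries_evenPart_neg (b : ℕ → ℝ) (x : ℝ) :
    charSeries (evenPart b) (-x) = charSeries (evenPart b) x := by
  refine tsum_congr fun n => ?_
  rw [chebU_neg, evenPart]
  split_ifs with h
  · rw [h.neg_one_pow, one_mul]
  · simp

theorem RapidDecay.charSeries_evenPart (hb : RapidDecay b) {x : ℝ} (hx : x ∈ Set.Icc (-1 : ℝ) 1) :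
    charSeries (CompactLie.evenPart b) x = (charSeries b x + charSeries b (-x)) / 2 := by
  have hx' : -x ∈ Set.Icc (-1 : ℝ) 1 := ⟨by linarith [hx.2], by linarith [hx.1]⟩
  rw [charSeries, charSeries, charSeries, ← (hb.summable hx).tsum_add (hb.summable hx'),
    ← tsum_div_const]
  refine tsum_congr fun n => ?_
  rw [chebU_neg, CompactLie.evenPart]
  split_ifs with h
  · rw [h.neg_one_pow]
    ring
  · rw [(Nat.not_even_iff_odd.1 h).neg_one_pow]
    ring

/-- Taking the even part of the coefficients is averaging the class function over the centre {±1} of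
`SU(2)`. -/
theorem CharNonneg.evenPart (hb : RapidDecay b) (h : CharNonneg b) :
    CharNonneg (CompactLie.evenPart b) := fun x hx => by
  rw [hb.charSeries_evenPart hx]
  have h1 := h x hx
  have h2 := h (-x) ⟨by linarith [hx.2], by linarith [hx.1]⟩
  positivity

/-- The central function on `SO(3)` whose lift to `SU(2)` is `centralSU2 (evenPart b)`. -/
noncomputable def centralSO3 (b : ℕ → ℝ) (R : SO3) : ℝ :=
  charSeries (evenPart b) √((1 + R.1.trace) / 4)

/-- The trace of the rotation determines only the absolute value of the half trace; an even
character series does not see the sign. -/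
theorem centralSO3_doubleCover (b : ℕ → ℝ) (g : SU2) :
    centralSO3 b (doubleCover g) = centralSU2 (evenPart b) g := by
  have h : (1 + (doubleCover g).1.trace) / 4 = halfTrace g ^ 2 := by
    rw [trace_doubleCover]
    ring
  rw [centralSO3, h, Real.sqrt_sq_eq_abs, centralSU2]
  rcases abs_choice (halfTrace g) with h | h
  · rw [h]
  · rw [h, charSeries_evenPart_neg]

theorem centralSO3_one (b : ℕ → ℝ) : centralSO3 b 1 = charSeries (evenPart b) 1 := by
  rw [← map_one doubleCover, centralSO3_doubleCover, centralSU2, halfTrace_one]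

theorem RapidDecay.continuous_centralSO3 (hb : RapidDecay b) : Continuous (centralSO3 b) := by
  refine hb.evenPart.continuousOn_charSeries.comp_continuous
    (f := fun R : SO3 => √((1 + R.1.trace) / 4)) ?_ fun R => ?_
  · exact ((continuous_const.add continuous_subtype_val.matrix_trace).div_const _).sqrt
  · obtain ⟨g, rfl⟩ := doubleCover_surjective R
    have hg := halfTrace_mem g
    refine ⟨by linarith [Real.sqrt_nonneg ((1 + (doubleCover g).1.trace) / 4)], ?_⟩
    rw [Real.sqrt_le_iff, trace_doubleCover]
    exact ⟨zero_le_one, by nlinarith [hg.1, hg.2]⟩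

end EvenPart

/-! ### Transfer of Haar measure and representations along the double cover -/

section Pullback

/-- Normalized Haar measure of `SO(3)`. -/
noncomputable abbrev haarSO3 : Measure SO3 :=
  Measure.haarMeasure (⊤ : TopologicalSpace.PositiveCompacts SO3)

theorem map_doubleCover_haarSU2 : haarSU2.map doubleCover = haarSO3 := by
  have h1 : (haarSU2.map doubleCover).IsHaarMeasure :=
    Measure.isHaarMeasure_map_of_isFiniteMeasure haarSU2 doubleCover continuous_doubleCover
      doubleCover_surjective
  have h2 : IsProbabilityMeasure (haarSU2.map doubleCover) :=
    Measure.isProbabilityMeasure_map continuous_doubleCover.aemeasurable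
  exact Measure.isHaarMeasure_eq_of_isProbabilityMeasure _ _

variable {d : ℕ} (π : UnitaryIrrep SO3 d)

/-- The pullback of a representation of `SO(3)` to `SU(2)`. -/
noncomputable def UnitaryIrrep.pullback : UnitaryIrrep SU2 d where
  toHom := π.toHom.comp doubleCover
  continuous_toHom := π.continuous_toHom.comp continuous_doubleCover
  dim_pos := π.dim_pos
  irreducible W hW := π.irreducible W fun R v hv => by
    obtain ⟨g, rfl⟩ := doubleCover_surjective R
    exact hW g v hv

theorem UnitaryIrrep.derived_pullback (k : Fin 3) :
    π.pullback.derived (frameSU2 k) = (-2 : ℝ) • π.derived (frameSO3 k) := by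
  ext i j
  have h : ∀ s, (π.pullback.toHom (frameSU2 k s)).1 i j
      = (π.toHom (frameSO3 k (-2 * s))).1 i j := fun s => by
    rw [← doubleCover_frame]
    rfl
  rw [Matrix.smul_apply, UnitaryIrrep.derived, UnitaryIrrep.derived, Matrix.of_apply,
    Matrix.of_apply]
  simp only [h]
  rw [deriv_comp_mul_left (-2) (fun s => (π.toHom (frameSO3 k s)).1 i j) 0, mul_zero]

theorem UnitaryIrrep.casimir_pullback {κ : ℝ}
    (hκ : π.casimir frameSO3 = (-κ : ℂ) • (1 : Matrix (Fin d) (Fin d) ℂ)) :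
    π.pullback.casimir frameSU2 = (-(4 * κ : ℝ) : ℂ) • (1 : Matrix (Fin d) (Fin d) ℂ) := by
  have h : π.pullback.casimir frameSU2 = (4 : ℝ) • π.casimir frameSO3 := by
    rw [UnitaryIrrep.casimir, UnitaryIrrep.casimir, Finset.smul_sum]
    refine Finset.sum_congr rfl fun k _ => ?_
    rw [π.derived_pullback, Matrix.smul_mul, Matrix.mul_smul, smul_smul]
    norm_num
  rw [h, hκ, ← Complex.coe_smul, smul_smul]
  congr 1
  push_cast
  ring

theorem neg_one_mem_su2 : (-1 : Matrix (Fin 2) (Fin 2) ℂ) ∈ Matrix.specialUnitaryGroup (Fin 2) ℂ := by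
  rw [Matrix.mem_specialUnitaryGroup_iff, Matrix.mem_unitaryGroup_iff]
  refine ⟨by simp, by simp [Matrix.det_fin_two]⟩

/-- Only even characters of `SU(2)` descend to `SO(3)`. -/
theorem UnitaryIrrep.even_of_pullback {m : ℕ}
    (hm : ∀ g, (π.pullback.toHom g).1.trace = d * (chebU m (halfTrace g) / (m + 1) : ℝ)) :
    Even m := by
  by_contra hodd
  -- The element -1 lies in the kernel of the cover, so its trace is d, while the character formula
  -- gives (-1)^m d.
  set z : SU2 := ⟨-1, neg_one_mem_su2⟩ with hz
  have hcov : doubleCover z = 1 := by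
    refine Subtype.ext ?_
    rw [doubleCover_val]
    have h1 : halfTrace z = -1 := by simp [halfTrace, hz]
    have h2 : ∀ k, vecPart k z = 0 := fun k => by fin_cases k <;> simp [vecPart, hz]
    rw [h1, h2, h2, h2, quatRotation_real]
    simp
  have h1 := hm z
  have h2 : (π.pullback.toHom z).1 = 1 := by
    change (π.toHom (doubleCover z)).1 = 1
    rw [hcov, map_one]
    rfl
  have h3 : halfTrace z = -1 := by simp [halfTrace, hz]
  have hm1 : ((m : ℝ) + 1) ≠ 0 := by positivity
  rw [h2, Matrix.trace_one, Fintype.card_fin, h3, chebU_neg, chebU_at_one,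
    (Nat.not_even_iff_odd.1 hodd).neg_one_pow, neg_one_mul, neg_div, div_self hm1] at h1
  have hd : (d : ℂ) ≠ 0 := Nat.cast_ne_zero.2 π.dim_pos.ne'
  push_cast at h1
  have : (2 : ℂ) * d = 0 := by linear_combination h1
  simp [hd] at this

variable {b : ℕ → ℝ}

theorem centralSO3_nonneg (hb : RapidDecay b) (hpos : CharNonneg b) (R : SO3) :
    0 ≤ centralSO3 b R := by
  obtain ⟨g, rfl⟩ := doubleCover_surjective R
  rw [centralSO3_doubleCover]
  exact hpos.evenPart hb _ (halfTrace_mem g)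

theorem UnitaryIrrep.fourier_centralSO3 (hb : RapidDecay b) (hpos : CharNonneg b) :
    π.fourier (haarSO3.withDensity fun R => ENNReal.ofReal (centralSO3 b R)) =
      π.pullback.fourier
        (haarSU2.withDensity fun g => ENNReal.ofReal (centralSU2 (evenPart b) g)) := by
  ext i j
  rw [π.fourier_withDensity _ hb.continuous_centralSO3 (centralSO3_nonneg hb hpos),
    π.pullback.fourier_withDensity _ hb.evenPart.continuous_centralSU2
      (fun g => hpos.evenPart hb _ (halfTrace_mem g)), ← map_doubleCover_haarSU2]
  refine (integral_map continuous_doubleCover.aemeasurable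
    ((Complex.continuous_ofReal.comp hb.continuous_centralSO3).mul
      (π.continuous_entry i j)).aestronglyMeasurable).trans ?_
  refine integral_congr_ae (ae_of_all _ fun g => ?_)
  exact congrArg (fun x : ℝ => (x : ℂ) * (π.toHom (doubleCover g)).1 i j)
    (centralSO3_doubleCover b g)

theorem isProbabilityMeasure_centralSO3 (hb : RapidDecay b) (hpos : CharNonneg b) (h0 : b 0 = 1) :
    IsProbabilityMeasure (haarSO3.withDensity fun R => ENNReal.ofReal (centralSO3 b R)) := by
  have h := (isProbabilityMeasure_centralSU2 hb.evenPart (hpos.evenPart hb)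
    (by rw [evenPart, if_pos Even.zero, h0])).measure_univ
  refine ⟨?_⟩
  rw [withDensity_apply _ MeasurableSet.univ, setLIntegral_univ] at h ⊢
  rw [← map_doubleCover_haarSU2, lintegral_map
    hb.continuous_centralSO3.measurable.ennreal_ofReal continuous_doubleCover.measurable]
  simpa only [centralSO3_doubleCover] using h

/-- The candidate for the semigroup on `SO(3)` whose exponent is `u ↦ η (2 u)`. -/
noncomputable def semigroupSO3 (η : ℝ → ℝ) (t : ℝ) : Measure SO3 :=
  if 0 < t then haarSO3.withDensity fun R => ENNReal.ofReal (centralSO3 (semigroupCoeff η t) R)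
  else Measure.dirac 1

variable {η : ℝ → ℝ}

theorem isContinuousDensity_semigroupSO3 (hb : ∀ t, 0 < t → RapidDecay (semigroupCoeff η t))
    (hpos : ∀ t, 0 < t → CharNonneg (semigroupCoeff η t)) :
    IsContinuousDensity (semigroupSO3 η) fun t => centralSO3 (semigroupCoeff η t) := fun t ht =>
  ⟨(hb t ht).continuous_centralSO3, centralSO3_nonneg (hb t ht) (hpos t ht), if_pos ht⟩

/-- A Casimir value κ on `SO(3)` lifts to 4κ = m(m + 2), so √(m(m + 2)) = 2√κ and the exponent seen
on `SO(3)` is u ↦ η(2u). -/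
theorem isInducedSemigroup_semigroupSO3 {η' : ℝ → ℝ} (hη : ∀ u, η (2 * u) = η' u) (h0 : η 0 = 0)
    (hb : ∀ t, 0 < t → RapidDecay (semigroupCoeff η t))
    (hpos : ∀ t, 0 < t → CharNonneg (semigroupCoeff η t)) :
    IsInducedSemigroup frameSO3 η' (semigroupSO3 η) := by
  refine faithfulFrameSO3.isInducedSemigroup (fun t _ => ?_) (if_neg (lt_irrefl 0))
    fun t ht d π κ hκ => ?_
  · unfold semigroupSO3
    split_ifs with ht
    · exact isProbabilityMeasure_centralSO3 (hb t ht) (hpos t ht) (by simp [semigroupCoeff, h0])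
    · infer_instance
  · rcases ht.lt_or_eq with ht | rfl
    · obtain ⟨m, h4, hm⟩ := π.pullback.exists_character (π.casimir_pullback hκ)
      have hsqrt : √((m : ℝ) * (m + 2)) = 2 * √κ := by
        rw [← h4, Real.sqrt_mul (by norm_num), show (4 : ℝ) = 2 ^ 2 by norm_num,
          Real.sqrt_sq (by norm_num)]
      rw [semigroupSO3, if_pos ht, π.fourier_centralSO3 (hb t ht) (hpos t ht),
        π.pullback.fourier_centralSU2 (hb t ht).evenPart ((hpos t ht).evenPart (hb t ht)) hm,
        evenPart, if_pos (π.even_of_pullback hm), semigroupCoeff, hsqrt, hη]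
    · rw [semigroupSO3, if_neg (lt_irrefl 0), π.fourier_dirac_one]
      simp

theorem hasDensityAsymptotics_SO3 {η' a : ℝ → ℝ} (hη : ∀ u, η (2 * u) = η' u) (h0 : η 0 = 0)
    (hb : ∀ t, 0 < t → RapidDecay (semigroupCoeff η t))
    (hpos : ∀ t, 0 < t → CharNonneg (semigroupCoeff η t))
    (ha : (fun t => charSeries (evenPart (semigroupCoeff η t)) 1) ~[𝓝[>] 0] a) :
    HasDensityAsymptotics frameSO3 η' a :=
  faithfulFrameSO3.hasDensityAsymptotics (isInducedSemigroup_semigroupSO3 hη h0 hb hpos)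
    (isContinuousDensity_semigroupSO3 hb hpos) (by simpa only [centralSO3_one] using ha)

end Pullback
end CompactLie

namespace CompactLie

/-! ### Cauchy, heat and relativistic semigroups -/

section Examples

theorem charNonneg_cauchy {σ t : ℝ} (hσ : 0 < σ) (ht : 0 < t) :
    CharNonneg (semigroupCoeff (cauchyExponent σ) t) := by
  have h := PosMultiplier.relativistic (mul_pos ht hσ).le 0
  -- The Cauchy semigroup is the massless case m = 0, run for time tσ.
  have heq : semigroupCoeff (cauchyExponent σ) t
      = fun n : ℕ => Real.exp (-(t * σ) * (√(0 ^ 2 + n * (n + 2)) - 0)) := by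
    ext n
    rw [semigroupCoeff, cauchyExponent, abs_of_nonneg (Real.sqrt_nonneg _)]
    ring_nf
  exact (heq ▸ h).charNonneg ((cauchy_comparable hσ).rapidDecay one_ne_zero ht)

theorem charNonneg_gauss {σ t : ℝ} (hσ : 0 < σ) (ht : 0 < t) :
    CharNonneg (semigroupCoeff (gaussExponent σ) t) := by
  have h := PosMultiplier.heat (t := t * σ ^ 2 / 2) (by positivity)
  have heq : semigroupCoeff (gaussExponent σ) t
      = fun n : ℕ => Real.exp (-(t * σ ^ 2 / 2) * (n * (n + 2))) := by
    ext n
    rw [semigroupCoeff, gaussExponent, Real.sq_sqrt (by positivity)]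
    ring_nf
  exact (heq ▸ h).charNonneg ((gauss_comparable hσ).rapidDecay two_ne_zero ht)

theorem charNonneg_relativistic {m t : ℝ} (hm : 0 < m) (ht : 0 < t) :
    CharNonneg (semigroupCoeff (relativisticExponent m) t) := by
  have h := PosMultiplier.relativistic ht.le m
  have heq : semigroupCoeff (relativisticExponent m) t
      = fun n : ℕ => Real.exp (-t * (√(m ^ 2 + n * (n + 2)) - m)) := by
    ext n
    rw [semigroupCoeff, relativisticExponent, Real.sq_sqrt (by positivity)]
  exact (heq ▸ h).charNonneg ((relativistic_comparable hm).rapidDecay one_ne_zero ht)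

theorem cauchy_SU2 {σ : ℝ} (hσ : 0 < σ) :
    HasDensityAsymptotics frameSU2 (cauchyExponent σ) (fun t => 2 / (σ ^ 3 * t ^ 3)) := by
  have H := cauchy_comparable hσ
  refine hasDensityAsymptotics_SU2 (by simp [cauchyExponent])
    (fun t ht => H.rapidDecay one_ne_zero ht) (fun t ht => charNonneg_cauchy hσ ht)
    (isEquivalent_of_tendsto_cube_mul (c := 2) two_pos H.pos ?_ fun t _ => by rw [mul_pow])
  simpa using H.tendsto_charSeries one_ne_zero

theorem relativistic_SU2 {m : ℝ} (hm : 0 < m) :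
    HasDensityAsymptotics frameSU2 (relativisticExponent m) (fun t => 2 / t ^ 3) := by
  have H := relativistic_comparable hm
  refine hasDensityAsymptotics_SU2 (by simp [relativisticExponent, Real.sqrt_sq hm.le])
    (fun t ht => H.rapidDecay one_ne_zero ht) (fun t ht => charNonneg_relativistic hm ht)
    (isEquivalent_of_tendsto_cube_mul (c := 2) two_pos H.pos ?_ fun t _ => rfl)
  simpa using H.tendsto_charSeries one_ne_zero

theorem gauss_SU2 {σ : ℝ} (hσ : 0 < σ) :
    HasDensityAsymptotics frameSU2 (gaussExponent σ)
      (fun t => √(Real.pi / 2) / σ ^ 3 * t ^ (-(3 / 2) : ℝ)) := by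
  have H := gauss_comparable hσ
  refine hasDensityAsymptotics_SU2 (by simp [gaussExponent])
    (fun t ht => H.rapidDecay two_ne_zero ht) (fun t ht => charNonneg_gauss hσ ht)
    (isEquivalent_of_tendsto_cube_mul (c := √Real.pi / 4) (by positivity) H.pos ?_
      fun t ht => gauss_rate hσ ht)
  convert H.tendsto_charSeries two_ne_zero using 2
  rw [Nat.cast_ofNat, gamma_three_halves]
  ring

theorem cauchy_SO3 {σ : ℝ} (hσ : 0 < σ) :
    HasDensityAsymptotics frameSO3 (cauchyExponent σ) (fun t => 8 / (σ ^ 3 * t ^ 3)) := by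
  have H := cauchy_comparable (half_pos hσ)
  refine hasDensityAsymptotics_SO3 (η := cauchyExponent (σ / 2)) (fun u => ?_)
    (by simp [cauchyExponent])
    (fun t ht => H.rapidDecay one_ne_zero ht) (fun t ht => charNonneg_cauchy (half_pos hσ) ht)
    -- The constant is half of Γ(3) = 2, and the scale h = σt/2 produces the 8.
    (isEquivalent_of_tendsto_cube_mul (c := 1) one_pos H.pos ?_ fun t ht => ?_)
  · rw [cauchyExponent, cauchyExponent, abs_mul, abs_two]
    ring
  · simpa using H.tendsto_charSeries_evenPart one_ne_zero
  · field_simp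
    norm_num

theorem gauss_SO3 {σ : ℝ} (hσ : 0 < σ) :
    HasDensityAsymptotics frameSO3 (gaussExponent σ)
      (fun t => 2 * √(2 * Real.pi) / σ ^ 3 * t ^ (-(3 / 2) : ℝ)) := by
  have H := gauss_comparable (half_pos hσ)
  refine hasDensityAsymptotics_SO3 (η := gaussExponent (σ / 2)) (fun u => ?_)
    (by simp [gaussExponent])
    (fun t ht => H.rapidDecay two_ne_zero ht) (fun t ht => charNonneg_gauss (half_pos hσ) ht)
    -- Here √π/4 = Γ(3/2)/2, halved again because only even n occur.
    (isEquivalent_of_tendsto_cube_mul (c := √Real.pi / 4 / 2) (by positivity) H.pos ?_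
      fun t ht => ?_)
  · rw [gaussExponent, gaussExponent]
    ring
  · convert H.tendsto_charSeries_evenPart two_ne_zero using 2
    rw [Nat.cast_ofNat, gamma_three_halves]
    ring
  · rw [div_right_comm, ← gauss_rate (half_pos hσ) ht,
      show 2 * Real.pi = 2 ^ 2 * (Real.pi / 2) by ring, Real.sqrt_mul (by positivity),
      Real.sqrt_sq two_pos.le]
    field_simp

theorem rpow_isLittleO_inv_cube {A B C : ℝ} (hB : B ≠ 0) (hC : C ≠ 0) :
    (fun t : ℝ => A * t ^ (-(3 / 2) : ℝ)) =o[𝓝[>] 0] fun t => B / (C * t ^ 3) := by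
  refine isLittleO_of_tendsto' ?_ ?_
  · filter_upwards [self_mem_nhdsWithin] with t ht h
    have ht0 : t ≠ 0 := (Set.mem_Ioi.1 ht).ne'
    exact absurd h (by positivity)
  · have h : Tendsto (fun t : ℝ => A * C / B * t ^ (3 / 2 : ℝ)) (𝓝[>] 0) (𝓝 0) := by
      have := ((Real.continuous_rpow_const (q := 3 / 2) (by norm_num)).tendsto 0).const_mul
        (A * C / B)
      rw [Real.zero_rpow (by norm_num), mul_zero] at this
      exact this.mono_left nhdsWithin_le_nhds
    refine h.congr' ?_
    filter_upwards [self_mem_nhdsWithin] with t ht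
    have ht : 0 < t := ht
    have h3 : t ^ (-(3 / 2) : ℝ) * t ^ 3 = t ^ (3 / 2 : ℝ) := by
      rw [← Real.rpow_natCast, ← Real.rpow_add ht]
      norm_num
    rw [← h3]
    field_simp

variable {G : Type} [Group G] [TopologicalSpace G] [MeasurableSpace G] [IsTopologicalGroup G]
  [CompactSpace G] [BorelSpace G]

theorem HasDensityAsymptotics.isLittleO {x : Fin 3 → ℝ → G} {η η' a a' : ℝ → ℝ}
    (H : HasDensityAsymptotics x η a) (H' : HasDensityAsymptotics x η' a')
    (ha : a' =o[𝓝[>] 0] a) {μ ν : ℝ → Measure G} {k h : ℝ → G → ℝ}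
    (hμ : IsInducedSemigroup x η μ) (hk : IsContinuousDensity μ k)
    (hν : IsInducedSemigroup x η' ν) (hh : IsContinuousDensity ν h) :
    (fun t => h t 1) =o[𝓝[>] 0] (fun t => k t 1) :=
  (((H'.2 ν hν).2 h hh).isBigO.trans_isLittleO ha).trans_isBigO ((H.2 μ hμ).2 k hk).isBigO_symm

end Examples
end CompactLie

theorem mainTheorem9 :
    -- Cauchy semigroups on `SU(2)` and `SO(3)`
    (∀ σ : ℝ, 0 < σ →
      HasDensityAsymptotics frameSU2 (cauchyExponent σ) (fun t => 2 / (σ ^ 3 * t ^ 3))) ∧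
    (∀ σ : ℝ, 0 < σ →
      HasDensityAsymptotics frameSO3 (cauchyExponent σ) (fun t => 8 / (σ ^ 3 * t ^ 3))) ∧
    -- heat semigroups
    (∀ σ : ℝ, 0 < σ →
      HasDensityAsymptotics frameSU2 (gaussExponent σ)
        (fun t => √(Real.pi / 2) / σ ^ 3 * t ^ (-(3 / 2) : ℝ))) ∧
    (∀ σ : ℝ, 0 < σ →
      HasDensityAsymptotics frameSO3 (gaussExponent σ)
        (fun t => 2 * √(2 * Real.pi) / σ ^ 3 * t ^ (-(3 / 2) : ℝ))) ∧
    -- the heat kernel at the identity is negligible against the Cauchy density at the identity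
    (∀ σ τ : ℝ, 0 < σ → 0 < τ → ∀ (μ ν : ℝ → Measure SU2) (k h : ℝ → SU2 → ℝ),
      IsInducedSemigroup frameSU2 (cauchyExponent σ) μ → IsContinuousDensity μ k →
      IsInducedSemigroup frameSU2 (gaussExponent τ) ν → IsContinuousDensity ν h →
        (fun t => h t 1) =o[𝓝[>] 0] (fun t => k t 1)) ∧
    (∀ σ τ : ℝ, 0 < σ → 0 < τ → ∀ (μ ν : ℝ → Measure SO3) (k h : ℝ → SO3 → ℝ),
      IsInducedSemigroup frameSO3 (cauchyExponent σ) μ → IsContinuousDensity μ k →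
      IsInducedSemigroup frameSO3 (gaussExponent τ) ν → IsContinuousDensity ν h →
        (fun t => h t 1) =o[𝓝[>] 0] (fun t => k t 1)) ∧
    -- relativistic Schrödinger semigroup on `SU(2)`: same asymptotics as Cauchy with `σ = 1`
    (∀ m : ℝ, 0 < m →
      HasDensityAsymptotics frameSU2 (relativisticExponent m) (fun t => 2 / t ^ 3)) := by
  refine ⟨fun σ hσ => cauchy_SU2 hσ, fun σ hσ => cauchy_SO3 hσ, fun σ hσ => gauss_SU2 hσ,
    fun σ hσ => gauss_SO3 hσ, fun σ τ hσ hτ μ ν k h hμ hk hν hh => ?_,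
    fun σ τ hσ hτ μ ν k h hμ hk hν hh => ?_, fun m hm => relativistic_SU2 hm⟩
  · exact (cauchy_SU2 hσ).isLittleO (gauss_SU2 hτ)
      (rpow_isLittleO_inv_cube two_ne_zero (by positivity)) hμ hk hν hh
  · exact (cauchy_SO3 hσ).isLittleO (gauss_SO3 hτ)
      (rpow_isLittleO_inv_cube (by norm_num) (by positivity)) hμ hk hν hh
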